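/- Let $\mathfrak n$ be a Lie algebra of nilpotent real $m\times m$ matrices, let $N=\exp\mathfrak n\subset GL(m,\mathbb R)$, and let $\{X_1,\dots,X_n\}$ be a strong Malcev basis of $\mathfrak n$, i.e. a basis such that each $\mathfrak n_i=\operatorname{span}_{\mathbb R}\{X_1,\dots,X_i\}$ is an ideal of $\mathfrak n$. Assume that $\Gamma=\exp\mathbb ZX_1\exp\mathbb ZX_2\cdots\exp\mathbb ZX_n$ is a subgroup of $N$. Let $A$ be an automorphism of the Lie algebra $\mathfrak n$ that is diagonal in this basis, $AX_k=a_kX_k$ with $a_k\in\mathbb R$, let $\alpha$ be the automorphism of $N$ with $\alpha(\exp X)=\exp AX$ for all $X\in\mathfrak n$, and let $\Gamma_\alpha$ be the subgroup of $N$ generated by $\bigcup_{k\in\mathbb Z}\alpha^k(\Gamma)$. For $\lambda\in\mathfrak n^*$ put $\mathfrak n_i(\lambda)=\{Y\in\mathfrak n_i:\lambda[X,Y]=0\text{ for all }X\in\mathfrak n_i\}$, $\mathfrak p(\lambda)=\sum_{i=1}^n\mathfrak n_i(\lambda)$, $P(\lambda)=\exp\mathfrak p(\lambda)$ and $\chi_\lambda(\exp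 Y)=e^{2\pi i\lambda(Y)}$ for $Y\in\mathfrak p(\lambda)$. Let $\{j_1<\dots<j_d\}$ be the set of indices $k$ with $X_k\notin\mathfrak n_{k-1}+\mathfrak p(\lambda)$, and put $c(t)=\exp t_1X_{j_1}\cdots\exp t_dX_{j_d}$ for $t\in\mathbb R^d$. Let $\pi_\lambda$ be the representation of $N$ induced from $P(\lambda)$ by $\chi_\lambda$, realized on $L^2(\mathbb R^d)$: a function $g:N\to\mathbb C$ with $g(xp)=\chi_\lambda(p)^{-1}g(x)$ for $x\in N$, $p\in P(\lambda)$ and $g\circ c\in L^2(\mathbb R^d)$ is identified with $g\circ c$, and $\pi_\lambda(y)g(x)=g(y^{-1}x)$. Suppose that $A$ is expansive, i.e. all its eigenvalues have absolute value strictly greater than one. Then for every $\lambda\in\mathfrak n^*$ (in particular for every $\lambda$ in any cross-section $\Lambda\subset\mathfrak n^*$ of the generic coadjoint orbits) these formulas determine exactly one unitary representation $\pi_\lambda$ of $N$ on $L^2(\mathbb R^d)$; it is strongly continuous and irreducible, and its restriction $\pi_\lambda|_{\Gamma_\alpha}$ to $\Gamma_\alpha$ is irreducible. -/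

import Mathlib

open MeasureTheory

-- matrices with the commutator bracket
attribute [local instance] LieRing.ofAssociativeRing

noncomputable section

namespace WaveletRep

/-- The matrix exponential, as an element of `GL(m, ℝ)`. -/
def expGL {m : ℕ} (X : Matrix (Fin m) (Fin m) ℝ) : GL (Fin m) ℝ where
  val := NormedSpace.exp X
  inv := NormedSpace.exp (-X)
  val_inv := by
    rw [← Matrix.exp_add_of_commute X (-X) (Commute.neg_right (Commute.refl X)), add_neg_cancel,
      NormedSpace.exp_zero]
  inv_val := by
    rw [← Matrix.exp_add_of_commute (-X) X (Commute.neg_left (Commute.refl X)), neg_add_cancel,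
      NormedSpace.exp_zero]

variable {m n : ℕ} {𝔫 : LieSubalgebra ℝ (Matrix (Fin m) (Fin m) ℝ)}

/-- The analytic subgroup `N` of `GL(m, ℝ)` with Lie algebra `𝔫`: the subgroup generated by
`exp 𝔫`.  (When `𝔫` consists of nilpotent matrices it is equal to the set `exp 𝔫`.) -/
def lieGroup (𝔫 : LieSubalgebra ℝ (Matrix (Fin m) (Fin m) ℝ)) : Subgroup (GL (Fin m) ℝ) :=
  Subgroup.closure (Set.range fun X : 𝔫 => expGL (X : Matrix (Fin m) (Fin m) ℝ))

/-- The exponential map `exp : 𝔫 → N`. -/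
def expN (X : 𝔫) : lieGroup 𝔫 :=
  ⟨expGL (X : Matrix (Fin m) (Fin m) ℝ), Subgroup.subset_closure ⟨X, rfl⟩⟩

/-- `flag X i` is the span of the first `i` vectors of the basis `X`. -/
def flag (X : Module.Basis (Fin n) ℝ 𝔫) (i : ℕ) : Submodule ℝ 𝔫 :=
  Submodule.span ℝ (X '' {k | (k : ℕ) < i})

/-- A basis is a strong Malcev basis if each `flag X i` is an ideal. -/
def IsStrongMalcev (X : Module.Basis (Fin n) ℝ 𝔫) : Prop :=
  ∀ i : ℕ, ∀ Z : 𝔫, ∀ Y ∈ flag X i, ⁅Z, Y⁆ ∈ flag X i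

/-- `exp (t₁ X₁) exp (t₂ X₂) ⋯ exp (tₙ Xₙ)`, the factors in increasing order of the index. -/
def malcevCoord (X : Module.Basis (Fin n) ℝ 𝔫) (t : Fin n → ℝ) : lieGroup 𝔫 :=
  ((List.finRange n).map fun k => expN (t k • X k)).prod

/-- `𝔫ᵢ(λ)`: the radical of the form `(X, Y) ↦ λ[X, Y]` restricted to `𝔫ᵢ = flag X i`. -/
def radical (X : Module.Basis (Fin n) ℝ 𝔫) (l : Module.Dual ℝ 𝔫) (i : ℕ) : Submodule ℝ 𝔫 where
  carrier := {Y | Y ∈ flag X i ∧ ∀ Z ∈ flag X i, l ⁅Z, Y⁆ = 0}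
  zero_mem' := ⟨Submodule.zero_mem _, fun Z _ => by simp⟩
  add_mem' := fun {a b} ha hb => ⟨Submodule.add_mem _ ha.1 hb.1, fun Z hZ => by
    rw [lie_add, map_add, ha.2 Z hZ, hb.2 Z hZ, add_zero]⟩
  smul_mem' := fun c a ha => ⟨Submodule.smul_mem _ c ha.1, fun Z hZ => by
    rw [lie_smul, map_smul, ha.2 Z hZ, smul_zero]⟩

/-- The polarizing subalgebra `𝔭(λ) = 𝔫₁(λ) + ⋯ + 𝔫ₙ(λ)`; `P(λ) = exp 𝔭(λ)`. -/
def polarization (X : Module.Basis (Fin n) ℝ 𝔫) (l : Module.Dual ℝ 𝔫) : Submodule ℝ 𝔫 :=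
  ⨆ k : Fin n, radical X l ((k : ℕ) + 1)

open Classical in
/-- The index set `𝐣 = {j₁ < ⋯ < j_d}`: the indices at which the flag jumps modulo `𝔭(λ)`, so
that the `X_j`, `j ∈ 𝐣`, span a complement of `𝔭(λ)`. -/
def jumpSet (X : Module.Basis (Fin n) ℝ 𝔫) (l : Module.Dual ℝ 𝔫) : Finset (Fin n) :=
  Finset.univ.filter fun k => X k ∉ flag X k ⊔ polarization X l

open Classical in
/-- The section `(t₁, …, t_d) ↦ exp (t₁ X_{j₁}) ⋯ exp (t_d X_{j_d})` of `N → N / P(λ)`. -/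
def crossSection (X : Module.Basis (Fin n) ℝ 𝔫) (l : Module.Dual ℝ 𝔫) (t : jumpSet X l → ℝ) :
    lieGroup 𝔫 :=
  malcevCoord X fun k => if h : k ∈ jumpSet X l then t ⟨k, h⟩ else 0

/-- The Hilbert space `L²(ℝᵈ)` with Lebesgue measure, the coordinates of `ℝᵈ` being indexed by
the `d`-element set `𝐣`. -/
abbrev L2 (X : Module.Basis (Fin n) ℝ 𝔫) (l : Module.Dual ℝ 𝔫) : Type :=
  Lp ℂ 2 (volume : Measure (jumpSet X l → ℝ))

/-- `g(xp) = χ_λ(p)⁻¹ g(x)` for `x ∈ N` and `p ∈ P(λ)`, with `χ_λ(exp Y) = e^{2πi λ(Y)}` for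
`Y ∈ 𝔭(λ)`. -/
def IsEquivariant (X : Module.Basis (Fin n) ℝ 𝔫) (l : Module.Dual ℝ 𝔫) (g : lieGroup 𝔫 → ℂ) :
    Prop :=
  ∀ x : lieGroup 𝔫, ∀ Y ∈ polarization X l,
    g (x * expN Y) = Complex.exp (-(2 * Real.pi * Complex.I * (l Y : ℂ))) * g x

/-- `π` is the representation of `N` induced from `P(λ)` by `χ_λ`, realized on `L²(ℝᵈ)`: an
equivariant function `g` on `N` that is square integrable along the cross-section is identified
with its restriction to the cross-section, and `π(y)` is the left translation
`g ↦ g(y⁻¹ ·)`. -/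
def IsInducedRep (X : Module.Basis (Fin n) ℝ 𝔫) (l : Module.Dual ℝ 𝔫)
    (π : lieGroup 𝔫 →* (L2 X l ≃ₗᵢ[ℂ] L2 X l)) : Prop :=
  ∀ (y : lieGroup 𝔫) (g : lieGroup 𝔫 → ℂ), IsEquivariant X l g →
    ∀ hg : MemLp (fun t => g (crossSection X l t)) 2 (volume : Measure (jumpSet X l → ℝ)),
      (π y (hg.toLp _) : (jumpSet X l → ℝ) → ℂ) =ᵐ[volume]
        fun t => g (y⁻¹ * crossSection X l t)

/-- Strong continuity of a unitary representation. -/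
def IsStronglyContinuous {G H : Type*} [Group G] [TopologicalSpace G] [NormedAddCommGroup H]
    [InnerProductSpace ℂ H] (π : G →* (H ≃ₗᵢ[ℂ] H)) : Prop :=
  ∀ f : H, Continuous fun x => π x f

/-- Irreducibility of a unitary representation: the space is nonzero and there is no closed
invariant subspace besides `0` and the whole space. -/
def IsIrreducibleRep {G H : Type*} [Group G] [NormedAddCommGroup H] [InnerProductSpace ℂ H]
    (π : G →* (H ≃ₗᵢ[ℂ] H)) : Prop :=
  Nontrivial H ∧ ∀ V : Submodule ℂ H, IsClosed (V : Set H) →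
    (∀ x : G, ∀ f ∈ V, π x f ∈ V) → V = ⊥ ∨ V = ⊤

/-- A real square matrix is expansive if all its (complex) eigenvalues have absolute value
greater than one. -/
def IsExpansive (M : Matrix (Fin n) (Fin n) ℝ) : Prop :=
  ∀ z ∈ spectrum ℂ (M.map (algebraMap ℝ ℂ)), 1 < ‖z‖

/-- `Γ_α`: the subgroup generated by the sets `α^k(Γ)`, `k ∈ ℤ`. -/
def dilationClosure {G : Type*} [Group G] (α : MulAut G) (Γ : Subgroup G) : Subgroup G :=
  Subgroup.closure (⋃ k : ℤ, (fun x => (α ^ k) x) '' (Γ : Set G))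

end WaveletRep

end

/-! Existence and uniqueness. The form `λ[·,·]` vanishes on the subalgebra `𝔭(λ)`, so `P(λ)` is a
group and `χ_λ` a character of it. Each `x ∈ N` is uniquely `c(t) p` with `t = secCoord x` and `p =
polPart x ∈ P(λ)`, both continuous in `x`. Hence equivariant functions on `N` correspond to
arbitrary functions on `ℝᵈ`, and `N` acts on `ℝᵈ` by triangular maps: each coordinate is translated
by an amount that depends on the later ones. Such maps preserve Lebesgue measure, so left
translation is unitary.

Irreducibility. `𝔭(λ)` is the last term of a chain of subalgebras `𝔥₀ = 𝔫 ⊇ 𝔥₁ ⊇ ⋯ ⊇ 𝔥ₙ`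
(`orthChain`) in which the dimension drops by at most one, each drop being detected by some `W ∈ 𝔥ᵢ`
and `Y ∈ 𝔥ᵢ ∩ 𝔫ᵢ₊₁` with `λ[W, Y] ≠ 0`. Let all coefficients `⟨g, π(y) f⟩` vanish and let `F`, `G`
be the equivariant functions of `f`, `g`. Then the integral of `F(zh)` times the conjugate of
`G(xh)` over the cosets `h P(λ)` is zero for all `z`, `x`. Write `h = exp(rW) h'` with `h'` in the
next group of the chain. Replacing `z` by `z exp(sY)` inserts the factor `e^{2πi s r λ[W,Y]}`, up to
a constant, so by uniqueness for the Fourier transform the integral over `h'` alone vanishes for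
almost every `r` (`ae_isNullCoeff_of_cons`). At the end of the chain `F(z)` times the conjugate of
`G(x)` is zero almost everywhere, so `f = 0` or `g = 0`. A proper invariant subspace and its
orthogonal complement would contradict this.

Restriction. `Γ_α` contains all `exp(N a_k⁻ⁱ X_k)`. As `|a_k| > 1`, these are dense in the
one-parameter groups, which generate `N`. By strong continuity a closed `Γ_α`-invariant subspace is
`N`-invariant (`mem_of_dilationClosure_invariant`).

The group law is controlled by a Baker–Campbell–Hausdorff theorem modulo commutators
(`logTrunc_exp_mul_exp_mem`), obtained from the differential equation of `log(e^{Xy} e^x)` over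
polynomials in `X`. -/

noncomputable section

namespace WaveletRep

/-! ### Exponentials in an associative algebra and their derivatives. -/

section Algebra

open Finset Polynomial

/-- Evaluation of a polynomial at `1`. -/
def evalOne {A : Type*} [Ring A] : A[X] →+* A :=
  eval₂RingHom' (RingHom.id A) 1 (fun a => Commute.one_right a)

/-- Evaluation of a polynomial at `0`. -/
def evalZero {A : Type*} [Ring A] : A[X] →+* A :=
  eval₂RingHom' (RingHom.id A) 0 (fun a => Commute.zero_right a)

theorem evalOne_apply {A : Type*} [Ring A] (p : A[X]) : evalOne p = p.eval 1 := by
  simp [evalOne, eval₂RingHom', eval₂_eq_sum, eval_eq_sum]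

theorem evalZero_apply {A : Type*} [Ring A] (p : A[X]) : evalZero p = p.coeff 0 := by
  rw [coeff_zero_eq_eval_zero]
  simp [evalZero, eval₂RingHom', eval₂_eq_sum, eval_eq_sum]

variable {A : Type*} [Ring A] [Algebra ℚ A]

/-- The commutator `b ↦ a * b - b * a` as a linear map. -/
def adMap (a : A) : Module.End ℚ A := LinearMap.mulLeft ℚ a + LinearMap.mulRight ℚ (-a)

theorem adMap_apply (a b : A) : adMap a b = a * b - b * a := by simp [adMap, sub_eq_add_neg]

theorem mulLeft_pow_eq_zero {a : A} {K : ℕ} (ha : a ^ K = 0) :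
    (LinearMap.mulLeft ℚ a : Module.End ℚ A) ^ K = 0 := by
  rw [LinearMap.pow_mulLeft, ha]; ext; simp

theorem mulRight_pow_eq_zero {a : A} {K : ℕ} (ha : a ^ K = 0) :
    (LinearMap.mulRight ℚ a : Module.End ℚ A) ^ K = 0 := by
  rw [LinearMap.pow_mulRight, ha]; ext; simp

theorem neg_pow_eq_zero {A : Type*} [Ring A] {a : A} {K : ℕ} (ha : a ^ K = 0) : (-a) ^ K = 0 := by
  rw [neg_pow, ha, mul_zero]

theorem adMap_pow_eq_zero {a : A} {K : ℕ} (ha : a ^ K = 0) : adMap a ^ (2 * K) = 0 :=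
  Commute.add_pow_eq_zero_of_add_le_succ_of_pow_eq_zero (LinearMap.commute_mulLeft_right a (-a))
    (mulLeft_pow_eq_zero ha) (mulRight_pow_eq_zero (neg_pow_eq_zero ha)) (by omega)

theorem exp_mulLeft {a : A} (ha : IsNilpotent a) :
    IsNilpotent.exp (LinearMap.mulLeft ℚ a : Module.End ℚ A) =
      LinearMap.mulLeft ℚ (IsNilpotent.exp a) := by
  obtain ⟨K, hK⟩ := ha
  rw [IsNilpotent.exp_eq_sum (mulLeft_pow_eq_zero hK), IsNilpotent.exp_eq_sum hK]
  ext b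
  simp [LinearMap.pow_mulLeft, Finset.sum_mul]

theorem exp_mulRight {a : A} (ha : IsNilpotent a) :
    IsNilpotent.exp (LinearMap.mulRight ℚ a : Module.End ℚ A) =
      LinearMap.mulRight ℚ (IsNilpotent.exp a) := by
  obtain ⟨K, hK⟩ := ha
  rw [IsNilpotent.exp_eq_sum (mulRight_pow_eq_zero hK), IsNilpotent.exp_eq_sum hK]
  ext b
  simp [LinearMap.pow_mulRight, Finset.mul_sum]

/-- Conjugation by an exponential is the exponential of the commutator. -/
theorem exp_mul_mul_exp_neg {a : A} {K : ℕ} (ha : a ^ K = 0) (b : A) {M : ℕ} (hM : 2 * K ≤ M) :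
    IsNilpotent.exp a * b * IsNilpotent.exp (-a) =
      ∑ j ∈ range M, (j.factorial : ℚ)⁻¹ • (adMap a ^ j) b := by
  have hnil : IsNilpotent a := ⟨K, ha⟩
  -- `adMap a` is the sum of the commuting nilpotent operators `b ↦ ab` and `b ↦ -ba`, so its
  -- exponential is the product of theirs.
  have h3 := IsNilpotent.exp_add_of_commute (A := Module.End ℚ A)
    (LinearMap.commute_mulLeft_right (R := ℚ) a (-a)) ⟨K, mulLeft_pow_eq_zero ha⟩
    ⟨K, mulRight_pow_eq_zero (neg_pow_eq_zero ha)⟩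
  rw [exp_mulLeft hnil, exp_mulRight hnil.neg] at h3
  have h4 : adMap a ^ M = 0 := pow_eq_zero_of_le hM (adMap_pow_eq_zero ha)
  change IsNilpotent.exp (adMap a) = _ at h3
  rw [IsNilpotent.exp_eq_sum h4] at h3
  have h5 := LinearMap.congr_fun h3 b
  simp only [LinearMap.sum_apply, LinearMap.smul_apply] at h5
  rw [h5]
  simp [mul_assoc]

/-- The derivative of a polynomial as a `ℚ`-linear map. -/
def derivQ : Module.End ℚ A[X] := (derivative : A[X] →ₗ[A] A[X]).restrictScalars ℚ

theorem derivative_rat_smul (q : ℚ) (p : A[X]) : derivative (q • p) = q • derivative p :=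
  map_smul (derivQ (A := A)) q p

/-- By Leibniz, the commutator of multiplication by `z` with `d/dX` is multiplication by `-z'`; from
there on the commutators stay among left multiplications. -/
theorem adMap_mulLeft_derivQ (z : A[X]) (j : ℕ) :
    (adMap (LinearMap.mulLeft ℚ z : Module.End ℚ A[X]) ^ (j + 1)) derivQ =
      -LinearMap.mulLeft ℚ ((adMap z ^ j) (derivative z)) := by
  induction j with
  | zero =>
    ext p : 1
    simp [adMap_apply, derivQ, derivative_mul]
  | succ j ih =>
    rw [pow_succ', Module.End.mul_apply, ih, pow_succ' (adMap z), Module.End.mul_apply]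
    ext p : 1
    simp only [adMap_apply, LinearMap.sub_apply, LinearMap.neg_apply, Module.End.mul_apply,
      LinearMap.mulLeft_apply]
    noncomm_ring

/-- The derivative of an exponential: `e^z (e^{-z})' = - ∑ ad_z^j (z') / (j+1)!`. -/
theorem exp_mul_derivative_exp_neg {z : A[X]} {K : ℕ} (hz : z ^ K = 0) {M : ℕ} (hM : 2 * K ≤ M) :
    IsNilpotent.exp z * derivative (IsNilpotent.exp (-z)) =
      -∑ j ∈ range M, ((j + 1).factorial : ℚ)⁻¹ • (adMap z ^ j) (derivative z) := by
  -- The operator `d/dX` is conjugated by multiplication by `e^z`. One extra term is taken because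
  -- the term `j = 0` is `d/dX` itself, which disappears on evaluation at the polynomial `1`.
  have h := exp_mul_mul_exp_neg (A := Module.End ℚ A[X]) (mulLeft_pow_eq_zero hz) derivQ
    (M := M + 1) (by omega)
  have hneg : -(LinearMap.mulLeft ℚ z : Module.End ℚ A[X]) = LinearMap.mulLeft ℚ (-z) := by
    ext; simp
  rw [hneg, exp_mulLeft ⟨K, hz⟩, exp_mulLeft (IsNilpotent.neg ⟨K, hz⟩), sum_range_succ'] at h
  have h5 := LinearMap.congr_fun h 1
  simp only [adMap_mulLeft_derivQ] at h5
  simpa [derivQ, Module.End.mul_apply] using h5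

/-- The derivative of an exponential: `(e^z)' = (∑ ad_z^j (z') / (j+1)!) e^z`. -/
theorem derivative_exp {z : A[X]} {K : ℕ} (hz : z ^ K = 0) {M : ℕ} (hM : 2 * K ≤ M) :
    derivative (IsNilpotent.exp z) =
      (∑ j ∈ range M, ((j + 1).factorial : ℚ)⁻¹ • (adMap z ^ j) (derivative z)) *
        IsNilpotent.exp z := by
  have h1 : derivative (IsNilpotent.exp z * IsNilpotent.exp (-z)) = 0 := by
    rw [IsNilpotent.exp_mul_exp_neg_self ⟨K, hz⟩, derivative_one]
  rw [derivative_mul, exp_mul_derivative_exp_neg hz hM, add_neg_eq_zero] at h1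
  rw [← h1, mul_assoc, IsNilpotent.exp_neg_mul_exp_self ⟨K, hz⟩, mul_one]

theorem derivative_exp_of_commute {z : A[X]} {K : ℕ} (hz : z ^ K = 0)
    (h : Commute z (derivative z)) :
    derivative (IsNilpotent.exp z) = derivative z * IsNilpotent.exp z := by
  rw [derivative_exp hz (M := 2 * K + 1) (by omega), sum_range_succ']
  have : ∀ j, (adMap z ^ (j + 1)) (derivative z) = 0 := fun j => by
    rw [pow_succ, Module.End.mul_apply, adMap_apply, h.eq, sub_self, map_zero]
  simp [this]

/-! ### The truncated logarithm as inverse of the exponential. -/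

/-- The logarithm of a unipotent element, truncated at order `K`. -/
def logTrunc (K : ℕ) (u : A) : A :=
  ∑ i ∈ range K, ((-1) ^ i / (i + 1) : ℚ) • (u - 1) ^ (i + 1)

theorem X_mul_C_pow {A : Type*} [Ring A] (v : A) (i : ℕ) : (X * C v : A[X]) ^ i = X ^ i * C (v ^ i) := by
  rw [(commute_X (C v)).mul_pow, C_pow]

theorem derivative_X_mul_C_pow (v : A) (i : ℕ) :
    derivative ((X * C v : A[X]) ^ (i + 1)) = ((i + 1 : ℕ) : ℚ) • ((X * C v) ^ i * C v) := by
  rw [X_mul_C_pow, X_mul_C_pow, derivative_mul, derivative_C, mul_zero, add_zero,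
    derivative_X_pow, mul_assoc, mul_assoc, ← C_mul, ← pow_succ]
  simp only [C_eq_natCast, Nat.add_sub_cancel]
  rw [Nat.cast_smul_eq_nsmul, nsmul_eq_mul]

theorem eq_C_coeff_of_derivative_eq_zero {p : A[X]} (h : derivative p = 0) :
    p = C (p.coeff 0) := by
  have : IsAddTorsionFree A := IsAddTorsionFree.of_module_rat A
  exact Polynomial.eq_C_of_derivative_eq_zero h

theorem logTrunc_pow_eq_zero {K : ℕ} {u : A} (hu : (u - 1) ^ K = 0) : logTrunc K u ^ K = 0 := by
  have : logTrunc K u = (u - 1) * ∑ i ∈ range K, ((-1) ^ i / (i + 1) : ℚ) • (u - 1) ^ i := by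
    simp [logTrunc, mul_sum, pow_succ']
  rw [this, Commute.mul_pow, hu, zero_mul]
  exact Commute.sum_right _ _ _ fun i _ => ((Commute.refl _).pow_right i).smul_right _

theorem exp_sub_one_pow_eq_zero {K : ℕ} {z : A} (hz : z ^ K = 0) :
    (IsNilpotent.exp z - 1) ^ K = 0 := by
  have h : z ^ (K + 1) = 0 := pow_eq_zero_of_le (Nat.le_succ K) hz
  have : IsNilpotent.exp z - 1 = z * ∑ i ∈ range K, ((i + 1).factorial : ℚ)⁻¹ • z ^ i := by
    rw [IsNilpotent.exp_eq_sum h, sum_range_succ']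
    simp [mul_sum, pow_succ']
  rw [this, Commute.mul_pow, hz, zero_mul]
  exact Commute.sum_right _ _ _ fun i _ => ((Commute.refl _).pow_right i).smul_right _

theorem map_logTrunc {B : Type*} [Ring B] [Algebra ℚ B] (f : A →+* B) (K : ℕ) (u : A) :
    f (logTrunc K u) = logTrunc K (f u) := by
  simp [logTrunc, map_rat_smul]

theorem commute_logTrunc {K : ℕ} {u b : A} (h : Commute u b) : Commute (logTrunc K u) b :=
  Commute.sum_left _ _ _ fun i _ =>
    ((h.sub_left (Commute.one_left b)).pow_left (i + 1)).smul_left _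

theorem commute_exp {z b : A} (h : Commute z b) : Commute (IsNilpotent.exp z) b :=
  Commute.sum_left _ _ _ fun i _ => (h.pow_left i).smul_left _

theorem logTrunc_one (K : ℕ) : logTrunc K (1 : A) = 0 := by simp [logTrunc]

theorem derivative_logTrunc (v : A) (K : ℕ) :
    derivative (logTrunc K (1 + X * C v : A[X])) = (∑ i ∈ range K, (-(X * C v)) ^ i) * C v := by
  rw [logTrunc, derivative_sum, sum_mul]
  refine sum_congr rfl fun i _ => ?_
  rw [add_sub_cancel_left, derivative_rat_smul, derivative_X_mul_C_pow, smul_smul]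
  have : ((-1) ^ i / (i + 1) : ℚ) * ((i + 1 : ℕ) : ℚ) = (-1) ^ i := by
    push_cast; field_simp
  rw [this, neg_pow (X * C v)]
  rcases neg_one_pow_eq_or ℚ i with h | h <;> rcases Nat.even_or_odd i with h' | h' <;>
    simp [h'.neg_one_pow]

/-- The derivative of `log(1 + Xv)` is a geometric series times `v`; its truncation is an exact
inverse of `1 + Xv` since `v ^ K = 0`. -/
theorem one_add_mul_derivative_logTrunc {v : A} {K : ℕ} (hv : v ^ K = 0) :
    (1 + X * C v) * derivative (logTrunc K (1 + X * C v : A[X])) = C v := by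
  have hw : (X * C v : A[X]) ^ K = 0 := by rw [X_mul_C_pow, hv, C_0, mul_zero]
  rw [derivative_logTrunc, ← mul_assoc]
  have := mul_neg_geom_sum (-(X * C v) : A[X]) K
  rw [sub_neg_eq_add] at this
  rw [this, neg_pow, hw, mul_zero, sub_zero, one_mul]

/-- The exponential of the logarithm of a unipotent element. -/
theorem exp_logTrunc {K : ℕ} {u : A} (hu : (u - 1) ^ K = 0) :
    IsNilpotent.exp (logTrunc K u) = u := by
  set v := u - 1 with hv
  -- Join `1` to `u` by the path `1 + Xv`. With `z = log(1 + Xv)`, the product `e^{-z}(1 + Xv)` has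
  -- derivative zero and is `1` at `X = 0`; the claim is the value at `X = 1`.
  set w : A[X] := X * C v with hw
  have hwK : (1 + w - 1) ^ K = 0 := by
    rw [add_sub_cancel_left, hw, X_mul_C_pow, hu, C_0, mul_zero]
  set z := logTrunc K (1 + w) with hz
  have hzK : z ^ K = 0 := logTrunc_pow_eq_zero hwK
  have hwv : Commute (1 + w) (C v) :=
    (Commute.one_left _).add_left ((commute_X (C v)).mul_left (Commute.refl _))
  have hzv : Commute z (C v) := commute_logTrunc hwv
  have hzw : Commute z (1 + w) := commute_logTrunc (Commute.refl _)
  have hd : (1 + w) * derivative z = C v := one_add_mul_derivative_logTrunc hu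
  have hdz : Commute z (derivative z) := by
    rw [hz, hw, derivative_logTrunc]
    refine Commute.mul_right (Commute.sum_right _ _ _ fun i _ => Commute.pow_right ?_ _) hzv
    rw [← hw, ← hz]
    have := hzw.sub_right (Commute.one_right z)
    rw [add_sub_cancel_left] at this
    exact this.neg_right
  have hnz : Commute (-z) (derivative (-z)) := by
    rw [derivative_neg]; exact hdz.neg_left.neg_right
  have h0 : derivative (IsNilpotent.exp (-z) * (1 + w)) = 0 := by
    have hdw : derivative (1 + w) = C v := by
      rw [hw]; simp
    rw [derivative_mul, derivative_exp_of_commute (neg_pow_eq_zero hzK) hnz, hdw,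
      ← (commute_exp hnz).eq, mul_assoc, derivative_neg, neg_mul, ← hd]
    have : Commute (1 + w) (derivative z) := by
      rw [hz, hw, derivative_logTrunc]
      refine Commute.mul_right (Commute.sum_right _ _ _ fun i _ => Commute.pow_right ?_ _) hwv
      exact ((Commute.one_left _).add_left (Commute.refl _)).neg_right
    rw [this.eq, mul_neg, neg_add_cancel]
  have h1 := eq_C_coeff_of_derivative_eq_zero h0
  have hz0 : evalZero z = 0 := by
    rw [hz, map_logTrunc, map_add, map_one, evalZero_apply, hw]
    simp [logTrunc_one]
  have h2 : (IsNilpotent.exp (-z) * (1 + w)).coeff 0 = 1 := by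
    rw [← evalZero_apply, map_mul, IsNilpotent.map_exp ⟨K, neg_pow_eq_zero hzK⟩, map_neg, hz0,
      neg_zero, IsNilpotent.exp_zero, one_mul, evalZero_apply, hw]
    simp
  rw [h2, C_1] at h1
  have h3 : IsNilpotent.exp z = 1 + w := by
    have := congrArg (IsNilpotent.exp z * ·) h1
    simp only [mul_one] at this
    rw [← this, ← mul_assoc, IsNilpotent.exp_mul_exp_neg_self ⟨K, hzK⟩, one_mul]
  have h4 := congrArg evalOne h3
  have h5 : evalOne (1 + w) = u := by
    rw [evalOne_apply, hw, X_mul_C, eval_add, eval_one, eval_mul_X, eval_C, mul_one, hv,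
      add_sub_cancel]
  rw [IsNilpotent.map_exp ⟨K, hzK⟩, hz, map_logTrunc, h5] at h4
  exact h4

/-- The logarithm of the exponential of a nilpotent element. -/
theorem logTrunc_exp {K : ℕ} {v : A} (hv : v ^ K = 0) : logTrunc K (IsNilpotent.exp v) = v := by
  -- Along the path `w = Xv` put `z = log e^w`. Then `e^z = e^w`, and differentiating and cancelling
  -- this unit gives `z' = v = w'`; moreover `z` and `w` agree at `X = 0`.
  set w : A[X] := X * C v with hw
  have hwK : w ^ K = 0 := by rw [hw, X_mul_C_pow, hv, C_0, mul_zero]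
  have hwv : Commute w (C v) := (commute_X (C v)).mul_left (Commute.refl _)
  have hdw : derivative w = C v := by rw [hw]; simp
  set z := logTrunc K (IsNilpotent.exp w) with hz
  have hzK : z ^ K = 0 := logTrunc_pow_eq_zero (exp_sub_one_pow_eq_zero hwK)
  have hez : IsNilpotent.exp z = IsNilpotent.exp w := exp_logTrunc (exp_sub_one_pow_eq_zero hwK)
  have hdE : derivative (IsNilpotent.exp w) = C v * IsNilpotent.exp w := by
    rw [derivative_exp_of_commute hwK (by rwa [hdw]), hdw]
  have hEv : Commute (IsNilpotent.exp w) (C v) := commute_exp hwv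
  -- This is needed for `z` to commute with `z'`, so that `(e^z)' = z' e^z` holds without correction
  -- terms.
  have hdE1 : ∀ i, Commute (derivative ((IsNilpotent.exp w - 1) ^ i)) (IsNilpotent.exp w) := by
    have hc : Commute (IsNilpotent.exp w - 1) (IsNilpotent.exp w) :=
      (Commute.refl _).sub_left (Commute.one_left _)
    intro i
    induction i with
    | zero => simp
    | succ i ih =>
      rw [pow_succ, derivative_mul, derivative_sub, derivative_one, sub_zero, hdE]
      exact (ih.mul_left hc).add_left
        ((hc.pow_left i).mul_left (hEv.symm.mul_left (Commute.refl _)))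
  have hdzE : Commute (derivative z) (IsNilpotent.exp w) := by
    rw [hz, logTrunc, derivative_sum]
    refine Commute.sum_left _ _ _ fun i _ => ?_
    rw [derivative_rat_smul]
    exact (hdE1 (i + 1)).smul_left _
  have hzdz : Commute z (derivative z) := commute_logTrunc hdzE.symm
  have h1 := derivative_exp_of_commute hzK hzdz
  rw [hez, hdE] at h1
  have h2 : C v = derivative z := (IsNilpotent.isUnit_exp ⟨K, hwK⟩).mul_right_cancel h1
  have h3 : derivative (z - w) = 0 := by rw [derivative_sub, ← h2, hdw, sub_self]
  have h4 := eq_C_coeff_of_derivative_eq_zero h3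
  have h5 : (z - w).coeff 0 = 0 := by
    have h0 : evalZero w = 0 := by rw [evalZero_apply, hw]; simp
    rw [← evalZero_apply, map_sub, hz, map_logTrunc, IsNilpotent.map_exp ⟨K, hwK⟩, h0,
      IsNilpotent.exp_zero, logTrunc_one, sub_zero]
  rw [h5, C_0, sub_eq_zero] at h4
  have h6 := congrArg evalOne h4
  have h7 : evalOne w = v := by rw [evalOne_apply, hw]; simp
  rw [hz, map_logTrunc, IsNilpotent.map_exp ⟨K, hwK⟩, h7] at h6
  exact h6

/-! ### The Baker–Campbell–Hausdorff theorem. -/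

/-- The polynomials whose coefficients up to order `k` lie in `U`. -/
def coeffLE (U : Submodule ℚ A) (k : ℕ) : Submodule ℚ A[X] where
  carrier := {p | ∀ i ≤ k, p.coeff i ∈ U}
  zero_mem' := fun i _ => by simp
  add_mem' := fun hp hq i hi => by rw [coeff_add]; exact U.add_mem (hp i hi) (hq i hi)
  smul_mem' := fun c p hp i hi => by rw [coeff_smul]; exact U.smul_mem c (hp i hi)

theorem mul_mem_coeffLE {U V : Submodule ℚ A} {k : ℕ} {p q : A[X]} (hp : p ∈ coeffLE U k)
    (hq : q ∈ coeffLE V k) : p * q ∈ coeffLE (U * V) k := by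
  intro i hi
  rw [coeff_mul]
  refine Submodule.sum_mem _ fun ij hij => ?_
  have := mem_antidiagonal.1 hij
  exact Submodule.mul_mem_mul (hp _ (by omega)) (hq _ (by omega))

theorem pow_mem_coeffLE {U : Submodule ℚ A} {k : ℕ} {p : A[X]} (hp : p ∈ coeffLE U k) (i : ℕ) :
    p ^ i ∈ coeffLE (U ^ i) k := by
  induction i with
  | zero =>
    intro j _
    rw [pow_zero, pow_zero, coeff_one]
    split_ifs
    · exact Submodule.one_le.1 le_rfl
    · exact Submodule.zero_mem _
  | succ i ih => rw [pow_succ, pow_succ]; exact mul_mem_coeffLE ih hp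

theorem coeffLE_mono {U V : Submodule ℚ A} (h : U ≤ V) (k : ℕ) : coeffLE U k ≤ coeffLE V k :=
  fun _ hp i hi => h (hp i hi)

theorem C_mem_coeffLE {U : Submodule ℚ A} {a : A} (ha : a ∈ U) (k : ℕ) : C a ∈ coeffLE U k := by
  intro i _
  rw [coeff_C]
  split_ifs
  · exact ha
  · exact U.zero_mem

theorem X_mul_C_mem_coeffLE {U : Submodule ℚ A} {a : A} (ha : a ∈ U) (k : ℕ) :
    X * C a ∈ coeffLE U k := by
  intro i _
  rw [X_mul_C, coeff_C_mul, coeff_X]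
  split_ifs
  · simpa using ha
  · simp

theorem pow_succ_mem {B : Type*} [Ring B] [Algebra ℚ B] {U : Submodule ℚ B}
    (hU : ∀ a ∈ U, ∀ b ∈ U, a * b ∈ U) {a : B} (ha : a ∈ U) (i : ℕ) : a ^ (i + 1) ∈ U := by
  induction i with
  | zero => simpa using ha
  | succ i ih => rw [pow_succ]; exact hU _ ih _ ha

theorem exp_sub_one_mem {B : Type*} [Ring B] [Algebra ℚ B] {U : Submodule ℚ B}
    (hU : ∀ a ∈ U, ∀ b ∈ U, a * b ∈ U) {a : B} (ha : a ∈ U) (hn : IsNilpotent a) :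
    IsNilpotent.exp a - 1 ∈ U := by
  obtain ⟨K, hK⟩ := hn
  rw [IsNilpotent.exp_eq_sum (pow_eq_zero_of_le (Nat.le_succ K) hK), sum_range_succ']
  simp only [pow_zero, Nat.factorial_zero, Nat.cast_one, inv_one, one_smul, add_sub_cancel_right]
  exact Submodule.sum_mem _ fun i _ => U.smul_mem _ (pow_succ_mem hU ha i)

theorem logTrunc_mem {B : Type*} [Ring B] [Algebra ℚ B] {U : Submodule ℚ B}
    (hU : ∀ a ∈ U, ∀ b ∈ U, a * b ∈ U) {u : B} (hu : u - 1 ∈ U) (K : ℕ) : logTrunc K u ∈ U :=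
  Submodule.sum_mem _ fun i _ => U.smul_mem _ (pow_succ_mem hU hu i)

/-- The Baker–Campbell–Hausdorff theorem in a nilpotent algebra `U`: if `k` is closed under
commutators, which lie in `k'`, then `log (exp y * exp x)` is in `k`, and is `x + y` modulo `k'`. -/
theorem logTrunc_exp_mul_exp_mem {U k k' : Submodule ℚ A} {K : ℕ}
    (hU : ∀ a ∈ U, ∀ b ∈ U, a * b ∈ U) (hK : U ^ K = ⊥) (hkU : k ≤ U) (hk' : k' ≤ k)
    (hlie : ∀ a ∈ k, ∀ b ∈ k, a * b - b * a ∈ k') {x y : A} (hx : x ∈ k) (hy : y ∈ k) :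
    logTrunc K (IsNilpotent.exp y * IsNilpotent.exp x) ∈ k ∧
      logTrunc K (IsNilpotent.exp y * IsNilpotent.exp x) - (x + y) ∈ k' := by
  have hUU : U * U ≤ U := Submodule.mul_le.2 hU
  have hmul : ∀ j, ∀ p ∈ coeffLE U j, ∀ q ∈ coeffLE U j, p * q ∈ coeffLE U j :=
    fun j p hp q hq => coeffLE_mono hUU j (mul_mem_coeffLE hp hq)
  have hpow : ∀ p : A[X], (∀ j, p ∈ coeffLE U j) → p ^ K = 0 := by
    intro p hp
    ext i
    have := pow_mem_coeffLE (hp i) K i le_rfl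
    rw [hK, Submodule.mem_bot] at this
    rw [this, coeff_zero]
  have hpowA : ∀ a ∈ U, a ^ K = 0 := by
    intro a ha
    have := hpow (C a) (C_mem_coeffLE ha)
    rwa [← C_pow, C_eq_zero] at this
  -- The path is `z = log(e^{Xy} e^x)`, from `x` at `X = 0` to the wanted logarithm at `X = 1`. It
  -- satisfies `∑ ad_z^j(z') / (j+1)! = y`, from which its coefficients are found recursively.
  set w : A[X] := X * C y with hw
  have hwK : w ^ K = 0 := hpow _ (X_mul_C_mem_coeffLE (hkU hy))
  have hCxK : (C x) ^ K = 0 := hpow _ (C_mem_coeffLE (hkU hx))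
  have hdw : derivative w = C y := by rw [hw]; simp
  set u := IsNilpotent.exp w * IsNilpotent.exp (C x) with hu
  have hu1 : ∀ j, u - 1 ∈ coeffLE U j := by
    intro j
    have h1 := exp_sub_one_mem (hmul j) (X_mul_C_mem_coeffLE (hkU hy) j) ⟨K, hwK⟩
    have h2 := exp_sub_one_mem (hmul j) (C_mem_coeffLE (hkU hx) j) ⟨K, hCxK⟩
    have h3 : u - 1 = (IsNilpotent.exp w - 1) * (IsNilpotent.exp (C x) - 1) +
      (IsNilpotent.exp w - 1) + (IsNilpotent.exp (C x) - 1) := by rw [hu]; noncomm_ring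
    rw [h3]
    exact Submodule.add_mem _ (Submodule.add_mem _ (hmul j _ h1 _ h2) h1) h2
  set z := logTrunc K u with hz
  have hzU : ∀ j, z ∈ coeffLE U j := fun j => logTrunc_mem (hmul j) (hu1 j) K
  have hzK : z ^ K = 0 := hpow _ hzU
  have hez : IsNilpotent.exp z = u := exp_logTrunc (hpow _ hu1)
  have hexpC : ∀ a : A, a ∈ U → IsNilpotent.exp (C a) = C (IsNilpotent.exp a) := fun a ha =>
    (IsNilpotent.map_exp ⟨K, hpowA a ha⟩ (C : A →+* A[X])).symm
  have hdu : derivative u = C y * u := by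
    rw [hu, derivative_mul, hexpC x (hkU hx), derivative_C, mul_zero, add_zero,
      derivative_exp_of_commute hwK, hdw, mul_assoc]
    rw [hdw]
    exact (commute_X (C y)).mul_left (Commute.refl _)
  have hy1 : ∑ j ∈ range (2 * K + 1), ((j + 1).factorial : ℚ)⁻¹ • (adMap z ^ j) (derivative z) =
      C y := by
    have h1 := derivative_exp hzK (M := 2 * K + 1) (by omega)
    rw [hez, hdu, ← hez] at h1
    exact ((IsNilpotent.isUnit_exp ⟨K, hzK⟩).mul_right_cancel h1).symm
  set q := derivative z with hq
  have hz0 : z.coeff 0 = x := by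
    rw [← evalZero_apply, hz, map_logTrunc, hu, map_mul, IsNilpotent.map_exp ⟨K, hwK⟩,
      IsNilpotent.map_exp ⟨K, hCxK⟩, evalZero_apply w, evalZero_apply (C x), coeff_C_zero, hw,
      mul_coeff_zero, coeff_X_zero, zero_mul, IsNilpotent.exp_zero, one_mul]
    exact logTrunc_exp (hpowA x (hkU hx))
  have had0 : ∀ j, 2 * K ≤ j → (adMap z ^ j) q = 0 := fun j hj => by
    rw [pow_eq_zero_of_le hj (adMap_pow_eq_zero hzK), LinearMap.zero_apply]
  -- The recursion: the coefficients of `z` up to order `j` control those of `z'` up to order `j`,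
  -- hence those of `z` up to order `j + 1`.
  have key : ∀ j, z ∈ coeffLE k j → q ∈ coeffLE k j ∧ q - C y ∈ coeffLE k' j := by
    intro j hzj
    have hlie' : ∀ p ∈ coeffLE k j, adMap z p ∈ coeffLE k' j := by
      intro p hp i hi
      rw [adMap_apply, coeff_sub, coeff_mul, coeff_mul, ← Nat.sum_antidiagonal_swap,
        ← sum_sub_distrib]
      refine Submodule.sum_mem _ fun ij hij => ?_
      have := mem_antidiagonal.1 hij
      exact hlie _ (hzj _ (by simp; omega)) _ (hp _ (by simp; omega))
    -- The equation `hy1` is solved for `z'` from the top: after applying `ad_z^{2K-i}`, its term `j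
    -- = 0` is the wanted vector, and the other terms contain higher powers of `ad_z`, which are
    -- known by induction or vanish.
    have hmain : ∀ i, i ≤ 2 * K →
        (adMap z ^ (2 * K - i)) q ∈ coeffLE k j := by
      intro i
      induction i using Nat.strong_induction_on with
      | _ i ih =>
        intro hi
        have h1 := congrArg (adMap z ^ (2 * K - i)) hy1
        rw [sum_range_succ', map_add, map_sum] at h1
        simp only [map_rat_smul, ← Module.End.mul_apply, ← pow_add, add_zero, zero_add,
          Nat.factorial_one, Nat.cast_one, inv_one, one_smul] at h1
        rw [add_comm, ← eq_sub_iff_add_eq] at h1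
        rw [h1]
        refine Submodule.sub_mem _ ?_ (Submodule.sum_mem _ fun e _ => Submodule.smul_mem _ _ ?_)
        · generalize 2 * K - i = e
          induction e with
          | zero => exact C_mem_coeffLE hy j
          | succ e ihe =>
            rw [pow_succ', Module.End.mul_apply]
            exact coeffLE_mono hk' j (hlie' _ ihe)
        · by_cases he : 2 * K ≤ 2 * K - i + (e + 1)
          · rw [had0 _ he]; exact Submodule.zero_mem _
          · have := ih (i - (e + 1)) (by omega) (by omega)
            rwa [show 2 * K - (i - (e + 1)) = 2 * K - i + (e + 1) by omega] at this
    have hmain' : ∀ i, (adMap z ^ i) q ∈ coeffLE k j := by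
      intro i
      by_cases hi : 2 * K ≤ i
      · rw [had0 _ hi]; exact Submodule.zero_mem _
      · have := hmain (2 * K - i) (by omega)
        rwa [show 2 * K - (2 * K - i) = i by omega] at this
    refine ⟨by simpa using hmain' 0, ?_⟩
    rw [← hy1, sum_range_succ']
    simp only [pow_zero, zero_add, Nat.factorial_one, Nat.cast_one, inv_one, one_smul,
      Module.End.one_apply, sub_add_cancel_right]
    refine Submodule.neg_mem _ (Submodule.sum_mem _ fun e _ => Submodule.smul_mem _ _ ?_)
    rw [pow_succ', Module.End.mul_apply]
    exact hlie' _ (hmain' e)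
  have hcoeff : ∀ i, z.coeff (i + 1) = ((i + 1 : ℕ) : ℚ)⁻¹ • q.coeff i := by
    intro i
    rw [hq, coeff_derivative, ← Nat.cast_succ, ← nsmul_eq_mul', ← Nat.cast_smul_eq_nsmul ℚ,
      smul_smul, inv_mul_cancel₀ (by positivity), one_smul]
  have hzk : ∀ j, z ∈ coeffLE k j := by
    intro j
    induction j with
    | zero =>
      intro i hi
      obtain rfl : i = 0 := by omega
      rwa [hz0]
    | succ j ih =>
      intro i hi
      rcases i with _ | i
      · rwa [hz0]
      · rw [hcoeff]
        exact k.smul_mem _ ((key j ih).1 i (by omega))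
  have hz1 : logTrunc K (IsNilpotent.exp y * IsNilpotent.exp x) = evalOne z := by
    rw [hz, map_logTrunc, hu, map_mul, IsNilpotent.map_exp ⟨K, hwK⟩,
      IsNilpotent.map_exp ⟨K, hCxK⟩, evalOne_apply w, evalOne_apply (C x), eval_C, hw, X_mul_C,
      eval_mul_X, eval_C, mul_one]
  have hsub : evalOne z - (x + y) ∈ k' := by
    -- The bound leaves room to split off the coefficient of order `0`, which is `x`, and that of
    -- order `1`, which is `y` modulo `k'`.
    have hN : z.natDegree < z.natDegree + 2 := by omega
    rw [evalOne_apply, eval_eq_sum_range' hN, sum_range_succ', sum_range_succ']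
    simp only [one_pow, mul_one, hz0]
    have h1 : z.coeff (0 + 1) - y ∈ k' := by
      have := (key 0 (hzk 0)).2 0 le_rfl
      rw [coeff_sub, coeff_C_zero] at this
      rw [hcoeff]
      simpa using this
    have h2 : ∑ i ∈ range z.natDegree, z.coeff (i + 1 + 1) ∈ k' := by
      refine Submodule.sum_mem _ fun i _ => ?_
      have := (key (i + 1) (hzk _)).2 (i + 1) le_rfl
      rw [coeff_sub, coeff_C_succ, sub_zero] at this
      rw [hcoeff]
      exact k'.smul_mem _ this
    have h3 := k'.add_mem h2 h1
    convert h3 using 1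
    abel
  rw [hz1]
  refine ⟨?_, hsub⟩
  have := k.add_mem (hk' hsub) (k.add_mem hx hy)
  rwa [sub_add_cancel] at this

/-- The `ℚ`-submodules of a `ℚ`-algebra. -/
abbrev RatSub (A : Type*) [Ring A] [Algebra ℚ A] : Type _ := Submodule ℚ A

/-- The nonunital associative algebra generated by a submodule. -/
def assocHull (E : RatSub A) : RatSub A := ⨆ k : ℕ, E ^ (k + 1)

theorem mul_mem_assocHull {E : RatSub A} :
    ∀ a ∈ assocHull E, ∀ b ∈ assocHull E, a * b ∈ assocHull E := by
  rw [← Submodule.mul_le, assocHull, Submodule.iSup_mul]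
  refine iSup_le fun i => ?_
  rw [Submodule.mul_iSup]
  refine iSup_le fun j => ?_
  rw [← pow_add]
  exact le_iSup (fun k : ℕ => E ^ (k + 1)) (i + 1 + j)

/-- A product of `j` elements of the hull has degree at least `j` in `E`, so a vanishing power of
`E` kills the same power of the hull. -/
theorem assocHull_pow_le (E : RatSub A) (j : ℕ) : assocHull E ^ j ≤ ⨆ k : ℕ, E ^ (k + j) := by
  induction j with
  | zero => exact le_iSup_of_le 0 (by simp)
  | succ j ih =>
    rw [pow_succ]
    refine (mul_le_mul_left ih _).trans ?_
    rw [Submodule.iSup_mul]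
    refine iSup_le fun i => ?_
    rw [assocHull, Submodule.mul_iSup]
    refine iSup_le fun l => ?_
    rw [← pow_add]
    exact le_iSup_of_le (i + l) (le_of_eq (by congr 1; ring))

theorem assocHull_pow_eq_bot {E : RatSub A} {K : ℕ} (h : E ^ K = ⊥) : assocHull E ^ K = ⊥ := by
  rw [eq_bot_iff]
  refine (assocHull_pow_le E _).trans (iSup_le fun k => ?_)
  rw [pow_add, h]
  exact le_of_eq (Submodule.mul_bot _)

theorem le_assocHull (E : RatSub A) : E ≤ assocHull E := le_iSup_of_le 0 (by simp)

theorem pow_eq_zero_of_mem {U : RatSub A} {K : ℕ} (hK : U ^ K = ⊥) {a : A} (ha : a ∈ U) :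
    a ^ K = 0 := by
  have := Submodule.pow_mem_pow _ ha K
  rwa [hK, Submodule.mem_bot] at this

theorem mul_sub_one_mem {U : RatSub A} (hU : ∀ a ∈ U, ∀ b ∈ U, a * b ∈ U) {u v : A}
    (hu : u - 1 ∈ U) (hv : v - 1 ∈ U) : u * v - 1 ∈ U := by
  have h3 : u * v - 1 = (u - 1) * (v - 1) + (u - 1) + (v - 1) := by noncomm_ring
  rw [h3]
  exact add_mem (add_mem (hU _ hu _ hv) hu) hv

end Algebra
end WaveletRep
end


noncomputable section

namespace WaveletRep

/-! ### The exponential map of a Lie algebra of nilpotent matrices. -/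

section MatrixGroup

open Finset

variable {m n : ℕ} {𝔫 : LieSubalgebra ℝ (Matrix (Fin m) (Fin m) ℝ)}

/-- A Lie algebra of nilpotent matrices. -/
class IsNilMatrixAlgebra (𝔫 : LieSubalgebra ℝ (Matrix (Fin m) (Fin m) ℝ)) : Prop where
  nil : ∀ X ∈ 𝔫, IsNilpotent X

/-- A real space of matrices as a vector space over `ℚ`. -/
def ratSubmodule (E : Submodule ℝ (Matrix (Fin m) (Fin m) ℝ)) :
    RatSub (Matrix (Fin m) (Fin m) ℝ) where
  carrier := E
  zero_mem' := E.zero_mem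
  add_mem' := E.add_mem
  smul_mem' := fun q a ha => by
    have h : q • a = (q : ℝ) • a := by ext i j; simp [Rat.smul_def]
    rw [h]
    exact E.smul_mem _ ha

/-- Engel's theorem for the action of `𝔫` on `ℝᵐ`: its lower central series reaches zero at some
`K`, and a product of `K` matrices of `𝔫` maps `ℝᵐ` into the `K`-th term. -/
theorem exists_ratSubmodule_pow_eq_bot [h𝔫 : IsNilMatrixAlgebra 𝔫] :
    ∃ K, ratSubmodule 𝔫.toSubmodule ^ K = ⊥ := by
  let f : 𝔫 →ₗ⁅ℝ⁆ Module.End ℝ (Fin m → ℝ) :=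
    (lieEquivMatrix' (R := ℝ) (n := Fin m)).symm.toLieHom.comp 𝔫.incl
  let _ := LieRingModule.compLieHom (Fin m → ℝ) f
  have := LieModule.compLieHom (Fin m → ℝ) f
  have hact : ∀ (x : 𝔫) (v : Fin m → ℝ), ⁅x, v⁆ = (x : Matrix (Fin m) (Fin m) ℝ).mulVec v := by
    intro x v
    rfl
  have hnil : LieModule.IsNilpotent 𝔫 (Fin m → ℝ) := by
    rw [LieModule.isNilpotent_iff_forall' (R := ℝ)]
    intro x
    obtain ⟨K, hK⟩ := h𝔫.nil x x.2
    refine ⟨K, ?_⟩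
    have : LieModule.toEnd ℝ 𝔫 (Fin m → ℝ) x = Matrix.toLin' (x : Matrix (Fin m) (Fin m) ℝ) := by
      ext1 v; rfl
    rw [this, ← Matrix.toLin'_pow, hK, map_zero]
  obtain ⟨K, hK⟩ := (LieModule.isNilpotent_iff ℝ 𝔫 (Fin m → ℝ)).1 hnil
  refine ⟨K, ?_⟩
  have key : ∀ K, ∀ M ∈ ratSubmodule 𝔫.toSubmodule ^ K, ∀ v : Fin m → ℝ,
      M.mulVec v ∈ LieModule.lowerCentralSeries ℝ 𝔫 (Fin m → ℝ) K := by
    intro K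
    induction K with
    | zero => intro M _ v; simp
    | succ K ih =>
      intro M hM v
      rw [pow_succ'] at hM
      induction hM using Submodule.mul_induction_on' with
      | mem_mul_mem a ha b hb =>
        rw [← Matrix.mulVec_mulVec, LieModule.lowerCentralSeries_succ]
        exact LieSubmodule.lie_mem_lie (x := (⟨a, ha⟩ : 𝔫)) (LieSubmodule.mem_top _) (ih b hb v)
      | add a _ b _ ha hb =>
        rw [Matrix.add_mulVec]
        exact add_mem ha hb
  rw [eq_bot_iff]
  intro M hM
  have h0 : ∀ v, M.mulVec v = 0 := fun v => by
    have := key K M hM v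
    rwa [hK, LieSubmodule.mem_bot] at this
  rw [Submodule.mem_bot]
  exact Matrix.ext_of_mulVec_single fun i => by rw [h0, Matrix.zero_mulVec]

/-- An order of nilpotency of the associative algebra generated by `𝔫`. -/
def nilOrder (𝔫 : LieSubalgebra ℝ (Matrix (Fin m) (Fin m) ℝ)) : ℕ :=
  sInf {K | ratSubmodule 𝔫.toSubmodule ^ K = ⊥}

theorem ratSubmodule_pow_nilOrder [IsNilMatrixAlgebra 𝔫] :
    ratSubmodule 𝔫.toSubmodule ^ nilOrder 𝔫 = ⊥ :=
  Nat.sInf_mem (s := {K | ratSubmodule 𝔫.toSubmodule ^ K = ⊥}) exists_ratSubmodule_pow_eq_bot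

theorem assocHull_pow_nilOrder [IsNilMatrixAlgebra 𝔫] :
    assocHull (ratSubmodule 𝔫.toSubmodule) ^ nilOrder 𝔫 = ⊥ :=
  assocHull_pow_eq_bot ratSubmodule_pow_nilOrder

theorem mem_assocHull (Y : 𝔫) :
    (Y : Matrix (Fin m) (Fin m) ℝ) ∈ assocHull (ratSubmodule 𝔫.toSubmodule) :=
  le_assocHull _ Y.2

theorem pow_nilOrder [IsNilMatrixAlgebra 𝔫] (Y : 𝔫) :
    (Y : Matrix (Fin m) (Fin m) ℝ) ^ nilOrder 𝔫 = 0 :=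
  pow_eq_zero_of_mem assocHull_pow_nilOrder (mem_assocHull Y)

theorem exp_eq_nilpotent_exp {a : Matrix (Fin m) (Fin m) ℝ} (ha : IsNilpotent a) :
    NormedSpace.exp a = IsNilpotent.exp a := by
  obtain ⟨K, hK⟩ := ha
  rw [NormedSpace.exp_eq_tsum ℚ, IsNilpotent.exp_eq_sum hK]
  refine tsum_eq_sum fun i hi => ?_
  rw [pow_eq_zero_of_le (by simpa using hi) hK, smul_zero]

theorem coe_expN [IsNilMatrixAlgebra 𝔫] (Y : 𝔫) :
    ((expN Y : GL (Fin m) ℝ) : Matrix (Fin m) (Fin m) ℝ) =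
      IsNilpotent.exp (Y : Matrix (Fin m) (Fin m) ℝ) :=
  exp_eq_nilpotent_exp ⟨_, pow_nilOrder Y⟩

theorem lieGroup_ext {x y : lieGroup 𝔫} (h : ((x : GL (Fin m) ℝ) : Matrix (Fin m) (Fin m) ℝ) =
    ((y : GL (Fin m) ℝ) : Matrix (Fin m) (Fin m) ℝ)) : x = y :=
  Subtype.ext (Units.ext h)

theorem expN_zero : expN (0 : 𝔫) = 1 := lieGroup_ext (by
  change NormedSpace.exp (0 : Matrix (Fin m) (Fin m) ℝ) = 1
  exact NormedSpace.exp_zero)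

theorem expN_neg (Y : 𝔫) : expN (-Y) = (expN Y)⁻¹ := by
  refine eq_inv_of_mul_eq_one_left (lieGroup_ext ?_)
  exact (expGL (Y : Matrix (Fin m) (Fin m) ℝ)).inv_val

theorem expN_add_smul (s t : ℝ) (Y : 𝔫) : expN ((s + t) • Y) = expN (s • Y) * expN (t • Y) := by
  refine lieGroup_ext ?_
  change NormedSpace.exp ((s + t) • (Y : Matrix (Fin m) (Fin m) ℝ)) = _
  rw [add_smul, Matrix.exp_add_of_commute]
  · rfl
  · exact ((Commute.refl _).smul_left s).smul_right t

/-- The Baker–Campbell–Hausdorff theorem for subalgebras of `𝔫`. -/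
theorem exists_expN_mul_expN [IsNilMatrixAlgebra 𝔫] {k k' : Submodule ℝ 𝔫} (hk' : k' ≤ k)
    (hlie : ∀ a ∈ k, ∀ b ∈ k, ⁅a, b⁆ ∈ k') {x y : 𝔫} (hx : x ∈ k) (hy : y ∈ k) :
    ∃ z ∈ k, z - (x + y) ∈ k' ∧ expN z = expN x * expN y := by
  let e : Submodule ℝ 𝔫 → RatSub (Matrix (Fin m) (Fin m) ℝ) := fun E =>
    ratSubmodule (E.map 𝔫.toSubmodule.subtype)
  have he : ∀ E : Submodule ℝ 𝔫, e E ≤ assocHull (ratSubmodule 𝔫.toSubmodule) := fun E =>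
    (fun a ha => by
      obtain ⟨b, -, rfl⟩ := ha
      exact mem_assocHull b)
  have hmem : ∀ (E : Submodule ℝ 𝔫) (a : 𝔫), (a : Matrix (Fin m) (Fin m) ℝ) ∈ e E ↔ a ∈ E := by
    intro E a
    constructor
    · rintro ⟨b, hb, hba⟩
      have : b = a := Subtype.ext hba
      exact this ▸ hb
    · intro ha
      exact ⟨a, ha, rfl⟩
  -- That theorem treats `exp y * exp x`, so it is used with `x` and `y` interchanged.
  obtain ⟨h1, h2⟩ := logTrunc_exp_mul_exp_mem (K := nilOrder 𝔫) (k := e k) (k' := e k')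
    mul_mem_assocHull assocHull_pow_nilOrder (he k)
    (fun a ha => by obtain ⟨b, hb, rfl⟩ := ha; exact ⟨b, hk' hb, rfl⟩)
    (by
      rintro _ ⟨a, ha, rfl⟩ _ ⟨b, hb, rfl⟩
      exact ⟨(⁅(show 𝔫 from a), (show 𝔫 from b)⁆ : 𝔫), hlie a ha b hb, rfl⟩) ((hmem k y).2 hy) ((hmem k x).2 hx)
  obtain ⟨z, hz, hzz⟩ := h1
  refine ⟨z, hz, ?_, ?_⟩
  · rw [← hmem]
    rw [← hzz] at h2
    rw [add_comm x y]
    exact h2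
  · refine lieGroup_ext ?_
    rw [coe_expN]
    change IsNilpotent.exp (𝔫.toSubmodule.subtype z) = _
    rw [hzz]
    change _ = ((expN x : GL (Fin m) ℝ) : Matrix (Fin m) (Fin m) ℝ) *
      ((expN y : GL (Fin m) ℝ) : Matrix (Fin m) (Fin m) ℝ)
    rw [coe_expN, coe_expN]
    exact exp_logTrunc (pow_eq_zero_of_mem assocHull_pow_nilOrder (mul_sub_one_mem
      mul_mem_assocHull (exp_sub_one_mem mul_mem_assocHull (mem_assocHull x) ⟨_, pow_nilOrder x⟩)
      (exp_sub_one_mem mul_mem_assocHull (mem_assocHull y) ⟨_, pow_nilOrder y⟩)))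

theorem expN_surjective [IsNilMatrixAlgebra 𝔫] (x : lieGroup 𝔫) : ∃ Y : 𝔫, expN Y = x := by
  obtain ⟨x, hx⟩ := x
  suffices h : ∃ Y : 𝔫, (expN Y : GL (Fin m) ℝ) = x by
    obtain ⟨Y, hY⟩ := h
    exact ⟨Y, Subtype.ext hY⟩
  induction hx using Subgroup.closure_induction with
  | mem x hx =>
    obtain ⟨Y, rfl⟩ := hx
    exact ⟨Y, rfl⟩
  | one => exact ⟨0, by rw [expN_zero]; rfl⟩
  | mul x y _ _ hx hy =>
    obtain ⟨Y, rfl⟩ := hx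
    obtain ⟨Z, rfl⟩ := hy
    obtain ⟨W, -, -, hW⟩ := exists_expN_mul_expN (𝔫 := 𝔫) (k := ⊤) (k' := ⊤) le_rfl
      (fun _ _ _ _ => trivial) (x := Y) (y := Z) trivial trivial
    exact ⟨W, by rw [hW]; rfl⟩
  | inv x _ hx =>
    obtain ⟨Y, rfl⟩ := hx
    exact ⟨-Y, by rw [expN_neg]; rfl⟩

/-- `e^{ad Z} Y`. -/
def adExp (Z Y : 𝔫) : 𝔫 :=
  ∑ j ∈ range (2 * nilOrder 𝔫 + 2), (j.factorial : ℝ)⁻¹ • (LieAlgebra.ad ℝ 𝔫 Z ^ j) Y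

theorem coe_ad_pow (Z Y : 𝔫) (j : ℕ) :
    ((LieAlgebra.ad ℝ 𝔫 Z ^ j) Y : Matrix (Fin m) (Fin m) ℝ) =
      (adMap (Z : Matrix (Fin m) (Fin m) ℝ) ^ j) (Y : Matrix (Fin m) (Fin m) ℝ) := by
  induction j with
  | zero => rfl
  | succ j ih =>
    rw [pow_succ', Module.End.mul_apply, pow_succ', Module.End.mul_apply, ← ih, adMap_apply]
    rfl

theorem adExp_smul (Z Y : 𝔫) (s : ℝ) : adExp Z (s • Y) = s • adExp Z Y := by
  simp only [adExp, map_smul, smul_sum]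
  exact sum_congr rfl fun j _ => smul_comm _ _ _

theorem ad_pow_mem {E : Submodule ℝ 𝔫} {Z Y : 𝔫} (hE : ∀ V ∈ E, ⁅Z, V⁆ ∈ E) (hY : Y ∈ E) (j : ℕ) :
    (LieAlgebra.ad ℝ 𝔫 Z ^ j) Y ∈ E := by
  induction j with
  | zero => exact hY
  | succ j ih => rw [pow_succ', Module.End.mul_apply]; exact hE _ ih

theorem adExp_mem {E : Submodule ℝ 𝔫} {Z Y : 𝔫} (hE : ∀ V ∈ E, ⁅Z, V⁆ ∈ E) (hY : Y ∈ E) :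
    adExp Z Y ∈ E :=
  Submodule.sum_mem _ fun j _ => E.smul_mem _ (ad_pow_mem hE hY j)

theorem adExp_sub_mem {E : Submodule ℝ 𝔫} {Z Y : 𝔫} (hE : ∀ V ∈ E, ⁅Z, V⁆ ∈ E)
    (hY : ⁅Z, Y⁆ ∈ E) : adExp Z Y - Y ∈ E := by
  rw [adExp, sum_range_succ']
  simp only [Nat.factorial_zero, Nat.cast_one, inv_one, pow_zero, one_smul, Module.End.one_apply,
    add_sub_cancel_right]
  exact Submodule.sum_mem _ fun j _ => E.smul_mem _ (ad_pow_mem hE hY j)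

/-- The exponential series is linear modulo `E`, because all terms from the second order on fall
into `E`. This is what makes `λ` of a conjugate computable in `form_adExp_neg`. -/
theorem adExp_sub_sub_mem {E : Submodule ℝ 𝔫} {Z Y : 𝔫} (hE : ∀ V ∈ E, ⁅Z, V⁆ ∈ E)
    (hY : ⁅Z, ⁅Z, Y⁆⁆ ∈ E) : adExp Z Y - Y - ⁅Z, Y⁆ ∈ E := by
  -- The `+ 2` in the range of `adExp` is there for these two splittings.
  rw [adExp, sum_range_succ', sum_range_succ']
  simp only [Nat.factorial_zero, Nat.cast_one, inv_one, pow_zero, one_smul, Module.End.one_apply,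
    add_sub_cancel_right, zero_add, Nat.factorial_one, pow_one, LieAlgebra.ad_apply]
  refine Submodule.sum_mem _ fun j _ => E.smul_mem _ ?_
  rw [add_assoc, pow_add]
  exact ad_pow_mem hE hY j

/-- The logarithm `N → 𝔫`. -/
def logN [IsNilMatrixAlgebra 𝔫] (x : lieGroup 𝔫) : 𝔫 := (expN_surjective x).choose

variable [IsNilMatrixAlgebra 𝔫]

theorem expN_logN (x : lieGroup 𝔫) : expN (logN x) = x := (expN_surjective x).choose_spec

theorem coe_logN (x : lieGroup 𝔫) : (logN x : Matrix (Fin m) (Fin m) ℝ) =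
    logTrunc (nilOrder 𝔫) ((x : GL (Fin m) ℝ) : Matrix (Fin m) (Fin m) ℝ) := by
  conv_rhs => rw [← expN_logN x, coe_expN]
  rw [logTrunc_exp (pow_nilOrder _)]

theorem logN_expN (Y : 𝔫) : logN (expN Y) = Y := by
  refine Subtype.ext ?_
  rw [coe_logN, coe_expN, logTrunc_exp (pow_nilOrder _)]

theorem logN_one : logN (1 : lieGroup 𝔫) = 0 := by rw [← expN_zero, logN_expN]

theorem logN_inv (x : lieGroup 𝔫) : logN x⁻¹ = -logN x := by
  conv_lhs => rw [← expN_logN x, ← expN_neg, logN_expN]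

/-- The source of all homomorphisms below. Consecutive terms of the flag make leading coefficients
additive, `𝔭(λ)` and its intersection with the kernel of `λ` make `λ ∘ log` additive, and
consecutive terms of `orthChain` make the form `λ[log ·, Y]` additive. -/
theorem logN_mul_mem {k k' : Submodule ℝ 𝔫} (hk' : k' ≤ k)
    (hlie : ∀ a ∈ k, ∀ b ∈ k, ⁅a, b⁆ ∈ k') {x y : lieGroup 𝔫} (hx : logN x ∈ k)
    (hy : logN y ∈ k) :
    logN (x * y) ∈ k ∧ logN (x * y) - (logN x + logN y) ∈ k' := by
  obtain ⟨z, hz, hz', hzz⟩ := exists_expN_mul_expN hk' hlie hx hy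
  rw [expN_logN, expN_logN] at hzz
  rw [← hzz, logN_expN]
  exact ⟨hz, hz'⟩

theorem continuous_logN : Continuous (logN : lieGroup 𝔫 → 𝔫) := by
  refine Continuous.subtype_mk (f := fun x : lieGroup 𝔫 => (logN x : Matrix (Fin m) (Fin m) ℝ))
    ?_ _
  simp only [coe_logN]
  refine continuous_finsetSum _ fun i _ => ?_
  simp only [Algebra.smul_def]
  exact continuous_const.mul
    (((Units.continuous_val.comp continuous_subtype_val).sub continuous_const).pow _)

theorem continuous_expN : Continuous (expN : 𝔫 → lieGroup 𝔫) := by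
  have hc : Continuous fun Y : 𝔫 => IsNilpotent.exp (Y : Matrix (Fin m) (Fin m) ℝ) := by
    have : (fun Y : 𝔫 => IsNilpotent.exp (Y : Matrix (Fin m) (Fin m) ℝ)) = fun Y : 𝔫 =>
        ∑ i ∈ range (nilOrder 𝔫), (i.factorial : ℚ)⁻¹ • (Y : Matrix (Fin m) (Fin m) ℝ) ^ i := by
      ext1 Y
      exact IsNilpotent.exp_eq_sum (pow_nilOrder Y)
    rw [this]
    refine continuous_finsetSum _ fun i _ => ?_
    simp only [Algebra.smul_def]
    exact continuous_const.mul (continuous_subtype_val.pow i)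
  refine Continuous.subtype_mk ?_ _
  refine Units.continuous_iff.2 ⟨?_, ?_⟩
  · exact hc.congr fun Y => (coe_expN Y).symm
  · refine (hc.comp (continuous_subtype_val.neg.subtype_mk fun Y : 𝔫 => (-Y).2)).congr fun Y => ?_
    exact (coe_expN (-Y)).symm

/-- The exponential map is a homeomorphism of `𝔫` onto `N`. -/
def expHomeo : 𝔫 ≃ₜ lieGroup 𝔫 where
  toFun := expN
  invFun := logN
  left_inv := logN_expN
  right_inv := expN_logN
  continuous_toFun := continuous_expN
  continuous_invFun := continuous_logN

theorem coe_adExp (Z Y : 𝔫) : (adExp Z Y : Matrix (Fin m) (Fin m) ℝ) =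
    IsNilpotent.exp (Z : Matrix (Fin m) (Fin m) ℝ) * Y *
      IsNilpotent.exp (-(Z : Matrix (Fin m) (Fin m) ℝ)) := by
  rw [exp_mul_mul_exp_neg (pow_nilOrder Z) _ (M := 2 * nilOrder 𝔫 + 2) (by omega)]
  have h1 : (adExp Z Y : Matrix (Fin m) (Fin m) ℝ) = ∑ j ∈ range (2 * nilOrder 𝔫 + 2),
      (j.factorial : ℝ)⁻¹ • ((LieAlgebra.ad ℝ 𝔫 Z ^ j) Y : Matrix (Fin m) (Fin m) ℝ) :=
    map_sum 𝔫.toSubmodule.subtype _ _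
  rw [h1]
  refine sum_congr rfl fun j _ => ?_
  rw [coe_ad_pow]
  ext a b
  simp [Algebra.smul_def]

theorem conj_expN (g : lieGroup 𝔫) (Y : 𝔫) : g * expN Y * g⁻¹ = expN (adExp (logN g) Y) := by
  refine lieGroup_ext ?_
  rw [coe_expN, coe_adExp]
  have h1 : ((g : GL (Fin m) ℝ) : Matrix (Fin m) (Fin m) ℝ) =
      IsNilpotent.exp (logN g : Matrix (Fin m) (Fin m) ℝ) := by rw [← coe_expN, expN_logN]
  have h2 : (((g⁻¹ : lieGroup 𝔫) : GL (Fin m) ℝ) : Matrix (Fin m) (Fin m) ℝ) =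
      IsNilpotent.exp (-(logN g : Matrix (Fin m) (Fin m) ℝ)) := by
    have := coe_expN (-logN g)
    rw [← logN_inv, expN_logN, logN_inv] at this
    exact this
  have h3 : ((expN Y : GL (Fin m) ℝ) : Matrix (Fin m) (Fin m) ℝ) =
      IsNilpotent.exp (Y : Matrix (Fin m) (Fin m) ℝ) := coe_expN Y
  change ((g : GL (Fin m) ℝ) : Matrix (Fin m) (Fin m) ℝ) *
    ((expN Y : GL (Fin m) ℝ) : Matrix (Fin m) (Fin m) ℝ) *
    (((g⁻¹ : lieGroup 𝔫) : GL (Fin m) ℝ) : Matrix (Fin m) (Fin m) ℝ) = _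
  rw [← exp_eq_nilpotent_exp, ← h2, ← h1, h3, ← exp_eq_nilpotent_exp ⟨_, pow_nilOrder Y⟩]
  · exact (Matrix.exp_units_conj (g : GL (Fin m) ℝ) _).symm
  · refine ⟨nilOrder 𝔫, ?_⟩
    rw [← coe_adExp]
    exact pow_nilOrder _

theorem logN_conj (g x : lieGroup 𝔫) : logN (g * x * g⁻¹) = adExp (logN g) (logN x) := by
  conv_lhs => rw [← expN_logN x, conj_expN, logN_expN]

end MatrixGroup
end WaveletRep
end


noncomputable section

namespace WaveletRep

/-! ### The polarization `𝔭(λ)` and the chain of subalgebras that descends to it. -/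

section Polarization

variable {m n : ℕ} {𝔫 : LieSubalgebra ℝ (Matrix (Fin m) (Fin m) ℝ)}
  {X : Module.Basis (Fin n) ℝ 𝔫} {l : Module.Dual ℝ 𝔫}

theorem mem_flag_iff {i : ℕ} {Y : 𝔫} : Y ∈ flag X i ↔ ∀ k : Fin n, i ≤ k → X.repr Y k = 0 := by
  rw [flag, Module.Basis.mem_span_image]
  constructor
  · intro h k hk
    by_contra h0
    have := h (Finsupp.mem_support_iff.2 h0)
    simp only [Set.mem_ofPred_eq] at this
    omega
  · intro h k hk
    by_contra h0
    simp only [Set.mem_ofPred_eq, not_lt] at h0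
    exact Finsupp.mem_support_iff.1 hk (h k h0)

theorem flag_mono {i j : ℕ} (h : i ≤ j) : flag X i ≤ flag X j := fun _ hY =>
  mem_flag_iff.2 fun k hk => mem_flag_iff.1 hY k (h.trans hk)

theorem flag_zero : flag X 0 = ⊥ := by
  simp [flag]

theorem flag_eq_top {i : ℕ} (h : n ≤ i) : flag X i = ⊤ := by
  rw [eq_top_iff]
  intro Y _
  exact mem_flag_iff.2 fun k hk => by have := k.2; omega

theorem basis_mem_flag (k : Fin n) : X k ∈ flag X (k + 1) :=
  Submodule.subset_span ⟨k, by simp, rfl⟩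

theorem sub_smul_mem_flag {k : Fin n} {Y : 𝔫} (hY : Y ∈ flag X (k + 1)) :
    Y - X.repr Y k • X k ∈ flag X k := by
  refine mem_flag_iff.2 fun j hj => ?_
  rw [map_sub, map_smul, Module.Basis.repr_self, Finsupp.sub_apply, Finsupp.smul_apply,
    Finsupp.single_apply]
  split_ifs with h
  · subst h; simp
  · have : (k : ℕ) + 1 ≤ j := by
      have : (k : ℕ) ≠ j := fun h' => h (Fin.ext h')
      omega
    simp [mem_flag_iff.1 hY j this]

theorem repr_eq_zero_iff_mem_flag {k : Fin n} {Y : 𝔫} (hY : Y ∈ flag X (k + 1)) :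
    X.repr Y k = 0 ↔ Y ∈ flag X k := by
  constructor
  · intro h
    have := sub_smul_mem_flag hY
    rwa [h, zero_smul, sub_zero] at this
  · intro h
    exact mem_flag_iff.1 h k le_rfl

/-- If `Y ∉ flag X k`, every `Z` in `flag X (k + 1)` is a multiple of `Y` modulo `flag X k`. -/
theorem exists_sub_smul_mem_flag {k : Fin n} {Y Z : 𝔫} (hY : Y ∈ flag X (k + 1))
    (hY' : Y ∉ flag X k) (hZ : Z ∈ flag X (k + 1)) : ∃ c : ℝ, Z - c • Y ∈ flag X k := by
  have h0 : X.repr Y k ≠ 0 := fun h => hY' ((repr_eq_zero_iff_mem_flag hY).1 h)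
  refine ⟨X.repr Z k / X.repr Y k, ?_⟩
  rw [← repr_eq_zero_iff_mem_flag (sub_mem hZ (Submodule.smul_mem _ _ hY)), map_sub, map_smul,
    Finsupp.sub_apply, Finsupp.smul_apply, smul_eq_mul, div_mul_cancel₀ _ h0, sub_self]

/-- `ad Z` acts on the line `𝔫ᵢ₊₁ / 𝔫ᵢ` by a scalar `d`. As `ad Z` is nilpotent, a power of `d` is
zero, so `d = 0`. -/
theorem lie_mem_flag [IsNilMatrixAlgebra 𝔫] (hX : IsStrongMalcev X) {i : ℕ} (Z : 𝔫) {Y : 𝔫}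
    (hY : Y ∈ flag X (i + 1)) : ⁅Z, Y⁆ ∈ flag X i := by
  by_cases hi : n ≤ i
  · rw [flag_eq_top hi]; trivial
  · set k : Fin n := ⟨i, by omega⟩ with hk
    change ⁅Z, Y⁆ ∈ flag X k
    change Y ∈ flag X (k + 1) at hY
    have h1 := hX (k + 1) Z (X k) (basis_mem_flag k)
    set d := X.repr ⁅Z, X k⁆ k with hd
    have h2 : ⁅Z, X k⁆ - d • X k ∈ flag X k := sub_smul_mem_flag h1
    have h3 : ∀ j : ℕ, (LieAlgebra.ad ℝ 𝔫 Z ^ j) (X k) - d ^ j • X k ∈ flag X k := by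
      intro j
      induction j with
      | zero => simp
      | succ j ih =>
        rw [pow_succ', Module.End.mul_apply, LieAlgebra.ad_apply]
        have h4 := add_mem (hX k Z _ ih) (Submodule.smul_mem _ (d ^ j) h2)
        rw [lie_sub, lie_smul, smul_sub, sub_add_sub_cancel, smul_smul, ← pow_succ] at h4
        exact h4
    have h5 : (LieAlgebra.ad ℝ 𝔫 Z ^ (2 * nilOrder 𝔫)) (X k) = 0 := by
      refine Subtype.ext ?_
      rw [coe_ad_pow, adMap_pow_eq_zero (pow_nilOrder Z)]
      rfl
    have h6 := h3 (2 * nilOrder 𝔫)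
    rw [h5, zero_sub] at h6
    have h7 := mem_flag_iff.1 h6 k le_rfl
    have h8 : d = 0 := by
      rw [map_neg, map_smul, Finsupp.neg_apply, Finsupp.smul_apply, Module.Basis.repr_self,
        Finsupp.single_eq_same, smul_eq_mul, mul_one, neg_eq_zero] at h7
      by_contra hd0
      exact pow_ne_zero _ hd0 h7
    rw [h8, zero_smul, sub_zero] at h2
    have h9 := hX k Z _ (sub_smul_mem_flag hY)
    rw [lie_sub, lie_smul] at h9
    have := add_mem h9 (Submodule.smul_mem _ (X.repr Y k) h2)
    rwa [sub_add_cancel] at this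

theorem form_swap (l : Module.Dual ℝ 𝔫) (Y Z : 𝔫) : l ⁅Y, Z⁆ = -l ⁅Z, Y⁆ := by
  rw [← lie_skew, map_neg]

/-- The chain `𝔫 = 𝔥₀ ⊇ 𝔥₁ ⊇ ⋯ ⊇ 𝔥ₙ = 𝔭(λ)` of subalgebras: `𝔥ᵢ₊₁` is the set of vectors of `𝔥ᵢ`
orthogonal to `𝔥ᵢ ∩ 𝔫ᵢ₊₁` with respect to `(Y, Z) ↦ λ[Y, Z]`. -/
def orthChain (X : Module.Basis (Fin n) ℝ 𝔫) (l : Module.Dual ℝ 𝔫) : ℕ → Submodule ℝ 𝔫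
  | 0 => ⊤
  | i + 1 =>
    { carrier := {Z | Z ∈ orthChain X l i ∧ ∀ Y ∈ orthChain X l i ⊓ flag X (i + 1), l ⁅Z, Y⁆ = 0}
      zero_mem' := ⟨Submodule.zero_mem _, fun Y _ => by simp⟩
      add_mem' := fun {a b} ha hb => ⟨add_mem ha.1 hb.1, fun Y hY => by
        rw [add_lie, map_add, ha.2 Y hY, hb.2 Y hY, add_zero]⟩
      smul_mem' := fun c a ha => ⟨Submodule.smul_mem _ c ha.1, fun Y hY => by
        rw [smul_lie, map_smul, ha.2 Y hY, smul_zero]⟩ }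

theorem orthChain_succ_le (i : ℕ) : orthChain X l (i + 1) ≤ orthChain X l i := fun _ h => h.1

theorem orthChain_antitone : Antitone (orthChain X l) := antitone_nat_of_succ_le orthChain_succ_le

theorem orthChain_orth {i : ℕ} {Z Y : 𝔫} (hZ : Z ∈ orthChain X l i)
    (hY : Y ∈ orthChain X l i ⊓ flag X i) : l ⁅Z, Y⁆ = 0 := by
  rcases i with _ | i
  · rw [flag_zero, inf_bot_eq, Submodule.mem_bot] at hY
    simp [hY]
  · exact hZ.2 Y ⟨hY.1.1, hY.2⟩

/-- By Jacobi, `λ[[Z,W],Y] = λ[Z,[W,Y]] - λ[W,[Z,Y]]`. For `Y ∈ 𝔥ᵢ ∩ 𝔫ᵢ₊₁` the inner brackets lie in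
`𝔥ᵢ ∩ 𝔫ᵢ`, to which `𝔥ᵢ` is orthogonal. -/
theorem lie_mem_orthChain_succ [IsNilMatrixAlgebra 𝔫] (hX : IsStrongMalcev X) {i : ℕ} {Z W : 𝔫}
    (hZ : Z ∈ orthChain X l i) (hW : W ∈ orthChain X l i) : ⁅Z, W⁆ ∈ orthChain X l (i + 1) := by
  have key : ∀ i, (∀ Z ∈ orthChain X l i, ∀ W ∈ orthChain X l i, ⁅Z, W⁆ ∈ orthChain X l i) →
      ∀ Z ∈ orthChain X l i, ∀ W ∈ orthChain X l i, ⁅Z, W⁆ ∈ orthChain X l (i + 1) := by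
    intro i hi Z hZ W hW
    refine ⟨hi Z hZ W hW, fun Y hY => ?_⟩
    rw [lie_lie, map_sub,
      orthChain_orth hZ ⟨hi W hW Y hY.1, lie_mem_flag hX W hY.2⟩,
      orthChain_orth hW ⟨hi Z hZ Y hY.1, lie_mem_flag hX Z hY.2⟩, sub_zero]
  refine key i ?_ Z hZ W hW
  clear hZ hW
  induction i with
  | zero => intro _ _ _ _; trivial
  | succ i ih =>
    intro Z hZ W hW
    exact key i ih Z hZ.1 W hW.1

theorem lie_mem_orthChain [IsNilMatrixAlgebra 𝔫] (hX : IsStrongMalcev X) {i : ℕ} {Z W : 𝔫}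
    (hZ : Z ∈ orthChain X l i) (hW : W ∈ orthChain X l i) : ⁅Z, W⁆ ∈ orthChain X l i :=
  (lie_mem_orthChain_succ hX hZ hW).1

theorem orthChain_inf_flag_le (i : ℕ) : orthChain X l i ⊓ flag X i ≤ orthChain X l (i + 1) :=
  fun Y hY => ⟨hY.1, fun Z hZ => by rw [form_swap, orthChain_orth hZ.1 hY, neg_zero]⟩

/-- On `𝔥ᵢ ∩ 𝔫ᵢ₊₁` the form factors through a quotient of dimension at most one, where an
alternating form vanishes. -/
theorem orthChain_inf_flag_succ_le {i : ℕ} (hi : i < n) :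
    orthChain X l i ⊓ flag X (i + 1) ≤ orthChain X l (i + 1) := by
  intro Y hY
  refine ⟨hY.1, fun Z hZ => ?_⟩
  by_cases h : Z ∈ flag X i
  · exact orthChain_orth hY.1 ⟨hZ.1, h⟩
  · obtain ⟨c, hc⟩ := exists_sub_smul_mem_flag (k := ⟨i, hi⟩) hZ.2 h hY.2
    have := orthChain_orth hZ.1 ⟨sub_mem hY.1 (Submodule.smul_mem _ c hZ.1), hc⟩
    rw [lie_sub, lie_smul, lie_self, smul_zero, sub_zero, form_swap, neg_eq_zero] at this
    exact this

/-- `𝔥ᵢ₊₁` has codimension at most one in `𝔥ᵢ`. -/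
theorem mem_orthChain_succ_of_form_eq_zero {i : ℕ} (hi : i < n) {W Y Z : 𝔫}
    (hW : W ∈ orthChain X l i) (hY : Y ∈ orthChain X l i ⊓ flag X (i + 1)) (hWY : l ⁅W, Y⁆ ≠ 0)
    (hZ : Z ∈ orthChain X l i) (hZY : l ⁅Z, Y⁆ = 0) : Z ∈ orthChain X l (i + 1) := by
  refine ⟨hZ, fun Y' hY' => ?_⟩
  have h : Y ∉ flag X i := fun h => hWY (orthChain_orth hW ⟨hY.1, h⟩)
  obtain ⟨c, hc⟩ := exists_sub_smul_mem_flag (k := ⟨i, hi⟩) hY.2 h hY'.2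
  have := orthChain_orth hZ ⟨sub_mem hY'.1 (Submodule.smul_mem _ c hY.1), hc⟩
  rw [lie_sub, lie_smul, map_sub, map_smul, hZY, smul_zero, sub_zero] at this
  exact this

theorem exists_form_ne_zero {i : ℕ} {W : 𝔫} (hW : W ∈ orthChain X l i)
    (hW' : W ∉ orthChain X l (i + 1)) : ∃ Y ∈ orthChain X l i ⊓ flag X (i + 1), l ⁅W, Y⁆ ≠ 0 := by
  by_contra! h
  exact hW' ⟨hW, h⟩

theorem orthChain_inf_flag_le_of_le {i j : ℕ} (hij : i ≤ j) :
    orthChain X l i ⊓ flag X i ≤ orthChain X l j ⊓ flag X j := by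
  induction j, hij using Nat.le_induction with
  | base => exact le_rfl
  | succ j _ ih =>
    exact fun Y hY => ⟨orthChain_inf_flag_le j (ih hY), flag_mono (Nat.le_succ j) (ih hY).2⟩

/-- `𝔥ᵢ` is the orthogonal space of `𝔥ᵢ ∩ 𝔫ᵢ`. -/
theorem mem_orthChain_of_orth {i : ℕ} (hi : i ≤ n) {W : 𝔫}
    (hW : ∀ Y ∈ orthChain X l i ⊓ flag X i, l ⁅W, Y⁆ = 0) : W ∈ orthChain X l i := by
  have key : ∀ j ≤ i, W ∈ orthChain X l j := by
    intro j
    induction j with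
    | zero => intro _; trivial
    | succ j ih =>
      intro hj
      refine ⟨ih (by omega), fun Y hY => hW Y ?_⟩
      exact orthChain_inf_flag_le_of_le hj
        ⟨orthChain_inf_flag_succ_le (by omega) hY, hY.2⟩
  exact key i le_rfl

/-- A vector `Y` of the radical of `𝔫ₖ₊₁` is orthogonal to all `𝔫ᵢ₊₁` with `i ≤ k`; from then on it
lies in `𝔥ᵢ ∩ 𝔫ᵢ`, which the chain never leaves. -/
theorem polarization_le_orthChain {i : ℕ} : polarization X l ≤ orthChain X l i := by
  refine iSup_le fun k => ?_
  intro Y hY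
  induction i with
  | zero => trivial
  | succ i ih =>
    by_cases h : i + 1 ≤ k + 1
    · refine ⟨ih, fun Z hZ => ?_⟩
      rw [form_swap, hY.2 Z (flag_mono h hZ.2), neg_zero]
    · exact orthChain_inf_flag_le i ⟨ih, flag_mono (by omega) hY.1⟩

/-- Let `L = 𝔥ᵢ ∩ 𝔫ᵢ`, which is its own orthogonal space in `𝔫ᵢ`. Since `Y` is orthogonal to `L`,
duality gives `e ∈ L` with `λ[Y, ·] = λ[e, ·]` on `𝔫ᵢ`. Then `Y - e` is also orthogonal to `Y`,
hence is in the radical of `𝔫ᵢ₊₁`, and `e` is covered by induction. -/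
theorem orthChain_inf_flag_le_polarization {i : ℕ} (hi : i ≤ n) :
    orthChain X l i ⊓ flag X i ≤ polarization X l := by
  induction i with
  | zero => rw [flag_zero, inf_bot_eq]; exact bot_le
  | succ i ih =>
    have ih := ih (by omega)
    intro Y hY
    have hYi : Y ∈ orthChain X l i := hY.1.1
    by_cases hYf : Y ∈ flag X i
    · exact ih ⟨hYi, hYf⟩
    let b : 𝔫 →ₗ[ℝ] Module.Dual ℝ 𝔫 := LinearMap.mk₂ ℝ (fun Z V => l ⁅Z, V⁆)
      (by intros; simp) (by intros; simp) (by intros; simp) (by intros; simp)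
    have hb : ∀ Z V, b Z V = l ⁅Z, V⁆ := fun Z V => rfl
    set L := orthChain X l i ⊓ flag X i with hL
    -- `S` consists of the functionals that agree on `𝔫ᵢ` with some `λ[e, ·]`, `e ∈ L`. To find
    -- `λ[Y, ·]` in it, it suffices that this functional kills the common zeros of `S`.
    let S : Submodule ℝ (Module.Dual ℝ 𝔫) := L.map b ⊔ (flag X i).dualAnnihilator
    have : FiniteDimensional ℝ 𝔫 := X.finiteDimensional_of_finite
    have hS : S.dualCoannihilator ≤ L := by
      intro v hv
      rw [Submodule.mem_dualCoannihilator] at hv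
      have hv1 : v ∈ flag X i := by
        rw [← Subspace.dualAnnihilator_dualCoannihilator_eq (W := flag X i),
          Submodule.mem_dualCoannihilator]
        exact fun φ hφ => hv φ (Submodule.mem_sup_right hφ)
      refine ⟨mem_orthChain_of_orth (by omega) fun Z hZ => ?_, hv1⟩
      have := hv (b Z) (Submodule.mem_sup_left ⟨Z, hZ, rfl⟩)
      rw [hb] at this
      rw [form_swap, this, neg_zero]
    have hmem : b Y ∈ S := by
      rw [← Subspace.dualCoannihilator_dualAnnihilator_eq (W := S),
        Submodule.mem_dualAnnihilator]
      exact fun v hv => orthChain_orth hYi (hS hv)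
    obtain ⟨_, ⟨e, he, rfl⟩, ψ, hψ, hsum⟩ := Submodule.mem_sup.1 hmem
    have h1 : ∀ Z ∈ flag X i, l ⁅Y - e, Z⁆ = 0 := by
      intro Z hZ
      have := LinearMap.congr_fun hsum Z
      rw [LinearMap.add_apply, (Submodule.mem_dualAnnihilator ψ).1 hψ Z hZ, add_zero, hb, hb] at this
      rw [sub_lie, map_sub, this, sub_self]
    have h2 : l ⁅Y - e, Y⁆ = 0 := by
      rw [sub_lie, lie_self, zero_sub, map_neg, form_swap, orthChain_orth hYi he, neg_zero, neg_zero]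
    have h3 : Y - e ∈ radical X l (i + 1) := by
      refine ⟨sub_mem hY.2 (flag_mono (Nat.le_succ i) he.2), fun Z hZ => ?_⟩
      obtain ⟨c, hc⟩ := exists_sub_smul_mem_flag (k := ⟨i, by omega⟩) hY.2 hYf hZ
      have h4 := h1 _ hc
      rw [lie_sub, lie_smul, map_sub, map_smul, h2, smul_zero, sub_zero] at h4
      rw [form_swap, h4, neg_zero]
    have h5 : Y - e ∈ polarization X l :=
      le_iSup (fun k : Fin n => radical X l ((k : ℕ) + 1)) ⟨i, by omega⟩ h3
    have := add_mem h5 (ih he)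
    rwa [sub_add_cancel] at this

theorem orthChain_eq_polarization : orthChain X l n = polarization X l := by
  refine le_antisymm ?_ polarization_le_orthChain
  have := orthChain_inf_flag_le_polarization (X := X) (l := l) le_rfl
  rwa [flag_eq_top le_rfl, inf_top_eq] at this

theorem lie_mem_polarization [IsNilMatrixAlgebra 𝔫] (hX : IsStrongMalcev X) {Z W : 𝔫}
    (hZ : Z ∈ polarization X l) (hW : W ∈ polarization X l) : ⁅Z, W⁆ ∈ polarization X l := by
  rw [← orthChain_eq_polarization] at *
  exact lie_mem_orthChain hX hZ hW

theorem form_eq_zero_of_mem_polarization {Z W : 𝔫} (hZ : Z ∈ polarization X l)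
    (hW : W ∈ polarization X l) : l ⁅Z, W⁆ = 0 := by
  rw [← orthChain_eq_polarization] at *
  exact orthChain_orth hZ ⟨hW, by rw [flag_eq_top le_rfl]; trivial⟩

/-- `W` is in `𝔥ᵢ` but not in `𝔥ᵢ₊₁`, its leading term is `X_j`, and no vector of smaller leading
term is in `𝔥ᵢ` but not in `𝔥ᵢ₊₁`. -/
def IsAdapted (X : Module.Basis (Fin n) ℝ 𝔫) (l : Module.Dual ℝ 𝔫) (i : ℕ) (j : Fin n) (W : 𝔫) :
    Prop :=
  W ∈ orthChain X l i ∧ W ∉ orthChain X l (i + 1) ∧ W - X j ∈ flag X j ∧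
    flag X j ⊓ orthChain X l i ≤ orthChain X l (i + 1)

theorem IsAdapted.mem_flag {i : ℕ} {j : Fin n} {W : 𝔫} (h : IsAdapted X l i j W) :
    W ∈ flag X (j + 1) := by
  have := add_mem (flag_mono (Nat.le_succ j) h.2.2.1) (basis_mem_flag (X := X) j)
  rwa [sub_add_cancel] at this

theorem mem_jumpSet {k : Fin n} : k ∈ jumpSet X l ↔ X k ∉ flag X k ⊔ polarization X l := by
  simp [jumpSet]

/-- `j` is the least index of a leading term lost between `𝔥ᵢ` and `𝔥ᵢ₊₁`. Were it not a jump, some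
`p ∈ 𝔭(λ) ⊆ 𝔥ᵢ₊₁` would have the leading term of `W`; by minimality `W - p`, and so `W`, would lie
in `𝔥ᵢ₊₁`. -/
theorem exists_isAdapted_of_not_le {i : ℕ}
    (h : ¬orthChain X l i ≤ orthChain X l (i + 1)) :
    ∃ j ∈ jumpSet X l, ∃ W, IsAdapted X l i j W := by
  classical
  have hex : ∃ j, ¬flag X j ⊓ orthChain X l i ≤ orthChain X l (i + 1) :=
    ⟨n, by rwa [flag_eq_top le_rfl, top_inf_eq]⟩
  have hspec := Nat.find_spec hex
  have hmin : ∀ j < Nat.find hex, flag X j ⊓ orthChain X l i ≤ orthChain X l (i + 1) :=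
    fun j hj => not_not.1 (Nat.find_min hex hj)
  have hle : Nat.find hex ≤ n := Nat.find_le (by rwa [flag_eq_top le_rfl, top_inf_eq])
  rcases hJ : Nat.find hex with _ | j
  · rw [hJ, flag_zero, bot_inf_eq] at hspec
    exact absurd bot_le hspec
  rw [hJ] at hspec hmin hle
  set k : Fin n := ⟨j, by omega⟩ with hk
  obtain ⟨V, hV, hV'⟩ := SetLike.not_le_iff_exists.1 hspec
  have hVk : V ∈ flag X (k + 1) := hV.1
  have hc : X.repr V k ≠ 0 := fun h0 =>
    hV' (hmin j (by omega) ⟨(repr_eq_zero_iff_mem_flag hVk).1 h0, hV.2⟩)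
  set W := (X.repr V k)⁻¹ • V with hW
  have hW1 : W ∉ orthChain X l (i + 1) := fun h0 => hV' (by
    have := Submodule.smul_mem _ (X.repr V k) h0
    rwa [hW, smul_smul, mul_inv_cancel₀ hc, one_smul] at this)
  have had : IsAdapted X l i k W := by
    refine ⟨Submodule.smul_mem _ _ hV.2, hW1, ?_, hmin j (by omega)⟩
    have := Submodule.smul_mem _ (X.repr V k)⁻¹ (sub_smul_mem_flag hVk)
    rwa [smul_sub, smul_smul, inv_mul_cancel₀ hc, one_smul] at this
  refine ⟨k, mem_jumpSet.2 fun hmem => ?_, W, had⟩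
  obtain ⟨v, hv, p, hp, hvp⟩ := Submodule.mem_sup.1 hmem
  have hWp : W - p ∈ flag X k := by
    have := add_mem had.2.2.1 hv
    rw [← hvp] at this
    convert this using 1
    abel
  have h1 : p ∈ orthChain X l (i + 1) := polarization_le_orthChain hp
  have h2 := add_mem (had.2.2.2 ⟨hWp, sub_mem had.1 h1.1⟩) h1
  rw [sub_add_cancel] at h2
  exact hW1 h2

/-- The leading term `X_j` occurs in `𝔥₀ = 𝔫` but not in `𝔥ₙ = 𝔭(λ)`; `i` is the step at which it is
lost. -/
theorem exists_isAdapted_of_mem_jumpSet {j : Fin n} (hj : j ∈ jumpSet X l) :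
    ∃ i < n, ∃ W, IsAdapted X l i j W := by
  classical
  have h0 : ¬∃ W ∈ orthChain X l n, W - X j ∈ flag X j := by
    rintro ⟨W, hW, hWj⟩
    rw [orthChain_eq_polarization] at hW
    refine mem_jumpSet.1 hj ?_
    have := Submodule.add_mem_sup (neg_mem hWj) hW
    rwa [neg_sub, sub_add_cancel] at this
  have hex : ∃ i, ¬∃ W ∈ orthChain X l i, W - X j ∈ flag X j := ⟨n, h0⟩
  have hspec := Nat.find_spec hex
  have hle : Nat.find hex ≤ n := Nat.find_le h0
  rcases hI : Nat.find hex with _ | i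
  · rw [hI] at hspec
    exact absurd ⟨X j, trivial, by simp⟩ hspec
  have hprev : ∃ W ∈ orthChain X l i, W - X j ∈ flag X j :=
    not_not.1 (Nat.find_min hex (m := i) (by omega))
  rw [hI] at hspec hle
  obtain ⟨W, hW, hWj⟩ := hprev
  have hW1 : W ∉ orthChain X l (i + 1) := fun h => hspec ⟨W, h, hWj⟩
  refine ⟨i, by omega, W, hW, hW1, hWj, ?_⟩
  intro v hv
  by_contra hv1
  -- If a vector `v` of smaller leading term were lost too, a combination `W - c v` orthogonal to
  -- `Y` would stay in `𝔥ᵢ₊₁` and keep the leading term `X_j`.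
  obtain ⟨Y, hY, hWY⟩ := exists_form_ne_zero hW hW1
  have hvY : l ⁅v, Y⁆ ≠ 0 := fun h =>
    hv1 (mem_orthChain_succ_of_form_eq_zero (by omega) hW hY hWY hv.2 h)
  refine hspec ⟨W - (l ⁅W, Y⁆ / l ⁅v, Y⁆) • v, ?_, ?_⟩
  · refine mem_orthChain_succ_of_form_eq_zero (by omega) hW hY hWY
      (sub_mem hW (Submodule.smul_mem _ _ hv.2)) ?_
    rw [sub_lie, smul_lie, map_sub, map_smul, smul_eq_mul, div_mul_cancel₀ _ hvY, sub_self]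
  · rw [sub_right_comm]
    exact sub_mem hWj (Submodule.smul_mem _ _ hv.1)

/-- Together with `IsAdapted.step_unique` and the two existence lemmas, this matches the jump
indices bijectively with the steps at which the chain drops. -/
theorem IsAdapted.index_unique {i : ℕ} {j j' : Fin n} {W W' : 𝔫} (h : IsAdapted X l i j W)
    (h' : IsAdapted X l i j' W') : j = j' := by
  have key : ∀ {j j' : Fin n} {W W' : 𝔫}, IsAdapted X l i j W → IsAdapted X l i j' W' → ¬j < j' :=
    fun {j j' W W'} h h' hlt =>
      h.2.1 (h'.2.2.2 ⟨flag_mono (Nat.succ_le_of_lt hlt) h.mem_flag, h.1⟩)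
  exact le_antisymm (not_lt.1 (key h' h)) (not_lt.1 (key h h'))

theorem IsAdapted.step_unique {i i' : ℕ} {j : Fin n} {W W' : 𝔫} (h : IsAdapted X l i j W)
    (h' : IsAdapted X l i' j W') : i = i' := by
  have key : ∀ {i i' : ℕ} {W W' : 𝔫}, IsAdapted X l i j W → IsAdapted X l i' j W' → ¬i < i' := by
    intro i i' W W' h h' hlt
    have h1 : W' ∈ orthChain X l (i + 1) := orthChain_antitone hlt h'.1
    have h2 : W - W' ∈ flag X j := by
      have := sub_mem h.2.2.1 h'.2.2.1
      rwa [sub_sub_sub_cancel_right] at this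
    have h3 := add_mem (h.2.2.2 ⟨h2, sub_mem h.1 h1.1⟩) h1
    rw [sub_add_cancel] at h3
    exact h.2.1 h3
  exact le_antisymm (not_lt.1 (key h' h)) (not_lt.1 (key h h'))

end Polarization
end WaveletRep
end


noncomputable section

namespace WaveletRep

/-! ### Coordinates on `N` and on `N / P(λ)`. -/

section Coordinates

variable {m n : ℕ} {𝔫 : LieSubalgebra ℝ (Matrix (Fin m) (Fin m) ℝ)}
  {X : Module.Basis (Fin n) ℝ 𝔫} {l : Module.Dual ℝ 𝔫}

/-- `exp (t_k X_k) ⋯ exp (t_n X_n)`: the factors of `malcevCoord X t` from the index `k` on. -/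
def tailProd (X : Module.Basis (Fin n) ℝ 𝔫) (t : Fin n → ℝ) (k : ℕ) : lieGroup 𝔫 :=
  (((List.finRange n).drop k).map fun i => expN (t i • X i)).prod

theorem tailProd_of_le (t : Fin n → ℝ) {k : ℕ} (hk : n ≤ k) : tailProd X t k = 1 := by
  rw [tailProd, List.drop_eq_nil_of_le (by simpa using hk)]
  rfl

theorem tailProd_eq_mul (t : Fin n → ℝ) (k : Fin n) :
    tailProd X t k = expN (t k • X k) * tailProd X t (k + 1) := by
  rw [tailProd, List.drop_eq_getElem_cons (by simp)]
  simp [tailProd]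

/-- Descending induction from `n`. -/
theorem descending_induction {P : ℕ → Prop} (hn : ∀ k, n ≤ k → P k)
    (hs : ∀ k : Fin n, P (k + 1) → P k) (k : ℕ) : P k := by
  by_cases hk : n ≤ k
  · exact hn k hk
  · exact Nat.decreasingInduction (motive := fun k _ => P k) (n := n)
      (fun k hk h => hs ⟨k, hk⟩ h) (hn n le_rfl) (by omega)

theorem tailProd_congr {t t' : Fin n → ℝ} (k : ℕ) (h : ∀ i : Fin n, k ≤ i → t i = t' i) :
    tailProd X t k = tailProd X t' k := by
  induction k using descending_induction (n := n) with
  | hn k hk => rw [tailProd_of_le t hk, tailProd_of_le t' hk]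
  | hs k ih =>
    rw [tailProd_eq_mul, tailProd_eq_mul, h k le_rfl, ih fun i hi => h i (by omega)]

theorem polarization_inf_flag_le {k : Fin n} (hk : k ∈ jumpSet X l) {Y : 𝔫}
    (hY : Y ∈ polarization X l) (hYk : Y ∈ flag X (k + 1)) : Y ∈ flag X k := by
  by_contra h
  obtain ⟨c, hc⟩ := exists_sub_smul_mem_flag hYk h (basis_mem_flag k)
  refine mem_jumpSet.1 hk ?_
  have := Submodule.add_mem_sup hc (Submodule.smul_mem _ c hY)
  rwa [sub_add_cancel] at this

open Classical in
/-- The extension by zero of a vector of coordinates indexed by the jump set. -/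
def extendJump (X : Module.Basis (Fin n) ℝ 𝔫) (l : Module.Dual ℝ 𝔫) (t : jumpSet X l → ℝ) :
    Fin n → ℝ := fun k => if h : k ∈ jumpSet X l then t ⟨k, h⟩ else 0

theorem crossSection_eq (t : jumpSet X l → ℝ) :
    crossSection X l t = malcevCoord X (extendJump X l t) := rfl

theorem extendJump_apply (t : jumpSet X l → ℝ) (k : jumpSet X l) : extendJump X l t k = t k := by
  simp [extendJump]

theorem extendJump_of_notMem (t : jumpSet X l → ℝ) : ∀ i ∉ jumpSet X l, extendJump X l t i = 0 :=
  fun i hi => by simp [extendJump, hi]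

theorem extendJump_restrict {t : Fin n → ℝ} (ht : ∀ i ∉ jumpSet X l, t i = 0) :
    extendJump X l (fun k => t k) = t := by
  ext k
  by_cases hk : k ∈ jumpSet X l
  · simp [extendJump, hk]
  · simp [extendJump, hk, ht k hk]

theorem continuous_dual (f : Module.Dual ℝ 𝔫) : Continuous f :=
  LinearMap.continuous_of_finiteDimensional (E := 𝔫.toSubmodule) f

variable [IsNilMatrixAlgebra 𝔫]

theorem continuous_expN_smul (Y : 𝔫) : Continuous fun s : ℝ => expN (s • Y) := by
  refine continuous_expN.comp ?_
  exact (continuous_id.smul continuous_const).subtype_mk fun s => (s • Y).2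

theorem continuous_tailProd (k : ℕ) : Continuous fun t : Fin n → ℝ => tailProd X t k := by
  induction k using descending_induction (n := n) with
  | hn k hk => simp only [tailProd_of_le _ hk]; exact continuous_const
  | hs k ih =>
    simp only [tailProd_eq_mul]
    exact ((continuous_expN_smul (X k)).comp (continuous_apply k)).mul ih

theorem continuous_crossSection : Continuous (crossSection X l) := by
  refine (continuous_tailProd (X := X) 0).comp (continuous_pi fun k => ?_)
  by_cases h : k ∈ jumpSet X l
  · simpa [h] using continuous_apply _
  · simpa [h] using continuous_const

/-- The coefficient of `X_k` in the logarithm. -/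
def lead (X : Module.Basis (Fin n) ℝ 𝔫) (k : Fin n) (x : lieGroup 𝔫) : ℝ := X.repr (logN x) k

theorem continuous_lead (k : Fin n) : Continuous (lead X k) :=
  (continuous_dual (X.coord k)).comp continuous_logN

/-- The normal subgroup `exp 𝔫ᵢ`, as a set. -/
def level (X : Module.Basis (Fin n) ℝ 𝔫) (i : ℕ) : Set (lieGroup 𝔫) := {x | logN x ∈ flag X i}

theorem level_mono {i j : ℕ} (h : i ≤ j) : level X i ⊆ level X j := fun _ hx => flag_mono h hx

theorem one_mem_level (i : ℕ) : (1 : lieGroup 𝔫) ∈ level X i := by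
  change logN 1 ∈ flag X i
  rw [logN_one]
  exact zero_mem _

theorem eq_one_of_mem_level_zero {x : lieGroup 𝔫} (hx : x ∈ level X 0) : x = 1 := by
  change logN x ∈ flag X 0 at hx
  rw [flag_zero, Submodule.mem_bot] at hx
  rw [← expN_logN x, hx, expN_zero]

theorem mem_level_of_le {i : ℕ} (hi : n ≤ i) (x : lieGroup 𝔫) : x ∈ level X i := by
  change logN x ∈ flag X i
  rw [flag_eq_top hi]
  trivial

theorem expN_mem_level {i : ℕ} {Y : 𝔫} (hY : Y ∈ flag X i) : expN Y ∈ level X i := by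
  change logN (expN Y) ∈ flag X i
  rwa [logN_expN]

theorem lead_expN (k : Fin n) (Y : 𝔫) : lead X k (expN Y) = X.repr Y k := by rw [lead, logN_expN]

theorem lead_expN_smul_basis (k : Fin n) (s : ℝ) : lead X k (expN (s • X k)) = s := by
  rw [lead_expN, map_smul, Module.Basis.repr_self]
  simp

theorem inv_mem_level {i : ℕ} {x : lieGroup 𝔫} (hx : x ∈ level X i) : x⁻¹ ∈ level X i := by
  change logN x⁻¹ ∈ flag X i
  rw [logN_inv]
  exact neg_mem hx

theorem lead_inv (k : Fin n) (x : lieGroup 𝔫) : lead X k x⁻¹ = -lead X k x := by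
  rw [lead, logN_inv, map_neg]
  rfl

theorem mem_level_iff_lead_eq_zero {k : Fin n} {x : lieGroup 𝔫} (hx : x ∈ level X (k + 1)) :
    x ∈ level X k ↔ lead X k x = 0 := (repr_eq_zero_iff_mem_flag hx).symm

theorem lead_eq_zero {k : Fin n} {x : lieGroup 𝔫} (hx : x ∈ level X k) : lead X k x = 0 :=
  mem_flag_iff.1 hx k le_rfl

theorem mul_mem_level (hX : IsStrongMalcev X) {i : ℕ} {x y : lieGroup 𝔫} (hx : x ∈ level X i)
    (hy : y ∈ level X i) : x * y ∈ level X i :=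
  (logN_mul_mem (k := flag X i) le_rfl (fun a _ b hb => hX i a b hb) hx hy).1

theorem lead_mul (hX : IsStrongMalcev X) {k : Fin n} {x y : lieGroup 𝔫}
    (hx : x ∈ level X (k + 1)) (hy : y ∈ level X (k + 1)) :
    lead X k (x * y) = lead X k x + lead X k y := by
  have := (logN_mul_mem (k := flag X (k + 1)) (k' := flag X k) (flag_mono (Nat.le_succ k))
    (fun a _ b hb => lie_mem_flag hX a hb) hx hy).2
  have := mem_flag_iff.1 this k le_rfl
  rw [map_sub, map_add, Finsupp.sub_apply, Finsupp.add_apply, sub_eq_zero] at this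
  exact this

theorem conj_mem_level (hX : IsStrongMalcev X) {i : ℕ} (g : lieGroup 𝔫) {x : lieGroup 𝔫}
    (hx : x ∈ level X i) : g * x * g⁻¹ ∈ level X i := by
  change logN _ ∈ flag X i
  rw [logN_conj]
  exact adExp_mem (fun V hV => hX i _ V hV) hx

theorem lead_conj (hX : IsStrongMalcev X) {k : Fin n} (g : lieGroup 𝔫) {x : lieGroup 𝔫}
    (hx : x ∈ level X (k + 1)) : lead X k (g * x * g⁻¹) = lead X k x := by
  have := adExp_sub_mem (E := flag X k) (Z := logN g) (Y := logN x) (fun V hV => hX k _ V hV)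
    (lie_mem_flag hX _ hx)
  have := mem_flag_iff.1 this k le_rfl
  rw [map_sub, Finsupp.sub_apply, sub_eq_zero] at this
  rw [lead, logN_conj, this, lead]

/-- The group `P(λ) = exp 𝔭(λ)`. -/
def polGroup (hX : IsStrongMalcev X) (l : Module.Dual ℝ 𝔫) : Subgroup (lieGroup 𝔫) where
  carrier := {x | logN x ∈ polarization X l}
  one_mem' := by
    change logN (1 : lieGroup 𝔫) ∈ polarization X l
    rw [logN_one]
    exact zero_mem _
  mul_mem' := fun {x y} hx hy => (logN_mul_mem (k := polarization X l) le_rfl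
    (fun a ha b hb => lie_mem_polarization hX ha hb) hx hy).1
  inv_mem' := fun {x} hx => by
    change logN x⁻¹ ∈ polarization X l
    rw [logN_inv]
    exact neg_mem hx

theorem mem_polGroup {hX : IsStrongMalcev X} {x : lieGroup 𝔫} :
    x ∈ polGroup hX l ↔ logN x ∈ polarization X l := Iff.rfl

theorem expN_mem_polGroup (hX : IsStrongMalcev X) {Y : 𝔫} (hY : Y ∈ polarization X l) :
    expN Y ∈ polGroup hX l := by rwa [mem_polGroup, logN_expN]

/-- `λ ∘ log` is additive on `P(λ)`. -/
theorem form_logN_mul (hX : IsStrongMalcev X) {x y : lieGroup 𝔫} (hx : x ∈ polGroup hX l)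
    (hy : y ∈ polGroup hX l) : l (logN (x * y)) = l (logN x) + l (logN y) := by
  have := (logN_mul_mem (k := polarization X l) (k' := polarization X l ⊓ LinearMap.ker l)
    inf_le_left (fun a ha b hb => ⟨lie_mem_polarization hX ha hb,
      LinearMap.mem_ker.2 (form_eq_zero_of_mem_polarization ha hb)⟩) hx hy).2.2
  have := LinearMap.mem_ker.1 this
  rwa [map_sub, map_add, sub_eq_zero] at this

theorem malcevCoord_eq_mul_tailProd (hX : IsStrongMalcev X) (t : Fin n → ℝ) (k : ℕ) (hk : k ≤ n) :
    ∃ a ∈ level X k, malcevCoord X t = a * tailProd X t k := by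
  induction k with
  | zero => exact ⟨1, one_mem_level 0, by rw [one_mul]; rfl⟩
  | succ k ih =>
    obtain ⟨a, ha, h⟩ := ih (by omega)
    refine ⟨a * expN (t ⟨k, hk⟩ • X ⟨k, hk⟩), mul_mem_level hX (level_mono (Nat.le_succ k) ha)
      (expN_mem_level (Submodule.smul_mem _ _ (basis_mem_flag ⟨k, hk⟩))), ?_⟩
    rw [h, mul_assoc, tailProd_eq_mul t ⟨k, hk⟩]

/-- Coordinates are compared from the last one down. Once the later ones agree, `p' p⁻¹` is
conjugate by the common tail to an element of `exp 𝔫ₖ₊₁` with leading coefficient `t k - t' k`.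
Conjugation preserves that coefficient, and at a jump index an element of `P(λ)` has none. -/
theorem tail_unique (hX : IsStrongMalcev X) (k : ℕ) {a a' p p' : lieGroup 𝔫} {t t' : Fin n → ℝ}
    (ht : ∀ i ∉ jumpSet X l, t i = 0) (ht' : ∀ i ∉ jumpSet X l, t' i = 0)
    (ha : a ∈ level X k) (ha' : a' ∈ level X k) (hp : p ∈ polGroup hX l) (hp' : p' ∈ polGroup hX l)
    (h : a * tailProd X t k * p = a' * tailProd X t' k * p') :
    ∀ i : Fin n, k ≤ i → t i = t' i := by
  induction k using descending_induction (n := n) generalizing a a' with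
  | hn k hk => intro i hi; have := i.2; omega
  | hs k ih =>
    rw [tailProd_eq_mul, tailProd_eq_mul, ← mul_assoc, ← mul_assoc] at h
    have hb : ∀ s : ℝ, expN (s • X k) ∈ level X (k + 1) := fun s =>
      expN_mem_level (Submodule.smul_mem _ _ (basis_mem_flag k))
    have h1 : a * expN (t k • X k) ∈ level X (k + 1) :=
      mul_mem_level hX (level_mono (Nat.le_succ k) ha) (hb _)
    have h1' : a' * expN (t' k • X k) ∈ level X (k + 1) :=
      mul_mem_level hX (level_mono (Nat.le_succ k) ha') (hb _)
    have ih := ih h1 h1' h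
    have hk : t k = t' k := by
      by_cases hkJ : k ∈ jumpSet X l
      · rw [← tailProd_congr (X := X) (k + 1) ih] at h
        set C := tailProd X t (k + 1)
        have h2 : (a' * expN (t' k • X k))⁻¹ * (a * expN (t k • X k)) =
            C * (p' * p⁻¹) * C⁻¹ := by
          rw [inv_mul_eq_iff_eq_mul, ← mul_assoc, ← mul_assoc, ← mul_assoc, ← h]
          group
        have h3 : C⁻¹ * ((a' * expN (t' k • X k))⁻¹ * (a * expN (t k • X k))) * C⁻¹⁻¹ =
            p' * p⁻¹ := by rw [h2]; group
        have h4 : (a' * expN (t' k • X k))⁻¹ * (a * expN (t k • X k)) ∈ level X (k + 1) :=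
          mul_mem_level hX (inv_mem_level h1') h1
        have h5 : p' * p⁻¹ ∈ level X k := polarization_inf_flag_le hkJ
          (mem_polGroup.1 (mul_mem hp' (inv_mem hp))) (h3 ▸ conj_mem_level hX _ h4)
        have h6 := lead_eq_zero h5
        rw [← h3, lead_conj hX _ h4, lead_mul hX (inv_mem_level h1') h1, lead_inv,
          lead_mul hX (level_mono (Nat.le_succ k) ha') (hb _),
          lead_mul hX (level_mono (Nat.le_succ k) ha) (hb _), lead_eq_zero ha, lead_eq_zero ha',
          lead_expN_smul_basis, lead_expN_smul_basis] at h6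
        linarith
      · rw [ht k hkJ, ht' k hkJ]
    intro i hi
    by_cases hik : i = k
    · rw [hik, hk]
    · exact ih i (by have : (i : ℕ) ≠ k := fun h => hik (Fin.ext h); omega)

/-- The leading coefficient `s` of `a` is removed, for decreasing `k`. At a jump index it becomes
the coordinate. Otherwise some `q ∈ 𝔭(λ)` has leading term `X_k`, and `exp(sq)` is carried through
the tail into `P(λ)`; the conjugation this costs leaves the leading coefficient unchanged. -/
theorem exists_continuous_decomposition (hX : IsStrongMalcev X) (k : ℕ) :
    ∃ (a p : lieGroup 𝔫 → lieGroup 𝔫) (T : lieGroup 𝔫 → Fin n → ℝ), Continuous a ∧ Continuous p ∧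
      Continuous T ∧ ∀ x, a x ∈ level X k ∧ p x ∈ polGroup hX l ∧ (∀ i ∉ jumpSet X l, T x i = 0) ∧
        x = a x * tailProd X (T x) k * p x := by
  classical
  induction k using descending_induction (n := n) with
  | hn k hk =>
    refine ⟨id, fun _ => 1, fun _ => 0, continuous_id, continuous_const, continuous_const,
      fun x => ⟨mem_level_of_le hk x, one_mem _, fun _ _ => rfl, ?_⟩⟩
    rw [tailProd_of_le _ hk]
    simp
  | hs k ih =>
    obtain ⟨a, p, T, ha, hp, hT, h⟩ := ih
    have hs : Continuous fun x => lead X k (a x) := (continuous_lead k).comp ha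
    have htail : ∀ x (s : ℝ), tailProd X (Function.update (T x) k s) (k + 1) =
        tailProd X (T x) (k + 1) := fun x s => tailProd_congr _ fun i hi =>
      Function.update_of_ne (fun h => by subst h; omega) _ _
    by_cases hkJ : k ∈ jumpSet X l
    · refine ⟨fun x => a x * expN (-lead X k (a x) • X k), p,
        fun x => Function.update (T x) k (lead X k (a x)),
        ha.mul ((continuous_expN_smul _).comp hs.neg), hp, hT.update k hs, fun x => ?_⟩
      obtain ⟨h1, h2, h3, h4⟩ := h x
      have hb : expN (-lead X k (a x) • X k) ∈ level X (k + 1) :=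
        expN_mem_level (Submodule.smul_mem _ _ (basis_mem_flag k))
      refine ⟨?_, h2, fun i hi => ?_, ?_⟩
      · rw [mem_level_iff_lead_eq_zero (mul_mem_level hX h1 hb), lead_mul hX h1 hb,
          lead_expN_smul_basis, add_neg_cancel]
      · dsimp only
        rw [Function.update_of_ne (show i ≠ k from fun h => hi (h ▸ hkJ))]
        exact h3 i hi
      · dsimp only
        rw [tailProd_eq_mul, htail, Function.update_self, neg_smul, expN_neg]
        conv_lhs => rw [h4]
        group
    · have hq : ∃ q ∈ polarization X l, q - X k ∈ flag X k := by
        rw [mem_jumpSet, not_not] at hkJ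
        obtain ⟨v, hv, q, hq, hvq⟩ := Submodule.mem_sup.1 hkJ
        exact ⟨q, hq, by rw [← hvq, sub_add_cancel_right]; exact neg_mem hv⟩
      obtain ⟨q, hq, hqk⟩ := hq
      have hq1 : q ∈ flag X (k + 1) := by
        have := add_mem (flag_mono (Nat.le_succ k) hqk) (basis_mem_flag k)
        rwa [sub_add_cancel] at this
      have hqrepr : X.repr q k = 1 := by
        have := mem_flag_iff.1 hqk k le_rfl
        rw [map_sub, Finsupp.sub_apply, Module.Basis.repr_self, Finsupp.single_eq_same,
          sub_eq_zero] at this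
        exact this
      have hC : Continuous fun x => tailProd X (T x) (k + 1) := (continuous_tailProd _).comp hT
      refine ⟨fun x => a x * (tailProd X (T x) (k + 1) * expN (-lead X k (a x) • q) *
          (tailProd X (T x) (k + 1))⁻¹), fun x => expN (lead X k (a x) • q) * p x,
        fun x => Function.update (T x) k 0,
        ha.mul ((hC.mul ((continuous_expN_smul q).comp hs.neg)).mul hC.inv),
        ((continuous_expN_smul q).comp hs).mul hp, hT.update k continuous_const, fun x => ?_⟩
      obtain ⟨h1, h2, h3, h4⟩ := h x
      have hb : expN (-lead X k (a x) • q) ∈ level X (k + 1) :=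
        expN_mem_level (Submodule.smul_mem _ _ hq1)
      refine ⟨?_, mul_mem (expN_mem_polGroup hX (Submodule.smul_mem _ _ hq)) h2,
        fun i hi => ?_, ?_⟩
      · rw [mem_level_iff_lead_eq_zero (mul_mem_level hX h1 (conj_mem_level hX _ hb)),
          lead_mul hX h1 (conj_mem_level hX _ hb), lead_conj hX _ hb, lead_expN, map_smul,
          Finsupp.smul_apply, hqrepr, smul_eq_mul, mul_one, add_neg_cancel]
      · dsimp only
        by_cases hik : i = k
        · rw [hik, Function.update_self]
        · rw [Function.update_of_ne hik]
          exact h3 i hi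
      · dsimp only
        rw [tailProd_eq_mul, htail, Function.update_self, neg_smul, expN_neg, zero_smul, expN_zero]
        conv_lhs => rw [h4]
        group

theorem exists_continuous_section (hX : IsStrongMalcev X) (l : Module.Dual ℝ 𝔫) :
    ∃ (τ : lieGroup 𝔫 → jumpSet X l → ℝ) (p : lieGroup 𝔫 → lieGroup 𝔫), Continuous τ ∧
      Continuous p ∧ ∀ x, p x ∈ polGroup hX l ∧ x = crossSection X l (τ x) * p x := by
  obtain ⟨a, p, T, -, hp, hT, h⟩ := exists_continuous_decomposition (l := l) hX 0
  refine ⟨fun x k => T x k, p, continuous_pi fun k => (continuous_apply _).comp hT, hp,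
    fun x => ⟨(h x).2.1, ?_⟩⟩
  obtain ⟨h1, -, h3, h4⟩ := h x
  rw [crossSection_eq, extendJump_restrict h3]
  rw [eq_one_of_mem_level_zero h1, one_mul] at h4
  exact h4

/-- The coordinates of the coset `x P(λ)`. -/
def secCoord (hX : IsStrongMalcev X) (l : Module.Dual ℝ 𝔫) : lieGroup 𝔫 → jumpSet X l → ℝ :=
  (exists_continuous_section hX l).choose

/-- The component of `x` in `P(λ)`. -/
def polPart (hX : IsStrongMalcev X) (l : Module.Dual ℝ 𝔫) : lieGroup 𝔫 → lieGroup 𝔫 :=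
  (exists_continuous_section hX l).choose_spec.choose

theorem continuous_secCoord (hX : IsStrongMalcev X) : Continuous (secCoord hX l) :=
  (exists_continuous_section hX l).choose_spec.choose_spec.1

theorem continuous_polPart (hX : IsStrongMalcev X) : Continuous (polPart hX l) :=
  (exists_continuous_section hX l).choose_spec.choose_spec.2.1

theorem polPart_mem (hX : IsStrongMalcev X) (x : lieGroup 𝔫) : polPart hX l x ∈ polGroup hX l :=
  ((exists_continuous_section hX l).choose_spec.choose_spec.2.2 x).1

theorem crossSection_mul_polPart (hX : IsStrongMalcev X) (x : lieGroup 𝔫) :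
    crossSection X l (secCoord hX l x) * polPart hX l x = x :=
  ((exists_continuous_section hX l).choose_spec.choose_spec.2.2 x).2.symm

theorem secCoord_eq_of_eq (hX : IsStrongMalcev X) {k : ℕ} (hk : k ≤ n) {x a p : lieGroup 𝔫}
    {t : Fin n → ℝ} (ht : ∀ i ∉ jumpSet X l, t i = 0) (ha : a ∈ level X k)
    (hp : p ∈ polGroup hX l) (h : x = a * tailProd X t k * p) (i : jumpSet X l) (hi : k ≤ i) :
    secCoord hX l x i = t i := by
  obtain ⟨b, hb, hb'⟩ :=
    malcevCoord_eq_mul_tailProd hX (extendJump X l (secCoord hX l x)) k hk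
  have h1 := crossSection_mul_polPart (l := l) hX x
  rw [crossSection_eq, hb'] at h1
  have := tail_unique hX k (extendJump_of_notMem _) ht hb ha (polPart_mem hX x) hp
    (h1.trans h) i hi
  rwa [extendJump_apply] at this

theorem secCoord_crossSection_mul (hX : IsStrongMalcev X) (t : jumpSet X l → ℝ) {p : lieGroup 𝔫}
    (hp : p ∈ polGroup hX l) : secCoord hX l (crossSection X l t * p) = t := by
  ext i
  rw [secCoord_eq_of_eq hX (Nat.zero_le n) (extendJump_of_notMem t) (one_mem_level 0) hp
    (x := crossSection X l t * p) (by rw [one_mul]; rfl) i (Nat.zero_le _), extendJump_apply]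

theorem polPart_crossSection_mul (hX : IsStrongMalcev X) (t : jumpSet X l → ℝ) {p : lieGroup 𝔫}
    (hp : p ∈ polGroup hX l) : polPart hX l (crossSection X l t * p) = p := by
  have := crossSection_mul_polPart (l := l) hX (crossSection X l t * p)
  rwa [secCoord_crossSection_mul hX t hp, mul_left_cancel_iff] at this

theorem secCoord_crossSection (hX : IsStrongMalcev X) (t : jumpSet X l → ℝ) :
    secCoord hX l (crossSection X l t) = t := by
  simpa using secCoord_crossSection_mul hX t (one_mem _)

theorem polPart_crossSection (hX : IsStrongMalcev X) (t : jumpSet X l → ℝ) :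
    polPart hX l (crossSection X l t) = 1 := by
  simpa using polPart_crossSection_mul hX t (one_mem _)

theorem secCoord_mul (hX : IsStrongMalcev X) (x : lieGroup 𝔫) {p : lieGroup 𝔫}
    (hp : p ∈ polGroup hX l) : secCoord hX l (x * p) = secCoord hX l x := by
  conv_lhs => rw [← crossSection_mul_polPart (l := l) hX x, mul_assoc]
  exact secCoord_crossSection_mul hX _ (mul_mem (polPart_mem hX x) hp)

theorem polPart_mul (hX : IsStrongMalcev X) (x : lieGroup 𝔫) {p : lieGroup 𝔫}
    (hp : p ∈ polGroup hX l) : polPart hX l (x * p) = polPart hX l x * p := by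
  conv_lhs => rw [← crossSection_mul_polPart (l := l) hX x, mul_assoc]
  exact polPart_crossSection_mul hX _ (mul_mem (polPart_mem hX x) hp)

/-- Left translation by an element of `exp 𝔫_{e+1}` translates the coordinate of index `e`. -/
theorem secCoord_level_mul (hX : IsStrongMalcev X) (e : jumpSet X l) {z : lieGroup 𝔫}
    (hz : z ∈ level X ((e : Fin n) + 1)) (x : lieGroup 𝔫) :
    secCoord hX l (z * x) e = secCoord hX l x e + lead X e z := by
  classical
  set t := extendJump X l (secCoord hX l x) with ht
  obtain ⟨b, hb, hb'⟩ := malcevCoord_eq_mul_tailProd hX t e (by have := (e : Fin n).2; omega)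
  have h1 := crossSection_mul_polPart (l := l) hX x
  rw [crossSection_eq, hb', tailProd_eq_mul] at h1
  have hexp : ∀ s : ℝ, expN (s • X e) ∈ level X ((e : Fin n) + 1) := fun s =>
    expN_mem_level (Submodule.smul_mem _ _ (basis_mem_flag _))
  have hb1 : b ∈ level X ((e : Fin n) + 1) := level_mono (Nat.le_succ _) hb
  set s := t e + lead X e z with hs
  set y := z * b * expN (t e • X e) with hy
  have hy1 : y ∈ level X ((e : Fin n) + 1) :=
    mul_mem_level hX (mul_mem_level hX hz hb1) (hexp _)
  have hylead : lead X e y = s := by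
    rw [hy, lead_mul hX (mul_mem_level hX hz hb1) (hexp _), lead_mul hX hz hb1, lead_eq_zero hb,
      lead_expN_smul_basis, hs]
    ring
  have hyl : y * expN (-s • X e) ∈ level X e := by
    rw [mem_level_iff_lead_eq_zero (mul_mem_level hX hy1 (hexp _)), lead_mul hX hy1 (hexp _),
      hylead, lead_expN_smul_basis, add_neg_cancel]
  have htail : tailProd X (Function.update t e s) ((e : Fin n) + 1) =
      tailProd X t ((e : Fin n) + 1) := tailProd_congr _ fun i hi =>
    Function.update_of_ne (fun h => by subst h; omega) _ _
  have := secCoord_eq_of_eq hX (k := e) (by have := (e : Fin n).2; omega)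
    (t := Function.update t e s) (fun i hi => ?_) hyl (polPart_mem hX x) (x := z * x) ?_ e le_rfl
  · rw [this, Function.update_self, hs, ht, extendJump_apply]
  · rw [Function.update_of_ne (show i ≠ e from fun h => hi (h ▸ e.2))]
    exact extendJump_of_notMem _ i hi
  · rw [tailProd_eq_mul, htail, Function.update_self, neg_smul, expN_neg]
    conv_lhs => rw [← h1]
    rw [hy]
    group

/-- `y = z x` for some `z` in `exp 𝔫_{k+1}` whose leading coefficient is `δ`. -/
def LevelRel (X : Module.Basis (Fin n) ℝ 𝔫) (k : Fin n) (δ : ℝ) (x y : lieGroup 𝔫) : Prop :=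
  ∃ z ∈ level X ((k : ℕ) + 1), lead X k z = δ ∧ y = z * x

theorem LevelRel.refl (k : Fin n) (x : lieGroup 𝔫) : LevelRel X k 0 x x :=
  ⟨1, one_mem_level _, lead_eq_zero (one_mem_level _), (one_mul x).symm⟩

theorem LevelRel.mul (hX : IsStrongMalcev X) {k : Fin n} {δ δ' : ℝ} {x y x' y' : lieGroup 𝔫}
    (h : LevelRel X k δ x y) (h' : LevelRel X k δ' x' y') :
    LevelRel X k (δ + δ') (x * x') (y * y') := by
  obtain ⟨z, hz, hzδ, rfl⟩ := h
  obtain ⟨z', hz', hzδ', rfl⟩ := h'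
  refine ⟨z * (x * z' * x⁻¹), mul_mem_level hX hz (conj_mem_level hX x hz'), ?_, by group⟩
  rw [lead_mul hX hz (conj_mem_level hX x hz'), lead_conj hX x hz', hzδ, hzδ']

theorem levelRel_expN_smul {k : Fin n} {Y : 𝔫} (hY : Y ∈ flag X (k + 1)) (s s' : ℝ) :
    LevelRel X k ((s' - s) * X.repr Y k) (expN (s • Y)) (expN (s' • Y)) := by
  refine ⟨expN ((s' - s) • Y), expN_mem_level (Submodule.smul_mem _ _ hY), ?_, ?_⟩
  · rw [lead_expN, map_smul]
    rfl
  · rw [← expN_add_smul, sub_add_cancel]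

theorem LevelRel.secCoord (hX : IsStrongMalcev X) {k : jumpSet X l} {δ : ℝ} {x y : lieGroup 𝔫}
    (h : LevelRel X k δ x y) : secCoord hX l y k = WaveletRep.secCoord hX l x k + δ := by
  obtain ⟨z, hz, hzδ, rfl⟩ := h
  rw [secCoord_level_mul hX k hz, hzδ]

/-- Factors of index below `k` do not affect the coefficient of `X_k`, and those above it coincide,
so only the factor of index `k` is seen. This is the triangularity behind the invariance of Lebesgue
measure. -/
theorem levelRel_crossSection (hX : IsStrongMalcev X) (k : jumpSet X l) {t t' : jumpSet X l → ℝ}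
    (h : ∀ j, k < j → t j = t' j) :
    LevelRel X k (t' k - t k) (crossSection X l t) (crossSection X l t') := by
  have key : ∀ i : ℕ, LevelRel X k (if i ≤ k then t' k - t k else 0)
      (tailProd X (extendJump X l t) i) (tailProd X (extendJump X l t') i) := by
    intro i
    induction i using descending_induction (n := n) with
    | hn i hi =>
      rw [tailProd_of_le _ hi, tailProd_of_le _ hi,
        if_neg (by have := (k : Fin n).2; omega)]
      exact LevelRel.refl _ _
    | hs i ih =>
      rw [tailProd_eq_mul, tailProd_eq_mul]
      rcases lt_trichotomy i (k : Fin n) with hik | hik | hik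
      · have h1 := (levelRel_expN_smul (X := X) (k := k) (Y := X i)
          (flag_mono (by omega) (basis_mem_flag i)) (extendJump X l t i) (extendJump X l t' i)).mul
          hX ih
        rw [if_pos (by omega), Module.Basis.repr_self, Finsupp.single_eq_of_ne hik.ne',
          mul_zero, zero_add] at h1
        rwa [if_pos (by omega)]
      · subst hik
        have h1 := (levelRel_expN_smul (X := X) (k := k) (Y := X k)
          (basis_mem_flag _) (extendJump X l t k) (extendJump X l t' k)).mul hX ih
        rw [if_neg (by omega), Module.Basis.repr_self, Finsupp.single_eq_same, mul_one, add_zero,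
          extendJump_apply, extendJump_apply] at h1
        rw [if_pos le_rfl, extendJump_apply, extendJump_apply]
        exact h1
      · rw [if_neg (by omega)] at ih
        rw [if_neg (by omega)]
        have h2 : extendJump X l t i = extendJump X l t' i := by
          by_cases hi : i ∈ jumpSet X l
          · have := h ⟨i, hi⟩ hik
            simpa [extendJump, hi] using this
          · rw [extendJump_of_notMem t i hi, extendJump_of_notMem t' i hi]
        rw [h2]
        have h3 := (LevelRel.refl (X := X) (k : Fin n) (expN (extendJump X l t' i • X i))).mul hX ih
        rwa [add_zero] at h3
  have h0 := key 0
  rw [if_pos (Nat.zero_le _)] at h0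
  exact h0

end Coordinates
end WaveletRep
end


noncomputable section

namespace WaveletRep

/-! ### Triangular maps preserve Lebesgue measure. -/

section Triangular

/-- Fubini: the coordinates after the first undergo a triangular map by themselves, and the first is
translated by a function of them, so the map is a skew product. -/
theorem measurePreserving_of_triangular_fin (d : ℕ) (Φ : (Fin d → ℝ) → Fin d → ℝ)
    (hΦ : Measurable Φ)
    (h : ∀ e t t', (∀ j, e < j → t j = t' j) → Φ t e - t e = Φ t' e - t' e) :
    MeasurePreserving Φ volume volume := by
  induction d with
  | zero =>
    have : Φ = id := by ext t i; exact i.elim0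
    rw [this]
    exact MeasurePreserving.id _
  | succ d ih =>
    -- No displacement depends on the first coordinate, so it may be set to `0`.
    let Ψ : (Fin d → ℝ) → Fin d → ℝ := fun v => Fin.tail (Φ (Fin.cons 0 v))
    let q : (Fin d → ℝ) → ℝ := fun v => Φ (Fin.cons 0 v) 0
    have hcons : Measurable fun v : Fin d → ℝ => (Fin.cons 0 v : Fin (d + 1) → ℝ) := by
      refine measurable_pi_lambda _ fun i => ?_
      refine Fin.cases ?_ (fun i => ?_) i
      · simp
      · simpa using measurable_pi_apply i
    have hΨm : Measurable Ψ :=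
      measurable_pi_lambda _ fun i => (measurable_pi_apply i.succ).comp (hΦ.comp hcons)
    have hq : Measurable q := (measurable_pi_apply 0).comp (hΦ.comp hcons)
    have hΨ : MeasurePreserving Ψ volume volume := by
      refine ih Ψ hΨm fun e t t' htt' => ?_
      have := h e.succ (Fin.cons 0 t) (Fin.cons 0 t') fun j hj => by
        obtain ⟨j, rfl⟩ := Fin.exists_succ_eq.2 (Fin.ne_zero_of_lt hj)
        simpa using htt' j (by simpa using hj)
      simpa [Ψ, Fin.tail] using this
    have hskew : MeasurePreserving (fun p : (Fin d → ℝ) × ℝ => (Ψ p.1, p.2 + q p.1))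
        ((volume : Measure (Fin d → ℝ)).prod (volume : Measure ℝ))
        ((volume : Measure (Fin d → ℝ)).prod (volume : Measure ℝ)) :=
      hΨ.skew_product (g := fun a c => c + q a)
        (measurable_snd.add (hq.comp measurable_fst))
        (Filter.Eventually.of_forall fun a => map_add_right_eq_self volume (q a))
    let e := MeasurableEquiv.piFinSuccAbove (fun _ : Fin (d + 1) => ℝ) 0
    have he : MeasurePreserving e volume
        ((volume : Measure ℝ).prod (volume : Measure (Fin d → ℝ))) :=
      volume_preserving_piFinSuccAbove (fun _ : Fin (d + 1) => ℝ) 0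
    have hsw := Measure.measurePreserving_swap (μ := (volume : Measure ℝ))
      (ν := (volume : Measure (Fin d → ℝ)))
    have hsw' := Measure.measurePreserving_swap (μ := (volume : Measure (Fin d → ℝ)))
      (ν := (volume : Measure ℝ))
    have hall := (he.symm e).comp (hsw'.comp (hskew.comp (hsw.comp he)))
    have hΦe : Φ = e.symm ∘ Prod.swap ∘ (fun p : (Fin d → ℝ) × ℝ => (Ψ p.1, p.2 + q p.1)) ∘
        Prod.swap ∘ e := by
      funext t
      ext i
      have h0 : ∀ j, Φ t j - t j = Φ (Fin.cons 0 (Fin.tail t)) j -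
          (Fin.cons 0 (Fin.tail t) : Fin (d + 1) → ℝ) j := fun j =>
        h j _ _ fun k hk => by
          obtain ⟨k, rfl⟩ := Fin.exists_succ_eq.2 (Fin.ne_zero_of_lt hk)
          simp [Fin.tail]
      refine Fin.cases ?_ (fun i => ?_) i
      · have := h0 0
        simp only [Fin.cons_zero, sub_zero] at this
        change Φ t 0 = t 0 + Φ (Fin.cons 0 (Fin.tail t)) 0
        linarith
      · have := h0 i.succ
        simp only [Fin.cons_succ, Fin.tail, sub_left_inj] at this
        exact this
    rw [hΦe]
    exact hall

/-- A measurable map of `ℝ^ι` which is a translation in each coordinate, by an amount depending on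
the later coordinates only, preserves Lebesgue measure. -/
theorem measurePreserving_of_triangular {ι : Type*} [Fintype ι] [LinearOrder ι]
    (Φ : (ι → ℝ) → ι → ℝ) (hΦ : Measurable Φ)
    (h : ∀ e t t', (∀ j, e < j → t j = t' j) → Φ t e - t e = Φ t' e - t' e) :
    MeasurePreserving Φ volume volume := by
  let o : Fin (Fintype.card ι) ≃o ι := Fintype.orderIsoFinOfCardEq ι rfl
  let e : (ι → ℝ) ≃ᵐ (Fin (Fintype.card ι) → ℝ) :=
    MeasurableEquiv.piCongrLeft (fun _ => ℝ) o.symm.toEquiv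
  have he : MeasurePreserving e volume volume :=
    volume_measurePreserving_piCongrLeft (fun _ : Fin (Fintype.card ι) => ℝ) o.symm.toEquiv
  have heap : ∀ t i, e t i = t (o i) := by
    intro t i
    have := MeasurableEquiv.piCongrLeft_apply_apply (β := fun _ => ℝ) o.symm.toEquiv t (o i)
    rw [show o.symm.toEquiv (o i) = i from o.symm_apply_apply i] at this
    exact this
  have hesap : ∀ t i, e.symm t i = t (o.symm i) := by
    intro t i
    have := heap (e.symm t) (o.symm i)
    simp only [MeasurableEquiv.apply_symm_apply, OrderIso.apply_symm_apply] at this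
    exact this.symm
  have hmid : MeasurePreserving (fun t => e (Φ (e.symm t))) volume volume := by
    refine measurePreserving_of_triangular_fin _ _
      (e.measurable.comp (hΦ.comp e.symm.measurable)) fun i t t' htt' => ?_
    have := h (o i) (e.symm t) (e.symm t') fun j hj => by
      rw [hesap, hesap]
      exact htt' _ (by rw [← o.lt_iff_lt]; simpa using hj)
    rw [heap, heap]
    simpa [hesap] using this
  have hall := (he.symm e).comp (hmid.comp he)
  have hΦe : Φ = e.symm ∘ (fun t => e (Φ (e.symm t))) ∘ e := by
    funext t
    simp
  rw [hΦe]
  exact hall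

end Triangular

/-! ### The induced representation on `L²(ℝᵈ)`. -/

section Action

variable {m n : ℕ} {𝔫 : LieSubalgebra ℝ (Matrix (Fin m) (Fin m) ℝ)}
  {X : Module.Basis (Fin n) ℝ 𝔫} {l : Module.Dual ℝ 𝔫} [IsNilMatrixAlgebra 𝔫]

/-- The action of `N` on the coordinates of `N / P(λ)` preserves Lebesgue measure. -/
theorem measurePreserving_secCoord (hX : IsStrongMalcev X) (y : lieGroup 𝔫) :
    MeasurePreserving (fun t => secCoord hX l (y * crossSection X l t)) volume volume := by
  refine measurePreserving_of_triangular _ ((continuous_secCoord hX).comp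
    (continuous_const.mul continuous_crossSection)).measurable fun e t t' h => ?_
  have := ((LevelRel.refl (X := X) (e : Fin n) y).mul hX (levelRel_crossSection hX e h)).secCoord hX
  rw [this]
  ring

/-- `λ` of the logarithm of the component in `P(λ)`. -/
def phase (hX : IsStrongMalcev X) (l : Module.Dual ℝ 𝔫) (x : lieGroup 𝔫) : ℝ :=
  l (logN (polPart hX l x))

theorem continuous_phase (hX : IsStrongMalcev X) : Continuous (phase hX l) :=
  (continuous_dual l).comp (continuous_logN.comp (continuous_polPart hX))

theorem phase_mul (hX : IsStrongMalcev X) (x : lieGroup 𝔫) {p : lieGroup 𝔫}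
    (hp : p ∈ polGroup hX l) : phase hX l (x * p) = phase hX l x + l (logN p) := by
  rw [phase, polPart_mul hX x hp, form_logN_mul hX (polPart_mem hX x) hp, phase]

theorem phase_crossSection (hX : IsStrongMalcev X) (t : jumpSet X l → ℝ) :
    phase hX l (crossSection X l t) = 0 := by
  rw [phase, polPart_crossSection, logN_one, map_zero]

/-- The character `e^{-2πi s}`. -/
def unitChar (s : ℝ) : ℂ := Complex.exp (-(2 * Real.pi * Complex.I * (s : ℂ)))

theorem unitChar_add (s t : ℝ) : unitChar (s + t) = unitChar s * unitChar t := by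
  rw [unitChar, unitChar, unitChar, ← Complex.exp_add]
  push_cast
  ring_nf

theorem unitChar_zero : unitChar 0 = 1 := by simp [unitChar]

theorem norm_unitChar (s : ℝ) : ‖unitChar s‖ = 1 := by
  rw [unitChar, show -(2 * Real.pi * Complex.I * (s : ℂ)) = ((-(2 * Real.pi * s) : ℝ) : ℂ) *
    Complex.I by push_cast; ring]
  exact Complex.norm_exp_ofReal_mul_I _

theorem continuous_unitChar : Continuous unitChar := by
  unfold unitChar
  fun_prop

theorem unitChar_neg (s : ℝ) : unitChar (-s) * unitChar s = 1 := by
  rw [← unitChar_add, neg_add_cancel, unitChar_zero]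

theorem star_unitChar (s : ℝ) : (starRingEnd ℂ) (unitChar s) = unitChar (-s) := by
  rw [unitChar, unitChar, ← Complex.exp_conj]
  simp [map_ofNat]

/-- The equivariant function on `N` with restriction `F` to the cross-section. -/
def lift (hX : IsStrongMalcev X) (l : Module.Dual ℝ 𝔫) (F : (jumpSet X l → ℝ) → ℂ)
    (x : lieGroup 𝔫) : ℂ := unitChar (phase hX l x) * F (secCoord hX l x)

theorem lift_mul (hX : IsStrongMalcev X) (F : (jumpSet X l → ℝ) → ℂ) (x : lieGroup 𝔫)
    {p : lieGroup 𝔫} (hp : p ∈ polGroup hX l) :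
    lift hX l F (x * p) = unitChar (l (logN p)) * lift hX l F x := by
  rw [lift, phase_mul hX x hp, secCoord_mul hX x hp, unitChar_add, lift]
  ring

theorem isEquivariant_lift (hX : IsStrongMalcev X) (F : (jumpSet X l → ℝ) → ℂ) :
    IsEquivariant X l (lift hX l F) := fun x Y hY => by
  rw [lift_mul hX F x (expN_mem_polGroup hX hY), logN_expN]
  rfl

theorem lift_crossSection (hX : IsStrongMalcev X) (F : (jumpSet X l → ℝ) → ℂ)
    (t : jumpSet X l → ℝ) : lift hX l F (crossSection X l t) = F t := by
  rw [lift, phase_crossSection, secCoord_crossSection, unitChar_zero, one_mul]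

theorem eq_lift_of_isEquivariant (hX : IsStrongMalcev X) {g : lieGroup 𝔫 → ℂ}
    (hg : IsEquivariant X l g) : g = lift hX l fun t => g (crossSection X l t) := by
  ext x
  have h1 := hg (crossSection X l (secCoord hX l x)) (logN (polPart hX l x)) (polPart_mem hX x)
  rw [expN_logN, crossSection_mul_polPart] at h1
  exact h1

theorem norm_lift (hX : IsStrongMalcev X) (F : (jumpSet X l → ℝ) → ℂ) (x : lieGroup 𝔫) :
    ‖lift hX l F x‖ = ‖F (secCoord hX l x)‖ := by
  rw [lift, norm_mul, norm_unitChar, one_mul]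

/-- The restriction to the cross-section of the translate of an equivariant function. -/
def translate (hX : IsStrongMalcev X) (l : Module.Dual ℝ 𝔫) (y : lieGroup 𝔫)
    (F : (jumpSet X l → ℝ) → ℂ) (t : jumpSet X l → ℝ) : ℂ := lift hX l F (y⁻¹ * crossSection X l t)

theorem lift_translate (hX : IsStrongMalcev X) (y : lieGroup 𝔫) (F : (jumpSet X l → ℝ) → ℂ)
    (x : lieGroup 𝔫) : lift hX l (translate hX l y F) x = lift hX l F (y⁻¹ * x) := by
  conv_rhs => rw [← crossSection_mul_polPart (l := l) hX x, ← mul_assoc,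
    lift_mul hX F _ (polPart_mem hX x)]
  rfl

theorem translate_mul (hX : IsStrongMalcev X) (y y' : lieGroup 𝔫) (F : (jumpSet X l → ℝ) → ℂ) :
    translate hX l (y * y') F = translate hX l y (translate hX l y' F) := by
  ext t
  rw [translate, translate, lift_translate, mul_inv_rev, mul_assoc]

theorem translate_one (hX : IsStrongMalcev X) (F : (jumpSet X l → ℝ) → ℂ) :
    translate hX l 1 F = F := by
  ext t
  rw [translate, inv_one, one_mul, lift_crossSection]

/-- Invariance of the measure makes translation well defined on classes modulo null sets. -/
theorem translate_ae (hX : IsStrongMalcev X) (y : lieGroup 𝔫) {F F' : (jumpSet X l → ℝ) → ℂ}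
    (h : F =ᵐ[volume] F') : translate hX l y F =ᵐ[volume] translate hX l y F' := by
  have := (measurePreserving_secCoord (l := l) hX y⁻¹).quasiMeasurePreserving.ae h
  filter_upwards [this] with t ht
  rw [translate, translate, lift, lift, ht]

theorem memLp_translate (hX : IsStrongMalcev X) (y : lieGroup 𝔫) {F : (jumpSet X l → ℝ) → ℂ}
    (hF : MemLp F 2 volume) : MemLp (translate hX l y F) 2 volume := by
  have h1 := hF.comp_measurePreserving (measurePreserving_secCoord (l := l) hX y⁻¹)
  refine h1.congr_norm ?_ (Filter.Eventually.of_forall fun t => (norm_lift hX F _).symm)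
  exact ((continuous_unitChar.comp ((continuous_phase hX).comp
    (continuous_const.mul continuous_crossSection))).aestronglyMeasurable).mul h1.1

theorem eLpNorm_translate (hX : IsStrongMalcev X) (y : lieGroup 𝔫) {F : (jumpSet X l → ℝ) → ℂ}
    (hF : AEStronglyMeasurable F volume) :
    eLpNorm (translate hX l y F) 2 volume = eLpNorm F 2 volume := by
  rw [← eLpNorm_comp_measurePreserving hF (measurePreserving_secCoord (l := l) hX y⁻¹)]
  exact eLpNorm_congr_norm_ae (Filter.Eventually.of_forall fun t => norm_lift hX F _)

/-- The operator `π(y)` on `L²`. -/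
def transOp (hX : IsStrongMalcev X) (l : Module.Dual ℝ 𝔫) (y : lieGroup 𝔫) :
    L2 X l →ₗᵢ[ℂ] L2 X l where
  toFun f := (memLp_translate hX y (Lp.memLp f)).toLp _
  map_add' f g := by
    rw [← MemLp.toLp_add]
    refine MemLp.toLp_congr _ _ ?_
    filter_upwards [translate_ae hX y (Lp.coeFn_add f g)] with t ht
    rw [ht]
    simp only [translate, lift, Pi.add_apply, mul_add]
  map_smul' c f := by
    rw [RingHom.id_apply, ← MemLp.toLp_const_smul]
    refine MemLp.toLp_congr _ _ ?_
    filter_upwards [translate_ae hX y (Lp.coeFn_smul c f)] with t ht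
    rw [ht]
    simp only [translate, lift, Pi.smul_apply, smul_eq_mul]
    ring
  norm_map' f := by
    change ‖(memLp_translate hX y (Lp.memLp f)).toLp _‖ = _
    rw [Lp.norm_toLp, eLpNorm_translate hX y (Lp.aestronglyMeasurable f), Lp.norm_def]

theorem transOp_toLp (hX : IsStrongMalcev X) (y : lieGroup 𝔫) {F : (jumpSet X l → ℝ) → ℂ}
    (hF : MemLp F 2 volume) :
    transOp hX l y (hF.toLp F) = (memLp_translate hX y hF).toLp _ :=
  MemLp.toLp_congr (memLp_translate hX y (Lp.memLp _)) (memLp_translate hX y hF)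
    (translate_ae hX y hF.coeFn_toLp)

theorem transOp_mul (hX : IsStrongMalcev X) (y y' : lieGroup 𝔫) (f : L2 X l) :
    transOp hX l (y * y') f = transOp hX l y (transOp hX l y' f) := by
  change _ = transOp hX l y ((memLp_translate hX y' (Lp.memLp f)).toLp _)
  rw [transOp_toLp]
  exact MemLp.toLp_congr (memLp_translate hX (y * y') (Lp.memLp f)) _ (by rw [translate_mul])

theorem transOp_one (hX : IsStrongMalcev X) (f : L2 X l) : transOp hX l 1 f = f := by
  conv_rhs => rw [← Lp.toLp_coeFn f (Lp.memLp f)]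
  exact MemLp.toLp_congr (memLp_translate hX 1 (Lp.memLp f)) _ (by rw [translate_one])

/-- The induced representation. -/
def inducedRep (hX : IsStrongMalcev X) (l : Module.Dual ℝ 𝔫) :
    lieGroup 𝔫 →* (L2 X l ≃ₗᵢ[ℂ] L2 X l) where
  toFun y :=
    { toLinearEquiv := LinearEquiv.ofLinearMap (transOp hX l y).toLinearMap
        (transOp hX l y⁻¹).toLinearMap
        (by ext1 f; simp [← transOp_mul, transOp_one])
        (by ext1 f; simp [← transOp_mul, transOp_one])
      norm_map' := (transOp hX l y).norm_map }
  map_one' := by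
    ext1 f
    exact transOp_one hX f
  map_mul' y y' := by
    ext1 f
    exact transOp_mul hX y y' f

theorem inducedRep_apply (hX : IsStrongMalcev X) (y : lieGroup 𝔫) (f : L2 X l) :
    inducedRep hX l y f = transOp hX l y f := rfl

theorem isInducedRep_inducedRep (hX : IsStrongMalcev X) (l : Module.Dual ℝ 𝔫) :
    IsInducedRep X l (inducedRep hX l) := by
  intro y g hg hgL
  rw [inducedRep_apply, transOp_toLp]
  refine (MemLp.coeFn_toLp _).trans (Filter.Eventually.of_forall fun t => ?_)
  change lift hX l _ (y⁻¹ * crossSection X l t) = _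
  rw [← eq_lift_of_isEquivariant hX hg]

/-- Every `f ∈ L²` is the restriction of an equivariant function, its `lift`, so `IsInducedRep`
prescribes `π y f`. -/
theorem eq_inducedRep (hX : IsStrongMalcev X) {π : lieGroup 𝔫 →* (L2 X l ≃ₗᵢ[ℂ] L2 X l)}
    (hπ : IsInducedRep X l π) : π = inducedRep hX l := by
  ext y f : 2
  have hmem : MemLp (fun t => lift hX l f (crossSection X l t)) 2 volume := by
    simp only [lift_crossSection]
    exact Lp.memLp f
  have hf : hmem.toLp _ = f := by
    conv_rhs => rw [← Lp.toLp_coeFn f (Lp.memLp f)]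
    exact MemLp.toLp_congr _ _ (Filter.Eventually.of_forall fun t => lift_crossSection hX f t)
  have h1 := hπ y (lift hX l f) (isEquivariant_lift hX f) hmem
  have h2 := isInducedRep_inducedRep hX l y (lift hX l f) (isEquivariant_lift hX f) hmem
  rw [hf] at h1 h2
  exact Lp.ext (h1.trans h2.symm)

end Action
end WaveletRep
end


noncomputable section

namespace WaveletRep

/-! ### Strong continuity. -/

section StrongContinuity

open Topology

theorem tendsto_eLpNorm_sub {Y ι : Type*} [TopologicalSpace Y] [Fintype ι] {H : Y → (ι → ℝ) → ℂ}
    (hH : Continuous fun q : Y × (ι → ℝ) => H q.1 q.2) {y₀ : Y} {Q : Set Y} (hQ : Q ∈ 𝓝 y₀)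
    {K : Set (ι → ℝ)} (hK : IsCompact K) (h0 : ∀ y ∈ Q, ∀ t ∉ K, H y t = 0)
    (hL : ∀ y, MemLp (H y) 2 volume) :
    Filter.Tendsto (fun y => eLpNorm (H y - H y₀) 2 volume) (𝓝 y₀) (𝓝 0) := by
  have hcont : ContinuousOn (fun y => ∫ t, ‖H y t - H y₀ t‖ ^ (2 : ℝ)) Q := by
    refine continuousOn_integral_of_compact_support hK (Continuous.continuousOn ?_) ?_
    · refine Continuous.rpow_const (Continuous.norm ?_) fun _ => Or.inr (by norm_num)
      exact hH.sub (hH.comp (continuous_const.prodMk continuous_snd))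
    · intro y t hy ht
      rw [h0 y hy t ht, h0 y₀ (mem_of_mem_nhds hQ) t ht]
      simp
  have hlim := hcont.continuousAt hQ
  rw [ContinuousAt] at hlim
  simp only [sub_self, norm_zero, ne_eq, OfNat.ofNat_ne_zero, not_false_eq_true,
    Real.zero_rpow, integral_zero] at hlim
  have heq : ∀ y, eLpNorm (H y - H y₀) 2 volume =
      ENNReal.ofReal ((∫ t, ‖H y t - H y₀ t‖ ^ (2 : ℝ)) ^ ((2 : ℝ)⁻¹)) := fun y => by
    rw [((hL y).sub (hL y₀)).eLpNorm_eq_integral_rpow_norm (by norm_num) (by norm_num)]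
    rfl
  simp only [heq]
  have h3 := hlim.rpow_const (p := (2 : ℝ)⁻¹) (Or.inr (by norm_num))
  have h4 := ENNReal.tendsto_ofReal h3
  simpa using h4

variable {m n : ℕ} {𝔫 : LieSubalgebra ℝ (Matrix (Fin m) (Fin m) ℝ)}
  {X : Module.Basis (Fin n) ℝ 𝔫} {l : Module.Dual ℝ 𝔫} [IsNilMatrixAlgebra 𝔫]

/-- The coordinates of the logarithm with respect to a basis, as a homeomorphism. -/
def logHomeo (X : Module.Basis (Fin n) ℝ 𝔫) : lieGroup 𝔫 ≃ₜ (Fin n → ℝ) :=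
  expHomeo.symm.trans
    { toEquiv := X.equivFun.toEquiv
      continuous_toFun := continuous_pi fun k => continuous_dual (X.coord k)
      continuous_invFun := LinearMap.continuous_of_finiteDimensional (F' := 𝔫.toSubmodule)
        X.equivFun.symm.toLinearMap }

instance : SecondCountableTopology (lieGroup 𝔫) :=
  (logHomeo (Module.finBasis ℝ 𝔫)).secondCountableTopology

instance : LocallyCompactSpace (lieGroup 𝔫) :=
  (logHomeo (Module.finBasis ℝ 𝔫)).isClosedEmbedding.locallyCompactSpace

theorem continuous_translate (hX : IsStrongMalcev X) {F : (jumpSet X l → ℝ) → ℂ}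
    (hF : Continuous F) : Continuous fun q : lieGroup 𝔫 × (jumpSet X l → ℝ) =>
      translate hX l q.1 F q.2 := by
  have h : Continuous fun q : lieGroup 𝔫 × (jumpSet X l → ℝ) => q.1⁻¹ * crossSection X l q.2 :=
    continuous_fst.inv.mul (continuous_crossSection.comp continuous_snd)
  exact (continuous_unitChar.comp ((continuous_phase hX).comp h)).mul
    (hF.comp ((continuous_secCoord hX).comp h))

/-- The translates by `y ∈ Q` are supported in the image of `Q` times the support of `F`; for
compact `Q` and support this is the common compact set required by `tendsto_eLpNorm_sub`. -/
theorem translate_eq_zero (hX : IsStrongMalcev X) {F : (jumpSet X l → ℝ) → ℂ}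
    {Q : Set (lieGroup 𝔫)} {y : lieGroup 𝔫} (hy : y ∈ Q) {t : jumpSet X l → ℝ}
    (ht : t ∉ (fun q : lieGroup 𝔫 × (jumpSet X l → ℝ) => secCoord hX l (q.1 * crossSection X l q.2))
      '' (Q ×ˢ tsupport F)) : translate hX l y F t = 0 := by
  rw [translate, lift]
  by_contra h
  refine ht ⟨(y, secCoord hX l (y⁻¹ * crossSection X l t)), ⟨hy, subset_tsupport F ?_⟩, ?_⟩
  · exact (mul_ne_zero_iff.1 h).2
  · have h1 := crossSection_mul_polPart (l := l) hX (y⁻¹ * crossSection X l t)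
    change secCoord hX l (y * crossSection X l (secCoord hX l (y⁻¹ * crossSection X l t))) = t
    rw [← secCoord_mul hX _ (polPart_mem hX (y⁻¹ * crossSection X l t)), mul_assoc, h1,
      mul_inv_cancel_left, secCoord_crossSection]

theorem continuous_transOp_of_hasCompactSupport (hX : IsStrongMalcev X)
    {F : (jumpSet X l → ℝ) → ℂ} (hF : Continuous F) (hFc : HasCompactSupport F)
    (hFL : MemLp F 2 volume) : Continuous fun y => transOp hX l y (hFL.toLp F) := by
  rw [continuous_iff_continuousAt]
  intro y₀
  simp only [transOp_toLp]
  rw [ContinuousAt, Lp.tendsto_Lp_iff_tendsto_eLpNorm'']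
  obtain ⟨Q, hQ, hQy⟩ := exists_compact_mem_nhds y₀
  exact tendsto_eLpNorm_sub (H := fun y => translate hX l y F) (continuous_translate hX hF) hQy
    ((hQ.prod hFc).image ((continuous_secCoord hX).comp
      (continuous_fst.mul (continuous_crossSection.comp continuous_snd))))
    (fun y hy t ht => translate_eq_zero hX hy ht) (fun y => memLp_translate hX y hFL)

theorem isStronglyContinuous_inducedRep (hX : IsStrongMalcev X) (l : Module.Dual ℝ 𝔫) :
    IsStronglyContinuous (inducedRep hX l) := by
  intro f
  change Continuous fun y => transOp hX l y f
  -- The operators are isometries, so an approximation of `f` by a continuous function of compact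
  -- support is uniform in `y`.
  refine continuous_of_uniform_approx_of_continuous fun u hu => ?_
  obtain ⟨ε, hε, hεu⟩ := Metric.mem_uniformity_dist.1 hu
  obtain ⟨F, hFc, hFε, hF, hFL⟩ := (Lp.memLp f).exists_hasCompactSupport_eLpNorm_sub_le
    (by norm_num) (ε := ENNReal.ofReal (ε / 2)) (by simpa using hε)
  refine ⟨fun y => transOp hX l y (hFL.toLp F),
    continuous_transOp_of_hasCompactSupport hX hF hFc hFL, fun y => hεu ?_⟩
  rw [(transOp hX l y).isometry.dist_eq, dist_eq_norm]
  have h1 : f - hFL.toLp F = ((Lp.memLp f).sub hFL).toLp _ := by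
    rw [MemLp.toLp_sub (Lp.memLp f) hFL, Lp.toLp_coeFn]
  rw [h1, Lp.norm_toLp]
  refine lt_of_le_of_lt (ENNReal.toReal_mono ENNReal.ofReal_ne_top hFε) ?_
  rw [ENNReal.toReal_ofReal (by positivity)]
  linarith

end StrongContinuity
end WaveletRep
end


noncomputable section

namespace WaveletRep

/-! ### Uniqueness for the Fourier transform on the line. -/

section Fourier

open FourierTransform

theorem unitChar_eq_exp (s r : ℝ) :
    unitChar (s * r) = Complex.exp ((-2 * Real.pi * r * s : ℝ) * Complex.I) := by
  rw [unitChar]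
  congr 1
  push_cast
  ring

theorem integrable_unitChar_mul {φ : ℝ → ℂ} (hφ : Integrable φ) (s : ℝ) :
    Integrable fun r => unitChar (s * r) * φ r :=
  hφ.bdd_mul (c := 1)
    (continuous_unitChar.comp (continuous_const.mul continuous_id)).aestronglyMeasurable
    (Filter.Eventually.of_forall fun _ => (norm_unitChar _).le)

/-- An integrable function on `ℝ` whose Fourier transform vanishes is zero. -/
theorem ae_eq_zero_of_fourier_eq_zero {φ : ℝ → ℂ} (hφ : Integrable φ) (h : 𝓕 φ = 0) :
    ∀ᵐ r, φ r = 0 := by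
  refine ae_eq_zero_of_integral_contDiff_smul_eq_zero hφ.locallyIntegrable fun g hg hgc => ?_
  let G : ℝ → ℂ := fun x => (g x : ℂ)
  have hG : ContDiff ℝ (⊤ : ℕ∞) G := Complex.ofRealCLM.contDiff.comp hg
  have hGc : HasCompactSupport G := hgc.comp_left (g := fun x : ℝ => (x : ℂ)) (by simp)
  let S : SchwartzMap ℝ ℂ := hGc.toSchwartzMap hG
  let T : SchwartzMap ℝ ℂ := 𝓕⁻ S
  have hT : 𝓕 (T : ℝ → ℂ) = G := by
    rw [← SchwartzMap.fourier_coe, fourier_fourierInv_eq]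
    rfl
  have := VectorFourier.integral_fourierIntegral_smul_eq_flip (L := innerₗ ℝ) (μ := volume)
    (ν := volume) Real.continuous_fourierChar continuous_inner T.integrable hφ
  have h2 : ∫ ξ, (𝓕 (T : ℝ → ℂ)) ξ • φ ξ = ∫ x, T x • (𝓕 φ) x := by
    simpa using! this
  rw [hT, h] at h2
  simpa [G] using h2

/-- An integrable function on `ℝ` whose Fourier transform vanishes at the rational points is
zero. -/
theorem ae_eq_zero_of_integral_unitChar_mul {φ : ℝ → ℂ} (hφ : Integrable φ)
    (h : ∀ s : ℚ, ∫ r, unitChar (s * r) * φ r = 0) : ∀ᵐ r, φ r = 0 := by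
  refine ae_eq_zero_of_fourier_eq_zero hφ ?_
  have hc : Continuous fun s : ℝ => ∫ r, unitChar (s * r) * φ r := by
    refine continuous_of_dominated (bound := fun r => ‖φ r‖)
      (fun s => (integrable_unitChar_mul hφ s).aestronglyMeasurable)
      (fun s => Filter.Eventually.of_forall fun r => ?_) hφ.norm
      (Filter.Eventually.of_forall fun r => ?_)
    · rw [norm_mul, norm_unitChar, one_mul]
    · exact (continuous_unitChar.comp (continuous_id.mul continuous_const)).mul continuous_const
  have h0 : (fun s : ℝ => ∫ r, unitChar (s * r) * φ r) = fun _ => 0 :=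
    Rat.denseRange_cast.equalizer hc continuous_const (funext h)
  funext s
  rw [Real.fourier_real_eq_integral_exp_smul]
  have := congrFun h0 s
  simpa only [unitChar_eq_exp, smul_eq_mul, Pi.zero_apply] using this

end Fourier

/-! ### Integration over a subset of the coordinates. -/

section PartialMeasure

variable {ι : Type*}

open Classical in
/-- Lebesgue measure if `j ∈ J`, and the point mass at `0` otherwise. -/
def coordMeasure (J : Finset ι) (j : ι) : Measure ℝ :=
  if j ∈ J then volume else Measure.dirac 0

theorem coordMeasure_of_mem {J : Finset ι} {j : ι} (h : j ∈ J) : coordMeasure J j = volume :=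
  if_pos h

theorem coordMeasure_of_notMem {J : Finset ι} {j : ι} (h : j ∉ J) :
    coordMeasure J j = Measure.dirac 0 :=
  if_neg h

instance (J : Finset ι) (j : ι) : SigmaFinite (coordMeasure J j) := by
  unfold coordMeasure
  split_ifs <;> infer_instance

variable [Fintype ι]

/-- Lebesgue measure in the coordinates of `J`, point mass at `0` in the others. -/
def partialVolume (J : Finset ι) : Measure (ι → ℝ) := Measure.pi (coordMeasure J)

instance (J : Finset ι) : SigmaFinite (partialVolume J) := by
  unfold partialVolume
  infer_instance

theorem partialVolume_univ : partialVolume (Finset.univ : Finset ι) = volume := by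
  exact congrArg Measure.pi (funext fun j => coordMeasure_of_mem (Finset.mem_univ j))

instance : IsProbabilityMeasure (partialVolume (∅ : Finset ι)) := by
  have h : coordMeasure (∅ : Finset ι) = fun _ => Measure.dirac 0 :=
    funext fun j => coordMeasure_of_notMem (Finset.notMem_empty j)
  rw [partialVolume, h]
  infer_instance

/-- Used to split off the variable `j` by Fubini. Before, it carried the point mass at `0`, so
overwriting it loses nothing, and all stages of the descent share the parameter space `ℝᵈ`. -/
theorem measurePreserving_update [DecidableEq ι] {J : Finset ι} {j : ι} (hj : j ∉ J) :
    MeasurePreserving (fun q : ℝ × (ι → ℝ) => Function.update q.2 j q.1)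
      (volume.prod (partialVolume J)) (partialVolume (insert j J)) := by
  have hm : Measurable fun q : ℝ × (ι → ℝ) => Function.update q.2 j q.1 := by
    refine measurable_pi_lambda _ fun i => ?_
    by_cases h : i = j
    · subst h
      simpa using measurable_fst
    · simp only [Function.update_of_ne h]
      exact (measurable_pi_apply i).comp measurable_snd
  refine ⟨hm, ?_⟩
  symm
  refine Measure.pi_eq fun s hs => ?_
  rw [Measure.map_apply hm (MeasurableSet.univ_pi hs)]
  have hpre : (fun q : ℝ × (ι → ℝ) => Function.update q.2 j q.1) ⁻¹' Set.univ.pi s =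
      s j ×ˢ Set.univ.pi (Function.update s j Set.univ) := by
    ext q
    simp only [Set.mem_preimage, Set.mem_univ_pi, Set.mem_prod]
    constructor
    · intro h
      refine ⟨by simpa using h j, fun i => ?_⟩
      by_cases hi : i = j
      · subst hi; simp
      · simpa [hi] using h i
    · rintro ⟨h1, h2⟩ i
      by_cases hi : i = j
      · subst hi; simpa using h1
      · simpa [hi] using h2 i
  rw [hpre, Measure.prod_prod, partialVolume, Measure.pi_pi, ← Finset.mul_prod_erase _ _
    (Finset.mem_univ j), ← Finset.mul_prod_erase _ _ (Finset.mem_univ j)]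
  rw [coordMeasure_of_notMem hj, coordMeasure_of_mem (Finset.mem_insert_self j J),
    Function.update_self, measure_univ, one_mul]
  congr 1
  refine Finset.prod_congr rfl fun i hi => ?_
  have hij := Finset.ne_of_mem_erase hi
  rw [Function.update_of_ne hij]
  by_cases hiJ : i ∈ J
  · rw [coordMeasure_of_mem hiJ, coordMeasure_of_mem (Finset.mem_insert_of_mem hiJ)]
  · rw [coordMeasure_of_notMem hiJ,
      coordMeasure_of_notMem fun h => (Finset.mem_insert.1 h).elim hij hiJ]

end PartialMeasure
end WaveletRep
end


noncomputable section

namespace WaveletRep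

/-! ### Irreducibility of the induced representation. -/

section Orthogonality

variable {m n : ℕ} {𝔫 : LieSubalgebra ℝ (Matrix (Fin m) (Fin m) ℝ)}
  {X : Module.Basis (Fin n) ℝ 𝔫} {l : Module.Dual ℝ 𝔫}

instance : MeasurableSpace (lieGroup 𝔫) := borel _

instance : BorelSpace (lieGroup 𝔫) := ⟨rfl⟩

/-- The index set of the jumps of the chain of subalgebras from the `i`-th member on. -/
def laterJumps (X : Module.Basis (Fin n) ℝ 𝔫) (l : Module.Dual ℝ 𝔫) (i : ℕ) :
    Finset (jumpSet X l) :=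
  open Classical in Finset.univ.filter fun j => ∃ i', i ≤ i' ∧ i' < n ∧ ∃ W, IsAdapted X l i' j W

theorem mem_laterJumps {i : ℕ} {j : jumpSet X l} :
    j ∈ laterJumps X l i ↔ ∃ i', i ≤ i' ∧ i' < n ∧ ∃ W, IsAdapted X l i' j W := by
  simp [laterJumps]

theorem laterJumps_zero : laterJumps X l 0 = Finset.univ := by
  ext j
  obtain ⟨i, hi, W, hW⟩ := exists_isAdapted_of_mem_jumpSet j.2
  exact iff_of_true (mem_laterJumps.2 ⟨i, i.zero_le, hi, W, hW⟩) (Finset.mem_univ j)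

theorem laterJumps_eq_empty {i : ℕ} (hi : n ≤ i) : laterJumps X l i = ∅ := by
  ext j
  simp only [mem_laterJumps, Finset.notMem_empty, iff_false]
  rintro ⟨i', h, h', -⟩
  omega

theorem laterJumps_eq_succ {i : ℕ} (h : orthChain X l i ≤ orthChain X l (i + 1)) :
    laterJumps X l i = laterJumps X l (i + 1) := by
  ext j
  simp only [mem_laterJumps]
  refine ⟨?_, fun ⟨i', h1, h2⟩ => ⟨i', by omega, h2⟩⟩
  rintro ⟨i', h1, h2, W, hW⟩
  refine ⟨i', ?_, h2, W, hW⟩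
  rcases h1.eq_or_lt with rfl | h1
  · exact (hW.2.1 (h hW.1)).elim
  · exact h1

theorem laterJumps_eq_insert [DecidableEq (jumpSet X l)] {i : ℕ} (hi : i < n) {j : jumpSet X l}
    {W : 𝔫} (hW : IsAdapted X l i j W) :
    laterJumps X l i = insert j (laterJumps X l (i + 1)) := by
  ext k
  simp only [mem_laterJumps, Finset.mem_insert]
  constructor
  · rintro ⟨i', h1, h2, W', hW'⟩
    rcases h1.eq_or_lt with rfl | h1
    · exact Or.inl (Subtype.ext (hW'.index_unique hW))
    · exact Or.inr ⟨i', h1, h2, W', hW'⟩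
  · rintro (rfl | ⟨i', h1, h2⟩)
    · exact ⟨i, le_rfl, hi, W, hW⟩
    · exact ⟨i', by omega, h2⟩

theorem notMem_laterJumps_succ {i : ℕ} {j : jumpSet X l} {W : 𝔫} (hW : IsAdapted X l i j W) :
    j ∉ laterJumps X l (i + 1) := by
  rw [mem_laterJumps]
  rintro ⟨i', h1, -, W', hW'⟩
  have := hW.step_unique hW'
  omega

variable [IsNilMatrixAlgebra 𝔫]

/-- A right Haar measure on `N`. -/
def rightHaar (𝔫 : LieSubalgebra ℝ (Matrix (Fin m) (Fin m) ℝ)) [IsNilMatrixAlgebra 𝔫] :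
    Measure (lieGroup 𝔫) := (Measure.haar : Measure (lieGroup 𝔫)).inv

instance : SigmaFinite (rightHaar 𝔫) := by unfold rightHaar; infer_instance

instance : (rightHaar 𝔫).IsMulRightInvariant := by unfold rightHaar; infer_instance

instance : (rightHaar 𝔫).IsOpenPosMeasure := by unfold rightHaar; infer_instance

/-- Coordinates on a complement of `P(λ)` in the `i`-th group of the chain. -/
structure IsChainCoord (X : Module.Basis (Fin n) ℝ 𝔫) (l : Module.Dual ℝ 𝔫) (i : ℕ)
    (w : (jumpSet X l → ℝ) → lieGroup 𝔫) : Prop where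
  continuous : Continuous w
  logN_mem : ∀ t, logN (w t) ∈ orthChain X l i
  congr : ∀ t t', (∀ j ∈ laterJumps X l i, t j = t' j) → w t = w t'
  levelRel : ∀ (e : jumpSet X l) (t t' : jumpSet X l → ℝ), (∀ j, e < j → t j = t' j) →
    LevelRel X e (open Classical in if e ∈ laterJumps X l i then t' e - t e else 0) (w t) (w t')

theorem isChainCoord_one {i : ℕ} (hi : n ≤ i) : IsChainCoord X l i fun _ => 1 where
  continuous := continuous_const
  logN_mem t := by rw [logN_one]; exact zero_mem _
  congr _ _ _ := rfl
  levelRel e t t' _ := by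
    rw [laterJumps_eq_empty hi, if_neg (Finset.notMem_empty _)]
    exact LevelRel.refl _ _

theorem IsChainCoord.of_le {i : ℕ} {w : (jumpSet X l → ℝ) → lieGroup 𝔫}
    (hw : IsChainCoord X l (i + 1) w) (h : orthChain X l i ≤ orthChain X l (i + 1)) :
    IsChainCoord X l i w where
  continuous := hw.continuous
  logN_mem t := orthChain_succ_le i (hw.logN_mem t)
  congr := by rw [laterJumps_eq_succ h]; exact hw.congr
  levelRel := by rw [laterJumps_eq_succ h]; exact hw.levelRel

theorem IsAdapted.levelRel {i : ℕ} {j : jumpSet X l} {W : 𝔫}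
    (hW : IsAdapted X l i j W) (e : jumpSet X l) {t t' : jumpSet X l → ℝ}
    (h : ∀ j, e < j → t j = t' j) :
    LevelRel X e (open Classical in if e = j then t' e - t e else 0) (expN (t j • W))
      (expN (t' j • W)) := by
  split_ifs with hej
  · subst hej
    have h1 := levelRel_expN_smul hW.mem_flag (t e) (t' e)
    have h2 : X.repr W e = 1 := by
      have h3 : X.repr (W - X e) e = 0 := by
        exact mem_flag_iff.1 hW.2.2.1 _ le_rfl
      simpa [sub_eq_zero] using h3
    rwa [h2, mul_one] at h1
  · rcases lt_or_gt_of_ne hej with hlt | hgt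
    · rw [h j hlt]
      exact LevelRel.refl _ _
    · have hf : W ∈ flag X (e : Fin n) := flag_mono (Nat.succ_le_of_lt hgt) hW.mem_flag
      have h1 := levelRel_expN_smul (k := (e : Fin n)) (flag_mono (Nat.le_succ _) hf) (t j) (t' j)
      rwa [(mem_flag_iff.1 hf) _ le_rfl, mul_zero] at h1

theorem IsChainCoord.cons (hX : IsStrongMalcev X) {i : ℕ} (hi : i < n)
    {w : (jumpSet X l → ℝ) → lieGroup 𝔫} (hw : IsChainCoord X l (i + 1) w) {j : jumpSet X l} {W : 𝔫}
    (hW : IsAdapted X l i j W) : IsChainCoord X l i fun t => expN (t j • W) * w t where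
  continuous := ((continuous_expN_smul W).comp (continuous_apply j)).mul hw.continuous
  logN_mem t := by
    refine (logN_mul_mem le_rfl (fun a ha b hb => lie_mem_orthChain hX ha hb) ?_
      (orthChain_succ_le i (hw.logN_mem t))).1
    rw [logN_expN]
    exact Submodule.smul_mem _ _ hW.1
  congr t t' h := by
    classical
    rw [laterJumps_eq_insert hi hW] at h
    rw [h j (Finset.mem_insert_self _ _),
      hw.congr t t' fun k hk => h k (Finset.mem_insert_of_mem hk)]
  levelRel e t t' h := by
    classical
    have := (hW.levelRel e h).mul hX (hw.levelRel e t t' h)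
    convert this using 1
    rw [laterJumps_eq_insert hi hW]
    have hj := notMem_laterJumps_succ hW
    by_cases hej : e = j
    · subst hej
      simp [hj]
    · simp [hej]

/-- Conjugation by the `i`-th group acts on the `(i+1)`-st term of the flag within it through the
form `λ[·,·]`. -/
theorem form_adExp_neg (hX : IsStrongMalcev X) {i : ℕ} (hi : i < n) {Z Y : 𝔫}
    (hZ : Z ∈ orthChain X l i) (hY : Y ∈ orthChain X l i ⊓ flag X (i + 1)) :
    adExp (-Z) Y ∈ polarization X l ∧ l (adExp (-Z) Y) = l Y - l ⁅Z, Y⁆ := by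
  have hpol : orthChain X l i ⊓ flag X (i + 1) ≤ polarization X l := fun V hV =>
    orthChain_inf_flag_le_polarization (i := i + 1) hi ⟨orthChain_inf_flag_succ_le hi hV, hV.2⟩
  -- Brackets of `Z` with `𝔥ᵢ ∩ 𝔫ᵢ` are killed by `λ`, since `𝔥ᵢ` is orthogonal to that space. So
  -- `E` absorbs the terms of order two and higher of the exponential series.
  let E : Submodule ℝ 𝔫 := orthChain X l i ⊓ flag X i ⊓ LinearMap.ker l
  have hbr : ∀ V ∈ orthChain X l i, ∀ k, V ∈ flag X k → ⁅-Z, V⁆ ∈ orthChain X l i ⊓ flag X k :=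
    fun V hV k hk => ⟨lie_mem_orthChain hX (neg_mem hZ) hV, hX k _ _ hk⟩
  have hE : ∀ V ∈ orthChain X l i ⊓ flag X i, ⁅-Z, V⁆ ∈ E := fun V hV =>
    ⟨hbr V hV.1 i hV.2, orthChain_orth (neg_mem hZ) hV⟩
  refine ⟨hpol (adExp_mem (fun V hV => hbr V hV.1 _ hV.2) hY), ?_⟩
  have h1 : ⁅-Z, Y⁆ ∈ orthChain X l i ⊓ flag X i :=
    ⟨(hbr Y hY.1 _ hY.2).1, lie_mem_flag hX _ hY.2⟩
  have h2 := adExp_sub_sub_mem (E := E) (Z := -Z) (Y := Y) (fun V hV => hE V hV.1) (hE _ h1)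
  have h3 : l (adExp (-Z) Y - Y - ⁅-Z, Y⁆) = 0 := h2.2
  rw [map_sub, map_sub, neg_lie, map_neg] at h3
  linarith

/-- Translation on the right by `exp sY` multiplies an equivariant function by a character on the
`i`-th group of the chain. -/
theorem lift_mul_expN_mul (hX : IsStrongMalcev X) (F : (jumpSet X l → ℝ) → ℂ) {i : ℕ} (hi : i < n)
    {Y : 𝔫} (hY : Y ∈ orthChain X l i ⊓ flag X (i + 1)) (s : ℝ) (z : lieGroup 𝔫) {h : lieGroup 𝔫}
    (hh : logN h ∈ orthChain X l i) :
    lift hX l F (z * expN (s • Y) * h) =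
      unitChar (s * (l Y - l ⁅logN h, Y⁆)) * lift hX l F (z * h) := by
  have h1 : z * expN (s • Y) * h = z * h * (h⁻¹ * expN (s • Y) * h⁻¹⁻¹) := by group
  obtain ⟨h2, h3⟩ := form_adExp_neg hX hi hh hY
  rw [h1, conj_expN, logN_inv, adExp_smul, lift_mul hX F _
    (expN_mem_polGroup hX (Submodule.smul_mem _ s h2)), logN_expN, map_smul, h3, smul_eq_mul]

/-- The form on a product is determined by the first factor. -/
theorem form_logN_expN_mul (hX : IsStrongMalcev X) {i : ℕ} {W Y : 𝔫}
    (hW : W ∈ orthChain X l i) (hY : Y ∈ orthChain X l i ⊓ flag X (i + 1)) (r : ℝ) {h : lieGroup 𝔫}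
    (hh : logN h ∈ orthChain X l (i + 1)) :
    l ⁅logN (expN (r • W) * h), Y⁆ = r * l ⁅W, Y⁆ := by
  have h1 := (logN_mul_mem (orthChain_succ_le (X := X) (l := l) i)
    (fun a ha b hb => lie_mem_orthChain_succ hX ha hb) (x := expN (r • W)) (y := h)
    (by rw [logN_expN]; exact Submodule.smul_mem _ _ hW) (orthChain_succ_le i hh)).2
  have h2 := h1.2 Y hY
  have h3 := hh.2 Y hY
  rw [logN_expN, sub_lie, add_lie, smul_lie, map_sub, map_add, map_smul, h3, add_zero,
    smul_eq_mul, sub_eq_zero] at h2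
  exact h2

/-- The matrix coefficient of two equivariant functions over the coordinates `w` vanishes. -/
def IsNullCoeff (hX : IsStrongMalcev X) (F G : (jumpSet X l → ℝ) → ℂ) (J : Finset (jumpSet X l))
    (w : (jumpSet X l → ℝ) → lieGroup 𝔫) (q : lieGroup 𝔫 × lieGroup 𝔫) : Prop :=
  Integrable (fun t => lift hX l F (q.1 * w t) * (starRingEnd ℂ) (lift hX l G (q.2 * w t)))
      (partialVolume J) ∧
    ∫ t, lift hX l F (q.1 * w t) * (starRingEnd ℂ) (lift hX l G (q.2 * w t)) ∂partialVolume J = 0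

theorem stronglyMeasurable_lift (hX : IsStrongMalcev X) {F : (jumpSet X l → ℝ) → ℂ}
    (hF : StronglyMeasurable F) : StronglyMeasurable (lift hX l F) :=
  ((continuous_unitChar.comp (continuous_phase hX)).stronglyMeasurable).mul
    (hF.comp_measurable (continuous_secCoord hX).measurable)

theorem measurableSet_isNullCoeff (hX : IsStrongMalcev X) {F G : (jumpSet X l → ℝ) → ℂ}
    (hF : StronglyMeasurable F) (hG : StronglyMeasurable G) (J : Finset (jumpSet X l))
    {w : (jumpSet X l → ℝ) → lieGroup 𝔫} (hw : Continuous w) :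
    MeasurableSet {q | IsNullCoeff hX F G J w q} := by
  have h : StronglyMeasurable (Function.uncurry
      fun (q : lieGroup 𝔫 × lieGroup 𝔫) (t : jumpSet X l → ℝ) =>
        lift hX l F (q.1 * w t) * (starRingEnd ℂ) (lift hX l G (q.2 * w t))) := by
    refine ((stronglyMeasurable_lift hX hF).comp_measurable ?_).mul
      (Complex.continuous_conj.comp_stronglyMeasurable
        ((stronglyMeasurable_lift hX hG).comp_measurable ?_))
    · exact ((continuous_fst.comp continuous_fst).mul (hw.comp continuous_snd)).measurable
    · exact ((continuous_snd.comp continuous_fst).mul (hw.comp continuous_snd)).measurable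
  exact (measurableSet_integrable h).inter
    (h.integral_prod_right.measurable (measurableSet_singleton 0))

/-- Let `c = λ[W, Y] ≠ 0` and let `r` be the coordinate along `W`. Multiplying `q.1` on the right by
`exp(-(s/c) Y)` multiplies the integrand by a constant times `e^{-2πi s r}`. So the integral over
the remaining coordinates has, as a function of `r`, vanishing Fourier transform, and is zero for
almost every `r`. Right translation of both variables by `exp(rW)` then removes `r`. -/
theorem ae_isNullCoeff_of_cons (hX : IsStrongMalcev X) {F G : (jumpSet X l → ℝ) → ℂ}
    (hF : StronglyMeasurable F) (hG : StronglyMeasurable G) {i : ℕ} (hi : i < n)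
    {w : (jumpSet X l → ℝ) → lieGroup 𝔫} (hw : IsChainCoord X l (i + 1) w) {j : jumpSet X l} {W : 𝔫}
    (hW : IsAdapted X l i j W)
    (h : ∀ᵐ q ∂(rightHaar 𝔫).prod (rightHaar 𝔫),
      IsNullCoeff hX F G (laterJumps X l i) (fun t => expN (t j • W) * w t) q) :
    ∀ᵐ q ∂(rightHaar 𝔫).prod (rightHaar 𝔫),
      IsNullCoeff hX F G (laterJumps X l (i + 1)) w q := by
  classical
  obtain ⟨Y, hY, hWY⟩ := exists_form_ne_zero hW.1 hW.2.1
  set c : ℝ := l ⁅W, Y⁆ with hc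
  have hJ := laterJumps_eq_insert hi hW
  have hj := notMem_laterJumps_succ hW
  have hupd := measurePreserving_update hj
  have hwu : ∀ r t, w (Function.update t j r) = w t := fun r t =>
    hw.congr _ _ fun k hk => Function.update_of_ne (fun hkj : k = j => hj (hkj ▸ hk)) _ _
  -- Only rational `s` are taken, so that countably many null sets are discarded; continuity of the
  -- Fourier transform supplies the other values.
  have h1 : ∀ᵐ q ∂(rightHaar 𝔫).prod (rightHaar 𝔫), ∀ s : ℚ,
      IsNullCoeff hX F G (laterJumps X l i) (fun t => expN (t j • W) * w t)
        (q * (expN (((-(s / c) : ℝ)) • Y), 1)) :=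
    ae_all_iff.2 fun s => (measurePreserving_mul_right ((rightHaar 𝔫).prod (rightHaar 𝔫))
      ((expN (((-(s / c) : ℝ)) • Y), 1) : lieGroup 𝔫 × lieGroup 𝔫)).quasiMeasurePreserving.ae h
  have h2 : ∀ᵐ q ∂(rightHaar 𝔫).prod (rightHaar 𝔫), ∀ᵐ r : ℝ,
      IsNullCoeff hX F G (laterJumps X l (i + 1)) w (q * (expN (r • W), expN (r • W))) := by
    filter_upwards [h, h1] with q hq hqs
    have key : ∀ r t, ∀ x : lieGroup 𝔫, x * (expN (Function.update t j r j • W) *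
        w (Function.update t j r)) = x * expN (r • W) * w t := fun r t x => by
      rw [Function.update_self, hwu, mul_assoc]
    let ψ : ℝ × (jumpSet X l → ℝ) → ℂ := fun p =>
      lift hX l F (q.1 * expN (p.1 • W) * w p.2) *
        (starRingEnd ℂ) (lift hX l G (q.2 * expN (p.1 • W) * w p.2))
    have hψ : Integrable ψ (volume.prod (partialVolume (laterJumps X l (i + 1)))) := by
      have := hq.1
      rw [hJ] at this
      have := hupd.integrable_comp_of_integrable this
      simpa only [Function.comp_def, key] using this
    have hφ := hψ.integral_prod_left
    have hzero := ae_eq_zero_of_integral_unitChar_mul hφ fun s => by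
      have h3 := (hqs s).2
      rw [hJ, ← hupd.map_eq, integral_map hupd.measurable.aemeasurable] at h3
      rotate_left
      · have := (hqs s).1.aestronglyMeasurable
        rw [hJ] at this
        rwa [hupd.map_eq]
      have h4 : ∀ p : ℝ × (jumpSet X l → ℝ),
          lift hX l F ((q * (expN (((-(s / c) : ℝ)) • Y), 1)).1 *
            (expN (Function.update p.2 j p.1 j • W) * w (Function.update p.2 j p.1))) *
          (starRingEnd ℂ) (lift hX l G ((q * (expN (((-(s / c) : ℝ)) • Y), 1)).2 *
            (expN (Function.update p.2 j p.1 j • W) * w (Function.update p.2 j p.1)))) =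
          unitChar (-(s / c) * l Y) * (unitChar (s * p.1) * ψ p) := by
        intro p
        have h5 := lift_mul_expN_mul hX F hi hY (-(s / c)) q.1
          (h := expN (p.1 • W) * w p.2) (by
            have := (hw.cons hX hi hW).logN_mem (Function.update p.2 j p.1)
            simpa only [Function.update_self, hwu] using this)
        rw [form_logN_expN_mul hX hW.1 hY p.1 (hw.logN_mem p.2)] at h5
        simp only [Function.update_self, hwu, Prod.fst_mul, Prod.snd_mul, mul_one, h5, ψ]
        rw [show -(s / c : ℝ) * (l Y - p.1 * l ⁅W, Y⁆) = -(s / c) * l Y + s * p.1 by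
          rw [← hc]; field_simp; ring, unitChar_add, mul_assoc q.1, mul_assoc q.2]
        ring
      simp only [h4, integral_const_mul] at h3
      have h5 := (mul_eq_zero.1 h3).resolve_left fun h0 => by
        have := norm_unitChar (-(s / c) * l Y)
        rw [h0, norm_zero] at this
        exact zero_ne_one this
      have hint : Integrable (fun p : ℝ × (jumpSet X l → ℝ) => unitChar (s * p.1) * ψ p)
          (volume.prod (partialVolume (laterJumps X l (i + 1)))) :=
        hψ.bdd_mul (c := 1) (continuous_unitChar.comp
          (continuous_const.mul continuous_fst)).aestronglyMeasurable
          (Filter.Eventually.of_forall fun _ => (norm_unitChar _).le)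
      rw [integral_prod _ hint] at h5
      simpa only [integral_const_mul] using h5
    filter_upwards [hzero, hψ.prod_right_ae] with r hr hr'
    exact ⟨hr', hr⟩
  have hmeas := measurableSet_isNullCoeff hX hF hG (laterJumps X l (i + 1)) hw.continuous
  -- After exchanging the quantifiers, a single `r` is good for almost every `q`, and invariance of
  -- the measure undoes the shift by `exp(rW)`.
  rw [Measure.ae_ae_comm] at h2
  rotate_left
  · refine hmeas.preimage (f := fun p : (lieGroup 𝔫 × lieGroup 𝔫) × ℝ =>
      p.1 * (expN (p.2 • W), expN (p.2 • W))) (Continuous.measurable ?_)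
    have := (continuous_expN_smul W).comp (continuous_snd (X := lieGroup 𝔫 × lieGroup 𝔫))
    exact continuous_fst.mul (this.prodMk this)
  obtain ⟨r, hr⟩ := h2.exists
  have h3 := (measurePreserving_mul_right ((rightHaar 𝔫).prod (rightHaar 𝔫))
    ((expN (r • W), expN (r • W))⁻¹ : lieGroup 𝔫 × lieGroup 𝔫)).quasiMeasurePreserving.ae hr
  simpa only [inv_mul_cancel_right] using h3

/-- For `i ≥ n` the integration is over a point mass with `w = 1`, so the coefficient is the bare
product of the two values. Each lower `i` either changes nothing or adds one factor `exp(t_j W)`. -/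
theorem exists_isChainCoord (hX : IsStrongMalcev X) (l : Module.Dual ℝ 𝔫) (i : ℕ) :
    ∃ w, IsChainCoord X l i w ∧ ∀ F G : (jumpSet X l → ℝ) → ℂ, StronglyMeasurable F →
      StronglyMeasurable G → (∀ᵐ q ∂(rightHaar 𝔫).prod (rightHaar 𝔫),
        IsNullCoeff hX F G (laterJumps X l i) w q) →
      ∀ᵐ q ∂(rightHaar 𝔫).prod (rightHaar 𝔫), lift hX l F q.1 = 0 ∨ lift hX l G q.2 = 0 := by
  induction i using descending_induction (n := n) with
  | hn i hi =>
    refine ⟨fun _ => 1, isChainCoord_one hi, fun F G _ _ h => ?_⟩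
    filter_upwards [h] with q hq
    have := hq.2
    rw [laterJumps_eq_empty hi] at this
    simpa using this
  | hs i ih =>
    obtain ⟨w, hw, hFG⟩ := ih
    by_cases hle : orthChain X l i ≤ orthChain X l (i + 1)
    · refine ⟨w, hw.of_le hle, ?_⟩
      rw [laterJumps_eq_succ hle]
      exact hFG
    · obtain ⟨j, hj, W, hW⟩ := exists_isAdapted_of_not_le hle
      refine ⟨_, hw.cons hX i.2 (j := ⟨j, hj⟩) hW, fun F G hF hG h => hFG F G hF hG ?_⟩
      exact ae_isNullCoeff_of_cons hX hF hG i.2 hw (j := ⟨j, hj⟩) hW h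

theorem IsChainCoord.measurePreserving (hX : IsStrongMalcev X)
    {w : (jumpSet X l → ℝ) → lieGroup 𝔫} (hw : IsChainCoord X l 0 w) :
    MeasurePreserving (fun t => secCoord hX l (w t)) volume volume := by
  refine measurePreserving_of_triangular _
    ((continuous_secCoord hX).comp hw.continuous).measurable fun e t t' h => ?_
  have := hw.levelRel e t t' h
  rw [laterJumps_zero, if_pos (Finset.mem_univ _)] at this
  rw [this.secCoord hX]
  ring

/-- The characters contributed by the `P(λ)`-part of `h` are conjugate to each other and cancel, so
only the coset `h P(λ)` matters. -/
theorem lift_mul_conj_lift (hX : IsStrongMalcev X) (F G : (jumpSet X l → ℝ) → ℂ)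
    (z x h : lieGroup 𝔫) :
    lift hX l F (z * h) * (starRingEnd ℂ) (lift hX l G (x * h)) =
      lift hX l F (z * crossSection X l (secCoord hX l h)) *
        (starRingEnd ℂ) (lift hX l G (x * crossSection X l (secCoord hX l h))) := by
  conv_lhs => rw [← crossSection_mul_polPart (l := l) hX h, ← mul_assoc, ← mul_assoc,
    lift_mul hX F _ (polPart_mem hX h), lift_mul hX G _ (polPart_mem hX h), map_mul, star_unitChar]
  linear_combination (lift hX l F (z * crossSection X l (secCoord hX l h)) *
    (starRingEnd ℂ) (lift hX l G (x * crossSection X l (secCoord hX l h)))) *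
    unitChar_neg (l (logN (polPart hX l h)))

/-- The start of the descent: the integral over the cross-section may be taken along `w` instead,
since the change of coordinates is triangular. -/
theorem isNullCoeff_of_integral_eq_zero (hX : IsStrongMalcev X) {F G : (jumpSet X l → ℝ) → ℂ}
    {w : (jumpSet X l → ℝ) → lieGroup 𝔫} (hw : IsChainCoord X l 0 w)
    (hF : MemLp F 2 volume) (hG : MemLp G 2 volume) (z x : lieGroup 𝔫)
    (h : ∫ t, translate hX l z⁻¹ F t * (starRingEnd ℂ) (translate hX l x⁻¹ G t) = 0) :
    IsNullCoeff hX F G (laterJumps X l 0) w (z, x) := by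
  have hint : Integrable fun t => translate hX l z⁻¹ F t *
      (starRingEnd ℂ) (translate hX l x⁻¹ G t) :=
    (memLp_translate hX z⁻¹ hF).integrable_mul (memLp_translate hX x⁻¹ hG).star
  have hmp := hw.measurePreserving hX
  have heq : ∀ t, lift hX l F (z * w t) * (starRingEnd ℂ) (lift hX l G (x * w t)) =
      translate hX l z⁻¹ F (secCoord hX l (w t)) *
        (starRingEnd ℂ) (translate hX l x⁻¹ G (secCoord hX l (w t))) := fun t => by
    rw [lift_mul_conj_lift, translate, translate, inv_inv, inv_inv]
  rw [IsNullCoeff, laterJumps_zero, partialVolume_univ]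
  simp only [heq]
  refine ⟨hmp.integrable_comp_of_integrable hint, ?_⟩
  rw [← h]
  conv_rhs => rw [← hmp.map_eq]
  exact (integral_map hmp.measurable.aemeasurable
    (by rw [hmp.map_eq]; exact hint.aestronglyMeasurable)).symm

/-- By right invariance and Fubini there is one `z` with `lift F (z c(t)) = 0` for almost every `t`.
Its modulus is that of `F` at `secCoord (z c(t))`, and this change of variable preserves Lebesgue
measure. -/
theorem ae_eq_zero_of_lift_ae_eq_zero (hX : IsStrongMalcev X) {F : (jumpSet X l → ℝ) → ℂ}
    (hF : StronglyMeasurable F) (h : ∀ᵐ z ∂rightHaar 𝔫, lift hX l F z = 0) :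
    ∀ᵐ t, F t = 0 := by
  have h1 : ∀ᵐ t : jumpSet X l → ℝ, ∀ᵐ z ∂rightHaar 𝔫,
      lift hX l F (z * crossSection X l t) = 0 := Filter.Eventually.of_forall fun t =>
    (measurePreserving_mul_right (rightHaar 𝔫) (crossSection X l t)).quasiMeasurePreserving.ae h
  rw [Measure.ae_ae_comm] at h1
  rotate_left
  · exact (((stronglyMeasurable_lift hX hF).measurable (measurableSet_singleton 0))).preimage
      (f := fun p : (jumpSet X l → ℝ) × lieGroup 𝔫 => p.2 * crossSection X l p.1)
      (continuous_snd.mul (continuous_crossSection.comp continuous_fst)).measurable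
  obtain ⟨z, hz⟩ := h1.exists
  have hmp := measurePreserving_secCoord (l := l) hX z
  have hms : MeasurableSet {t | F t = 0} := hF.measurable (measurableSet_singleton 0)
  rw [ae_iff]
  change volume {t | F t = 0}ᶜ = 0
  rw [← hmp.measure_preimage hms.compl.nullMeasurableSet]
  rw [ae_iff] at hz
  refine measure_mono_null (fun t ht => ?_) hz
  simp only [Set.mem_ofPred_eq, Set.mem_preimage, Set.mem_compl_iff] at ht ⊢
  rw [← norm_eq_zero, norm_lift, norm_eq_zero]
  exact ht

open scoped InnerProductSpace in
/-- Two vectors of the induced representation all of whose translates are orthogonal to each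
other are not both nonzero. -/
theorem eq_zero_or_eq_zero_of_inner (hX : IsStrongMalcev X) (f g : L2 X l)
    (h : ∀ y : lieGroup 𝔫, ⟪g, transOp hX l y f⟫_ℂ = 0) : f = 0 ∨ g = 0 := by
  obtain ⟨w, hw, hFG⟩ := exists_isChainCoord hX l 0
  have hf := Lp.stronglyMeasurable f
  have hg := Lp.stronglyMeasurable g
  have hnull : ∀ z x : lieGroup 𝔫, IsNullCoeff hX f g (laterJumps X l 0) w (z, x) := by
    intro z x
    refine isNullCoeff_of_integral_eq_zero hX hw (Lp.memLp f) (Lp.memLp g) z x ?_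
    -- Unitarity turns this into the coefficient of `g` with `π(x z⁻¹) f`.
    have h1 : ⟪transOp hX l x⁻¹ g, transOp hX l z⁻¹ f⟫_ℂ = 0 := by
      have := (transOp hX l x⁻¹).inner_map_map g (transOp hX l (x * z⁻¹) f)
      rwa [← transOp_mul, inv_mul_cancel_left, h] at this
    rw [L2.inner_def] at h1
    rw [← h1]
    refine integral_congr_ae ?_
    filter_upwards [(memLp_translate hX x⁻¹ (Lp.memLp g)).coeFn_toLp,
      (memLp_translate hX z⁻¹ (Lp.memLp f)).coeFn_toLp] with t h2 h3
    change _ = ⟪(memLp_translate hX x⁻¹ (Lp.memLp g)).toLp _ t,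
      (memLp_translate hX z⁻¹ (Lp.memLp f)).toLp _ t⟫_ℂ
    rw [h2, h3]
    simp [RCLike.inner_apply]
  have hae := hFG f g hf hg (Filter.Eventually.of_forall fun q => hnull q.1 q.2)
  have hz := Measure.ae_ae_of_ae_prod hae
  by_cases hg0 : ∀ᵐ x ∂rightHaar 𝔫, lift hX l g x = 0
  · right
    exact Lp.eq_zero_iff_ae_eq_zero.2 (ae_eq_zero_of_lift_ae_eq_zero hX hg hg0)
  · left
    refine Lp.eq_zero_iff_ae_eq_zero.2 (ae_eq_zero_of_lift_ae_eq_zero hX hf ?_)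
    filter_upwards [hz] with z hz
    by_contra hne
    exact hg0 (hz.mono fun x hx => hx.resolve_left hne)

instance : Nontrivial (L2 X l) := by
  have hv : volume (Set.Icc (0 : jumpSet X l → ℝ) 1) = 1 := by simp [Real.volume_Icc_pi]
  refine ⟨indicatorConstLp 2 (measurableSet_Icc (a := (0 : jumpSet X l → ℝ)) (b := 1))
    (by rw [hv]; exact ENNReal.one_ne_top) (1 : ℂ), 0, fun h => ?_⟩
  have h1 := congrArg norm h
  rw [norm_indicatorConstLp (by norm_num) (by norm_num), Measure.real, hv] at h1
  norm_num at h1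

theorem isIrreducibleRep_inducedRep (hX : IsStrongMalcev X) (l : Module.Dual ℝ 𝔫) :
    IsIrreducibleRep (inducedRep hX l) := by
  refine ⟨inferInstance, fun V hV hinv => ?_⟩
  by_contra! hne
  have : CompleteSpace V := hV.completeSpace_coe
  obtain ⟨f, hf, hf0⟩ := V.exists_mem_ne_zero_of_ne_bot hne.1
  obtain ⟨g, hg, hg0⟩ := Vᗮ.exists_mem_ne_zero_of_ne_bot
    fun h => hne.2 (Submodule.orthogonal_eq_bot_iff.1 h)
  rcases eq_zero_or_eq_zero_of_inner hX f g fun y =>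
    V.inner_left_of_mem_orthogonal (hinv y f hf) hg with h | h
  · exact hf0 h
  · exact hg0 h

end Orthogonality
end WaveletRep
end


noncomputable section

namespace WaveletRep

/-! ### Approximation of `N` by `Γ_α`. -/

section Dilation

open Filter Topology

/-- The error is a fractional part times `a⁻ⁱ`. This is where expansiveness enters. -/
theorem tendsto_floor_mul_pow_mul_inv_pow {a : ℝ} (ha : 1 < |a|) (t : ℝ) :
    Tendsto (fun i : ℕ => (⌊t * a ^ i⌋ : ℝ) * (a⁻¹) ^ i) atTop (𝓝 t) := by
  have ha0 : a ≠ 0 := fun h => by simp [h] at ha; linarith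
  rw [tendsto_iff_norm_sub_tendsto_zero]
  refine squeeze_zero (g := fun i => |a⁻¹| ^ i) (fun _ => norm_nonneg _) (fun i => ?_)
    (tendsto_pow_atTop_nhds_zero_of_lt_one (abs_nonneg _)
      (by rw [abs_inv]; exact inv_lt_one_of_one_lt₀ ha))
  have h : (⌊t * a ^ i⌋ : ℝ) * (a⁻¹) ^ i - t = -Int.fract (t * a ^ i) * (a⁻¹) ^ i := by
    have h1 : t = t * a ^ i * (a⁻¹) ^ i := by
      rw [mul_assoc, ← mul_pow, mul_inv_cancel₀ ha0, one_pow, mul_one]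
    rw [Int.fract]
    conv_lhs => rw [sub_eq_add_neg]; arg 2; rw [h1]
    ring
  rw [h, norm_mul, norm_neg, Real.norm_eq_abs, Real.norm_eq_abs, abs_pow,
    abs_of_nonneg (Int.fract_nonneg _)]
  exact mul_le_of_le_one_left (by positivity) (Int.fract_lt_one _).le

theorem prod_map_eq_of_nodup {ι M : Type*} [Monoid M] {f : ι → M} {k : ι}
    (hf : ∀ i, i ≠ k → f i = 1) {L : List ι} (hL : L.Nodup) (hk : k ∈ L) : (L.map f).prod = f k := by
  induction L with
  | nil => exact absurd hk List.not_mem_nil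
  | cons i L ih =>
    rw [List.map_cons, List.prod_cons]
    rw [List.nodup_cons] at hL
    rcases List.mem_cons.1 hk with rfl | hk
    · rw [List.prod_eq_one, mul_one]
      intro x hx
      obtain ⟨j, hj, rfl⟩ := List.mem_map.1 hx
      exact hf j fun h => hL.1 (h ▸ hj)
    · rw [ih hL.2 hk, hf i fun h => hL.1 (h ▸ hk), one_mul]

variable {m n : ℕ} {𝔫 : LieSubalgebra ℝ (Matrix (Fin m) (Fin m) ℝ)}
  {X : Module.Basis (Fin n) ℝ 𝔫} {l : Module.Dual ℝ 𝔫}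

theorem one_lt_abs_of_isExpansive {A : 𝔫 →ₗ[ℝ] 𝔫} {a : Fin n → ℝ}
    (hA : ∀ k, A (X k) = a k • X k) (h : IsExpansive (LinearMap.toMatrix X X A)) (k : Fin n) :
    1 < |a k| := by
  have hd : (LinearMap.toMatrix X X A).map (algebraMap ℝ ℂ) =
      Matrix.diagonal fun k => (a k : ℂ) := by
    ext i j
    rw [Matrix.map_apply, LinearMap.toMatrix_apply, hA, map_smul, Module.Basis.repr_self,
      Finsupp.smul_apply, Matrix.diagonal_apply, Finsupp.single_apply]
    by_cases hij : i = j
    · subst hij; simp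
    · simp [hij, Ne.symm hij]
  have := h (a k) (by rw [hd, spectrum_diagonal]; exact ⟨k, rfl⟩)
  rwa [Complex.norm_real] at this

theorem expN_int_smul_basis (k : Fin n) (N : ℤ) :
    malcevCoord X (fun i => ((Pi.single k N : Fin n → ℤ) i : ℝ)) = expN ((N : ℝ) • X k) := by
  rw [malcevCoord, prod_map_eq_of_nodup (k := k) (fun i hi => ?_) (List.nodup_finRange n)
    (List.mem_finRange k), Pi.single_eq_same]
  rw [Pi.single_eq_of_ne hi, Int.cast_zero, zero_smul, expN_zero]

/-- The element is the image of `exp(N X_k) ∈ Γ` under the negative power `α⁻ⁱ`. -/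
theorem expN_mem_dilationClosure {Γ : Subgroup (lieGroup 𝔫)}
    (hΓ : (Γ : Set (lieGroup 𝔫)) = Set.range fun k : Fin n → ℤ => malcevCoord X fun i => (k i : ℝ))
    {A : 𝔫 ≃ₗ⁅ℝ⁆ 𝔫} {a : Fin n → ℝ} (hA : ∀ k, A (X k) = a k • X k)
    {α : MulAut (lieGroup 𝔫)} (hα : ∀ Y : 𝔫, α (expN Y) = expN (A Y)) {k : Fin n} (ha : a k ≠ 0)
    (N : ℤ) (i : ℕ) : expN (((N : ℝ) * ((a k)⁻¹) ^ i) • X k) ∈ dilationClosure α Γ := by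
  have h1 : ∀ (i : ℕ) (c : ℝ), (α ^ i) (expN (c • X k)) = expN ((c * a k ^ i) • X k) := by
    intro i
    induction i with
    | zero => intro c; simp
    | succ i ih =>
      intro c
      rw [pow_succ, MulAut.mul_apply, hα, map_smul, hA, smul_smul, ih]
      congr 2
      ring
  refine Subgroup.subset_closure (Set.mem_iUnion.2 ⟨-(i : ℤ), expN ((N : ℝ) • X k), ?_, ?_⟩)
  · rw [hΓ]
    exact ⟨Pi.single k N, expN_int_smul_basis k N⟩
  · dsimp only
    rw [zpow_neg, zpow_natCast, MulAut.inv_apply, MulEquiv.symm_apply_eq, h1, mul_assoc, ← mul_pow,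
      inv_mul_cancel₀ ha, one_pow, mul_one]

variable [IsNilMatrixAlgebra 𝔫]

/-- The one-parameter subgroups of a strong Malcev basis generate `N`. -/
theorem mem_of_expN_smul_basis_mem (hX : IsStrongMalcev X) {S : Submonoid (lieGroup 𝔫)}
    (hS : ∀ (k : Fin n) (t : ℝ), expN (t • X k) ∈ S) (x : lieGroup 𝔫) : x ∈ S := by
  have step : ∀ k : Fin n, (∀ x ∈ level X k, x ∈ S) → ∀ x ∈ level X (k + 1), x ∈ S := by
    intro k ih x hx
    have hb : expN (-lead X k x • X k) ∈ level X (k + 1) :=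
      expN_mem_level (Submodule.smul_mem _ _ (basis_mem_flag k))
    have h1 : x * expN (-lead X k x • X k) ∈ level X k := by
      rw [mem_level_iff_lead_eq_zero (mul_mem_level hX hx hb), lead_mul hX hx hb,
        lead_expN_smul_basis, add_neg_cancel]
    have h2 := mul_mem (ih _ h1) (hS k (lead X k x))
    rwa [neg_smul, expN_neg, inv_mul_cancel_right] at h2
  have key : ∀ i ≤ n, ∀ x ∈ level X i, x ∈ S := by
    intro i
    induction i with
    | zero => intro _ x hx; rw [eq_one_of_mem_level_zero hx]; exact one_mem S
    | succ i ih => intro hi; exact step ⟨i, hi⟩ (ih (by omega))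
  exact key n le_rfl x (mem_level_of_le le_rfl x)

/-- A closed subspace invariant under a subgroup with the points `exp (N a_k⁻ⁱ X_k)` is invariant
under `N`. -/
theorem mem_of_dilationClosure_invariant (hX : IsStrongMalcev X) {H : Type*} [NormedAddCommGroup H]
    [InnerProductSpace ℂ H] {π : lieGroup 𝔫 →* (H ≃ₗᵢ[ℂ] H)} (hπ : IsStronglyContinuous π)
    {V : Submodule ℂ H} (hV : IsClosed (V : Set H)) {Δ : Subgroup (lieGroup 𝔫)} {a : Fin n → ℝ}
    (ha : ∀ k, 1 < |a k|)
    (hΔ : ∀ (k : Fin n) (N : ℤ) (i : ℕ), expN (((N : ℝ) * ((a k)⁻¹) ^ i) • X k) ∈ Δ)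
    (hinv : ∀ x ∈ Δ, ∀ f ∈ V, π x f ∈ V) (x : lieGroup 𝔫) : ∀ f ∈ V, π x f ∈ V := by
  -- Stability under inverses is not evident for the elements that map `V` into itself; a submonoid
  -- is enough.
  let S : Submonoid (lieGroup 𝔫) :=
    { carrier := {x | ∀ f ∈ V, π x f ∈ V}
      one_mem' := fun f hf => by simpa using hf
      mul_mem' := fun {x y} hx hy f hf => by
        rw [map_mul]
        exact hx _ (hy f hf) }
  refine mem_of_expN_smul_basis_mem hX (S := S) (fun k t f hf => ?_) x
  have hc : Continuous fun s : ℝ => π (expN (s • X k)) f := (hπ f).comp (continuous_expN_smul (X k))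
  exact hV.mem_of_tendsto ((hc.tendsto t).comp (tendsto_floor_mul_pow_mul_inv_pow (ha k) t))
    (Eventually.of_forall fun i => hinv _ (hΔ k _ i) f hf)

end Dilation
end WaveletRep
end

open WaveletRep in
theorem mainTheorem2 {m n : ℕ} (𝔫 : LieSubalgebra ℝ (Matrix (Fin m) (Fin m) ℝ))
    (hnil : ∀ X ∈ 𝔫, IsNilpotent X)
    (X : Module.Basis (Fin n) ℝ 𝔫) (hX : IsStrongMalcev X)
    (Γ : Subgroup (lieGroup 𝔫))
    (hΓ : (Γ : Set (lieGroup 𝔫)) = Set.range fun k : Fin n → ℤ => malcevCoord X fun i => (k i : ℝ))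
    (A : 𝔫 ≃ₗ⁅ℝ⁆ 𝔫) (a : Fin n → ℝ) (hA : ∀ k, A (X k) = a k • X k)
    (α : MulAut (lieGroup 𝔫)) (hα : ∀ Y : 𝔫, α (expN Y) = expN (A Y))
    (hexp : IsExpansive (LinearMap.toMatrix X X (A : 𝔫 →ₗ[ℝ] 𝔫)))
    (l : Module.Dual ℝ 𝔫) :
    (∃! π : lieGroup 𝔫 →* (L2 X l ≃ₗᵢ[ℂ] L2 X l), IsInducedRep X l π) ∧
    ∀ π : lieGroup 𝔫 →* (L2 X l ≃ₗᵢ[ℂ] L2 X l), IsInducedRep X l π →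
      IsStronglyContinuous π ∧ IsIrreducibleRep π ∧
        IsIrreducibleRep (π.comp (dilationClosure α Γ).subtype) := by
  have : IsNilMatrixAlgebra 𝔫 := ⟨hnil⟩
  have ha : ∀ k, 1 < |a k| := one_lt_abs_of_isExpansive (X := X) hA hexp
  have ha0 : ∀ k, a k ≠ 0 := fun k h => by
    have := ha k
    rw [h, abs_zero] at this
    exact absurd this (by norm_num)
  refine ⟨⟨inducedRep hX l, isInducedRep_inducedRep hX l, fun π hπ => eq_inducedRep hX hπ⟩,
    fun π hπ => ?_⟩
  rw [eq_inducedRep hX hπ]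
  have hcont := isStronglyContinuous_inducedRep hX l
  have hirr := isIrreducibleRep_inducedRep hX l
  refine ⟨hcont, hirr, hirr.1, fun V hV hinv => hirr.2 V hV ?_⟩
  exact mem_of_dilationClosure_invariant hX hcont hV ha
    (fun k N i => expN_mem_dilationClosure hΓ hA hα (ha0 k) N i) fun x hx f hf => hinv ⟨x, hx⟩ f hf
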